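/- Let $G(x)=\tfrac12 e^{-|x|}$. Let $L>0$ and let $m_0$ be a finite signed Radon measure on $\mathbb R$ with $\operatorname{supp} m_0\subset(-L,L)$. Let $\rho\in C^k(\mathbb R)$, $k\ge 2$, be nonnegative and even, with $\int_{\mathbb R}\rho=1$ and $\operatorname{supp}\rho\subset\{|x|<1\}$. For $\epsilon>0$ put $\rho_\epsilon(x)=\tfrac1\epsilon\rho(\tfrac x\epsilon)$, $G^\epsilon=\rho_\epsilon * G$ and, for a function $Y$ on $[-L,L]$, $$U_\epsilon(x;Y)=\Big(\int_{[-L,L]}G^\epsilon(x-Y(\theta))\,dm_0(\theta)\Big)^2-\Big(\int_{[-L,L]}G^\epsilon_x(x-Y(\theta))\,dm_0(\theta)\Big)^2,\qquad U^\epsilon(\cdot\,;Y)=\rho_\epsilon * U_\epsilon(\cdot\,;Y).$$ (1) For every $\epsilon>0$ there is a unique $X^\epsilon\in C([-L,L]\times[0,\infty))$ with $$\partial_tX^\epsilon(\xi,t)=U^\epsilon\big(X^\epsilon(\xi,t);X^\epsilon(\cdot,t)\big),\quad X^\epsilon(\xi,0)=\xi\qquad(\xi\in[-L,L],\ t\ge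 0).$$ Put $u^\epsilon(x,t)=\int_{[-L,L]}G^\epsilon(x-X^\epsilon(\theta,t))\,dm_0(\theta)$ and $m^\epsilon=u^\epsilon-u^\epsilon_{xx}$. (2) Every sequence $\epsilon_n>0$ with $\epsilon_n\to0$ has a subsequence (not relabelled) for which there is a function $u$ on $\mathbb R\times[0,\infty)$, with weak space derivative $u_x$, such that (a) $u^{\epsilon_n}\to u$ and $u_x^{\epsilon_n}\to u_x$ in $L^1_{loc}(\mathbb R\times[0,\infty))$. (b) $u\in C([0,\infty);H^1(\mathbb R))\cap L^\infty(0,\infty;W^{1,\infty}(\mathbb R))$, and $u$ is a global weak solution of the modified Camassa–Holm equation $m_t+[(u^2-u_x^2)m]_x=0$, $m=u-u_{xx}$, with initial datum $m_0$, i.e. for all $\phi\in C_c^\infty(\mathbb R\times[0,\infty))$ $$\int_0^\infty\!\!\int_{\mathbb R}\Big[u(\phi_t-\phi_{txx})-\tfrac13u_x^3\phi_{xx}-\tfrac13u^3\phi_{xxx}+(u^3+uu_x^2)\phi_x\Big]dx\,dt=-\int_{\mathbb R}\phi(x,0)\,dm_0(x).$$ (c) For every $T>0$: $u$ and $u_x$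 belong to $BV(\mathbb R\times[0,T))$, that is, they are integrable on $\mathbb R\times(0,T)$ and have finite total variation there; and $m=(1-\partial_{xx})u$ is a finite signed Radon measure on $\mathbb R\times[0,T)$, that is, $\int\phi\,dm=\int_0^T\!\int_{\mathbb R}u(\phi-\phi_{xx})\,dx\,dt$ for all $\phi\in C_c^\infty(\mathbb R\times[0,T))$; and $m^{\epsilon_n}\,dx\,dt\to m$ weakly-* as measures on $\mathbb R\times[0,T)$ (tested with $C_0(\mathbb R\times[0,T))$). -/

import Mathlib

open Real Set Filter Topology MeasureTheory Function
open scoped ENNReal NNReal ContDiff Convolution ZeroAtInfty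

namespace MCH

noncomputable section

/-! ### Calculus for functions `f : ℝ → ℝ → ℝ` of space `x` and time `t` -/

/-- Partial derivative in space. -/
def dx (f : ℝ → ℝ → ℝ) : ℝ → ℝ → ℝ := fun x t => deriv (fun y => f y t) x

/-- Partial derivative in time. -/
def dt (f : ℝ → ℝ → ℝ) : ℝ → ℝ → ℝ := fun x t => deriv (fun s => f x s) t

/-- The space-time strip `ℝ × [0, T)`. -/
def strip (T : ℝ) : Set (ℝ × ℝ) := univ ×ˢ Ico 0 T

/-- `φ` is smooth with compact support contained in `Ω`. For `Ω = ℝ × (-∞, T)`, the restrictions of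
such `φ` to times `t ≥ 0` are exactly the elements of `C_c^∞(ℝ × [0, T))`; for `Ω = ℝ × ℝ` they are
the elements of `C_c^∞(ℝ × [0, ∞))`. -/
def IsTestFunction (Ω : Set (ℝ × ℝ)) (φ : ℝ → ℝ → ℝ) : Prop :=
  ContDiff ℝ ∞ (uncurry φ) ∧ HasCompactSupport (uncurry φ) ∧ tsupport (uncurry φ) ⊆ Ω

/-- `g` is the weak (distributional) derivative of `f` on `ℝ`. -/
def HasWeakDeriv (f g : ℝ → ℝ) : Prop :=
  LocallyIntegrable f ∧ LocallyIntegrable g ∧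
    ∀ ψ : ℝ → ℝ, ContDiff ℝ ∞ ψ → HasCompactSupport ψ →
      ∫ x, f x * deriv ψ x = -∫ x, g x * ψ x

/-! ### Function spaces. Throughout, `v` plays the role of `u_x`. -/

/-- The `H¹(ℝ)` norm of a function `f` with weak derivative `g`. -/
def h1Norm (f g : ℝ → ℝ) : ℝ≥0∞ :=
  (eLpNorm f 2 volume ^ 2 + eLpNorm g 2 volume ^ 2) ^ (1 / 2 : ℝ)

/-- `u ∈ C([0, ∞); H¹(ℝ))`, where `v(·, t)` is the weak derivative of `u(·, t)`. -/
def IsContinuousH1 (u v : ℝ → ℝ → ℝ) : Prop :=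
  (∀ t, 0 ≤ t →
    MemLp (fun x => u x t) 2 volume ∧ MemLp (fun x => v x t) 2 volume ∧
      HasWeakDeriv (fun x => u x t) (fun x => v x t)) ∧
  ∀ s, 0 ≤ s →
    Tendsto (fun t => h1Norm (fun x => u x t - u x s) (fun x => v x t - v x s))
      (𝓝[Ici 0] s) (𝓝 0)

/-- `u ∈ L^∞(0, ∞; W^{1,∞}(ℝ))`, where `v(·, t)` is the weak derivative of `u(·, t)`. -/
def IsBoundedW1Inf (u v : ℝ → ℝ → ℝ) : Prop :=
  AEStronglyMeasurable (uncurry u) (volume.restrict (univ ×ˢ Ioi 0)) ∧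
  AEStronglyMeasurable (uncurry v) (volume.restrict (univ ×ˢ Ioi 0)) ∧
  ∃ C : ℝ≥0, ∀ᵐ t ∂(volume.restrict (Ioi (0 : ℝ))),
    HasWeakDeriv (fun x => u x t) (fun x => v x t) ∧
    eLpNorm (fun x => u x t) ⊤ volume ≤ C ∧ eLpNorm (fun x => v x t) ⊤ volume ≤ C

/-- `(φ₁, φ₂) ∈ C_c^1(Ω; ℝ²)` with `‖(φ₁, φ₂)‖_{L^∞} ≤ 1`. -/
def IsTestField (Ω : Set (ℝ × ℝ)) (φ₁ φ₂ : ℝ → ℝ → ℝ) : Prop :=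
  (ContDiff ℝ 1 (uncurry φ₁) ∧ HasCompactSupport (uncurry φ₁) ∧ tsupport (uncurry φ₁) ⊆ Ω) ∧
  (ContDiff ℝ 1 (uncurry φ₂) ∧ HasCompactSupport (uncurry φ₂) ∧ tsupport (uncurry φ₂) ⊆ Ω) ∧
  ∀ x t, √(φ₁ x t ^ 2 + φ₂ x t ^ 2) ≤ 1

/-- The total variation of `f` in the open set `Ω ⊆ ℝ²`: the supremum of `∫_Ω f div φ`. -/
def totVar (f : ℝ → ℝ → ℝ) (Ω : Set (ℝ × ℝ)) : ℝ≥0∞ :=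
  ⨆ (φ₁ : ℝ → ℝ → ℝ) (φ₂ : ℝ → ℝ → ℝ) (_ : IsTestField Ω φ₁ φ₂),
    ENNReal.ofReal (∫ p in Ω, f p.1 p.2 * (dx φ₁ p.1 p.2 + dt φ₂ p.1 p.2))

/-- `f ∈ BV(Ω)`. -/
def IsBV (f : ℝ → ℝ → ℝ) (Ω : Set (ℝ × ℝ)) : Prop :=
  IntegrableOn (uncurry f) Ω ∧ totVar f Ω < ⊤

/-- `f n → g` in `L¹_loc(ℝ × [0, ∞))`. -/
def TendstoL1Loc (f : ℕ → ℝ → ℝ → ℝ) (g : ℝ → ℝ → ℝ) : Prop :=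
  ∀ K : Set (ℝ × ℝ), IsCompact K → K ⊆ univ ×ˢ Ici 0 →
    Tendsto (fun n => eLpNorm (uncurry (f n) - uncurry g) 1 (volume.restrict K)) atTop (𝓝 0)

/-! ### Weak solutions -/

/-- The functional `ℒ(u, φ)` of the weak formulation on `[0, ∞)`, where `v = u_x`. -/
def weakFunctional (u v φ : ℝ → ℝ → ℝ) : ℝ :=
  (∫ t in Ioi (0 : ℝ), ∫ x, u x t * (dt φ x t - dx (dx (dt φ)) x t))
  - 1 / 3 * (∫ t in Ioi (0 : ℝ), ∫ x, v x t ^ 3 * dx (dx φ) x t)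
  - 1 / 3 * (∫ t in Ioi (0 : ℝ), ∫ x, u x t ^ 3 * dx (dx (dx φ)) x t)
  + ∫ t in Ioi (0 : ℝ), ∫ x, (u x t ^ 3 + u x t * v x t ^ 2) * dx φ x t

/-- `u`, with weak space derivative `v = u_x`, is a global weak solution of
`m_t + [(u² - u_x²) m]_x = 0`, `m = u - u_xx`, with `m(·, 0) = m₀`. -/
structure IsGlobalWeakSolution (m₀ : SignedMeasure ℝ) (u v : ℝ → ℝ → ℝ) : Prop where
  continuousH1 : IsContinuousH1 u v
  boundedW1Inf : IsBoundedW1Inf u v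
  weak : ∀ φ : ℝ → ℝ → ℝ, IsTestFunction univ φ →
    weakFunctional u v φ = -∫ᵛ x, φ x 0 ∂•m₀

/-- The finite signed Radon measure `m` on `ℝ × [0, T)` is the distribution `(1 - ∂_xx) u`. -/
def IsHelmholtzMeasure (T : ℝ) (u : ℝ → ℝ → ℝ) (m : SignedMeasure (strip T)) : Prop :=
  ∀ φ : ℝ → ℝ → ℝ, IsTestFunction (univ ×ˢ Iio T) φ →
    ∫ᵛ p, φ p.1.1 p.1.2 ∂•m = ∫ p in strip T, u p.1 p.2 * (φ p.1 p.2 - dx (dx φ) p.1 p.2)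

/-- The measures `f n dx dt` converge weakly-* to `m` in `ℳ(ℝ × [0, T))`, the dual of
`C₀(ℝ × [0, T))`. -/
def TendstoWeakStar (T : ℝ) (f : ℕ → ℝ → ℝ → ℝ) (m : SignedMeasure (strip T)) : Prop :=
  (∀ n, IntegrableOn (uncurry (f n)) (strip T)) ∧
  ∀ φ : C₀(strip T, ℝ),
    Tendsto (fun n => ∫ p : strip T, φ p * f n p.1.1 p.1.2 ∂volume.comap Subtype.val)
      atTop (𝓝 (∫ᵛ p, φ p ∂•m))

/-! ### Regularized Lagrangian dynamics -/

/-- The fundamental solution of `1 - ∂_xx`. -/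
def G (x : ℝ) : ℝ := 1 / 2 * exp (-|x|)

structure IsMollifier (ρ : ℝ → ℝ) : Prop where
  contDiff : ContDiff ℝ 2 ρ
  nonneg : ∀ x, 0 ≤ ρ x
  integral_eq_one : ∫ x, ρ x = 1
  even : ∀ x, ρ (-x) = ρ x
  support : tsupport ρ ⊆ {x | |x| < 1}

/-- `ρ_ε(x) = ρ(x / ε) / ε`. -/
def rhoEps (ρ : ℝ → ℝ) (ε : ℝ) : ℝ → ℝ := fun x => 1 / ε * ρ (x / ε)

/-- `G^ε = ρ_ε * G`. -/
def GEps (ρ : ℝ → ℝ) (ε : ℝ) : ℝ → ℝ := rhoEps ρ ε ⋆ G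

/-- `U_ε(x; Y)` for a position field `Y` on the labels `[-L, L]`. -/
def preVelocity (ρ : ℝ → ℝ) (L : ℝ) (m₀ : SignedMeasure ℝ) (ε : ℝ) (Y : ℝ → ℝ) : ℝ → ℝ :=
  fun x => (∫ᵛ θ in Icc (-L) L, GEps ρ ε (x - Y θ) ∂•m₀) ^ 2
    - (∫ᵛ θ in Icc (-L) L, deriv (GEps ρ ε) (x - Y θ) ∂•m₀) ^ 2

/-- `U^ε(·; Y) = ρ_ε * U_ε(·; Y)`. -/
def velocity (ρ : ℝ → ℝ) (L : ℝ) (m₀ : SignedMeasure ℝ) (ε : ℝ) (Y : ℝ → ℝ) : ℝ → ℝ :=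
  rhoEps ρ ε ⋆ preVelocity ρ L m₀ ε Y

/-- `X ∈ C([-L, L] × [0, ∞))` solves `∂_t X(ξ, t) = U^ε(X(ξ, t); X(·, t))`, `X(ξ, 0) = ξ`. -/
structure IsRegularizedFlow (ρ : ℝ → ℝ) (L : ℝ) (m₀ : SignedMeasure ℝ) (ε : ℝ)
    (X : ℝ → ℝ → ℝ) : Prop where
  continuousOn : ContinuousOn (uncurry X) (Icc (-L) L ×ˢ Ici 0)
  initial : ∀ ξ ∈ Icc (-L) L, X ξ 0 = ξ
  ode : ∀ ξ ∈ Icc (-L) L, ∀ t, 0 ≤ t →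
    HasDerivWithinAt (fun s => X ξ s) (velocity ρ L m₀ ε (fun θ => X θ t) (X ξ t)) (Ici 0) t

/-- `u^ε(x, t) = ∫_{[-L, L]} G^ε(x - X(θ, t)) dm₀(θ)`. -/
def uEps (ρ : ℝ → ℝ) (L : ℝ) (m₀ : SignedMeasure ℝ) (ε : ℝ) (X : ℝ → ℝ → ℝ) : ℝ → ℝ → ℝ :=
  fun x t => ∫ᵛ θ in Icc (-L) L, GEps ρ ε (x - X θ t) ∂•m₀

/-- `m^ε = u^ε - u^ε_xx`. -/
def mEps (ρ : ℝ → ℝ) (L : ℝ) (m₀ : SignedMeasure ℝ) (ε : ℝ) (X : ℝ → ℝ → ℝ) : ℝ → ℝ → ℝ :=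
  fun x t => uEps ρ L m₀ ε X x t - dx (dx (uEps ρ L m₀ ε X)) x t

end

end MCH

/-!
# Lagrangian construction of weak solutions of the modified Camassa–Holm equation

Write `m₀ = w μ` with `|w| = 1`, so that every integral against `m₀` is an integral against a finite
positive measure (`MCH.exists_isPolar`). For a kernel `g` and positions `Y`, all quantities of
interest are superpositions of translates `∫ g (x - Y θ) w θ dμ(θ)` (`MCH.layer`): `u^ε`, `u^ε_x` and
`m^ε` come from `G^ε`, its derivative and `ρ_ε`.

*Existence and uniqueness.* For fixed `ε` the velocity is bounded and Lipschitz in the position and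
in the configuration. The dynamics is thus an ordinary differential equation with bounded Lipschitz
right-hand side in the Banach space `C([-L, L])` (`MCH.IsPolar.exists_isRegularizedFlow`,
`MCH.IsRegularizedFlow.unique`).

*Compactness.* Trajectories do not cross, so each flow is monotone in the label; the velocity is
bounded uniformly in `ε` by `(|m₀|(ℝ) / 2)²`, so each flow is Lipschitz in time. Helly's selection
theorem at rational times gives a subsequence along which the flows converge at *every* label and
time, to some `X` (`MCH.exists_subseq_tendsto_flow`). The solution is `u = ∫ G (x - X(θ, t)) dm₀(θ)`.
By dominated convergence `u^ε → u` everywhere. The kernel of `u_x` jumps at the origin only, and at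
each time only countably many points `x` satisfy `|m₀| {θ | X(θ, t) = x} > 0`, so `u^ε_x → u_x`
almost everywhere.

*Regularity.* Both `G` and its derivative have an `L¹` modulus of continuity that is linear in the
shift, and `X` is Lipschitz in time. Difference quotients of `u` and `u_x` in space and in time are
therefore bounded in `L¹`, which yields `BV` and the continuity in `H¹`.

*The equation.* Along a regularized trajectory, the time derivative of `φ(X^ε, t)` is
`φ_t + U^ε φ_x`; integrating it gives the weak formulation for `ε > 0`
(`MCH.IsRegularizedFlow.integral_transport`). Moving the outer mollifier of `U^ε` onto `m` costs
`O(ε)`, because `φ_x` is Lipschitz and `U_ε` bounded, and leaves `∫ (u² - u_x²) m φ_x dx` for smooth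
`u`. An integration by parts puts this in a form with no `m`
(`MCH.IsPolar.exists_abs_flux_sub_le`), which passes to the limit by dominated convergence
(`MCH.IsMotion.isGlobalWeakSolution`).

*The momentum.* `m` is the image of `m₀ ⊗ dt` under `(θ, t) ↦ (X(θ, t), t)`
(`MCH.IsMotion.exists_momentum`). Since `G` is the fundamental solution of `1 - ∂_xx`, Fubini's
theorem identifies it with `(1 - ∂_xx) u`. Testing `m^ε` with `φ` is testing the analogous image
measure of the regularized flow with `ρ_ε * φ`, so weak-* convergence follows from pointwise
convergence of the flows (`MCH.tendstoWeakStar_mEps`).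
-/

namespace MCH

noncomputable section

/-! ### Polar decomposition of signed measures -/

instance isFiniteMeasure_variation {α : Type*} [MeasurableSpace α] (m : SignedMeasure α) :
    IsFiniteMeasure m.variation := by
  rw [← SignedMeasure.totalVariation_eq_variation, SignedMeasure.totalVariation]
  infer_instance

theorem integral_lsmul_toSignedMeasure {α : Type*} [MeasurableSpace α] (μ : Measure α)
    [IsFiniteMeasure μ] (f : α → ℝ) : ∫ᵛ x, f x ∂•μ.toSignedMeasure = ∫ x, f x ∂μ := by
  have h : (ContinuousLinearMap.lsmul ℝ ℝ : ℝ →L[ℝ] ℝ →L[ℝ] ℝ)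
      = (ContinuousLinearMap.lsmul ℝ ℝ : ℝ →L[ℝ] ℝ →L[ℝ] ℝ).flip := by
    ext; simp
  rw [h]
  exact VectorMeasure.integral_toSignedMeasure

/-- A signed measure has a density with values `±1` with respect to its variation. As the density
does not vanish, the formula holds for non-integrable functions too. -/
theorem exists_polar {α : Type*} [MeasurableSpace α] (m : SignedMeasure α) :
    ∃ w : α → ℝ, Measurable w ∧ (∀ x, |w x| = 1) ∧
      ∀ f : α → ℝ, ∫ᵛ x, f x ∂•m = ∫ x, f x * w x ∂m.variation := by
  classical
  set j := m.toJordanDecomposition with hj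
  have hv : m.variation = j.posPart + j.negPart := by
    rw [← SignedMeasure.totalVariation_eq_variation]; rfl
  have hm : m = j.posPart.toSignedMeasure - j.negPart.toSignedMeasure :=
    m.toSignedMeasure_toJordanDecomposition.symm
  obtain ⟨S, hS, hP, hN⟩ := j.mutuallySingular
  have hw : Measurable (fun x => if x ∈ S then (-1 : ℝ) else 1) :=
    Measurable.ite hS measurable_const measurable_const
  have hw1 : ∀ x, |(if x ∈ S then (-1 : ℝ) else 1)| = 1 := fun x => by split_ifs <;> simp
  refine ⟨fun x => if x ∈ S then -1 else 1, hw, hw1, fun f => ?_⟩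
  have hPw : ∀ᵐ x ∂j.posPart, f x * (if x ∈ S then (-1 : ℝ) else 1) = f x := by
    have : ∀ᵐ x ∂j.posPart, x ∉ S := measure_eq_zero_iff_ae_notMem.1 hP
    filter_upwards [this] with x hx
    simp [hx]
  have hNw : ∀ᵐ x ∂j.negPart, f x * (if x ∈ S then (-1 : ℝ) else 1) = -f x := by
    have : ∀ᵐ x ∂j.negPart, x ∉ Sᶜ := measure_eq_zero_iff_ae_notMem.1 hN
    filter_upwards [this] with x hx
    have hx : x ∈ S := not_not.1 hx
    simp [hx]
  by_cases hf : Integrable f m.variation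
  · have hfw : Integrable (fun x => f x * (if x ∈ S then (-1 : ℝ) else 1)) m.variation := by
      refine hf.mono (hf.aestronglyMeasurable.mul hw.aestronglyMeasurable) ?_
      filter_upwards with x
      rw [norm_mul, Real.norm_eq_abs (ite _ _ _), hw1, mul_one]
    have hfP : Integrable f j.posPart := hf.mono_measure (hv ▸ Measure.le_add_right le_rfl)
    have hfN : Integrable f j.negPart := hf.mono_measure (hv ▸ Measure.le_add_left le_rfl)
    have h1 : ∫ᵛ x, f x ∂•m = ∫ x, f x ∂j.posPart - ∫ x, f x ∂j.negPart := by
      conv_lhs => rw [hm]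
      rw [VectorMeasure.integral_sub_vectorMeasure, integral_lsmul_toSignedMeasure,
        integral_lsmul_toSignedMeasure]
      · simpa [VectorMeasure.Integrable] using hfP
      · simpa [VectorMeasure.Integrable] using hfN
    rw [h1, hv, integral_add_measure]
    · rw [integral_congr_ae hPw, integral_congr_ae hNw, integral_neg, sub_eq_add_neg]
    · exact hfw.mono_measure (hv ▸ Measure.le_add_right le_rfl)
    · exact hfw.mono_measure (hv ▸ Measure.le_add_left le_rfl)
  · rw [VectorMeasure.integral_undef hf, integral_undef]
    intro h
    refine hf ?_
    have h2 := h.mono (f := f) ?_ ?_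
    · exact h2
    · have := h.aestronglyMeasurable.mul hw.aestronglyMeasurable (μ := m.variation)
      refine this.congr ?_
      filter_upwards with x
      have := hw1 x
      simp only [Pi.mul_apply]
      split_ifs <;> simp
    · filter_upwards with x
      rw [norm_mul, Real.norm_eq_abs (ite _ _ _), hw1, mul_one]

/-- The measure `μ` and the density `w` with values `±1` form a polar decomposition of the signed
measure `m₀`, which is carried by `[-L, L]`. -/
structure IsPolar (m₀ : SignedMeasure ℝ) (L : ℝ) (μ : Measure ℝ) (w : ℝ → ℝ) : Prop where
  measurable : Measurable w
  abs_eq_one : ∀ x, |w x| = 1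
  mem_Icc : ∀ᵐ θ ∂μ, θ ∈ Icc (-L) L
  integral_eq : ∀ f : ℝ → ℝ, ∫ᵛ x, f x ∂•m₀ = ∫ x, f x * w x ∂μ
  setIntegral_eq : ∀ f : ℝ → ℝ, ∫ᵛ x in Icc (-L) L, f x ∂•m₀ = ∫ x, f x * w x ∂μ

theorem exists_isPolar (m₀ : SignedMeasure ℝ) (L : ℝ)
    (hm₀ : m₀.variation.support ⊆ Ioo (-L) L) :
    ∃ (μ : Measure ℝ) (w : ℝ → ℝ), IsFiniteMeasure μ ∧ IsPolar m₀ L μ w := by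
  obtain ⟨w, hw, hw1, hf⟩ := exists_polar m₀
  have hsupp : ∀ᵐ θ ∂m₀.variation, θ ∈ Icc (-L) L := by
    filter_upwards [Measure.support_mem_ae (μ := m₀.variation)] with x hx
    exact Ioo_subset_Icc_self (hm₀ hx)
  have hres : m₀.restrict (Icc (-L) L) = m₀ := by
    ext s hs
    rw [VectorMeasure.restrict_apply _ measurableSet_Icc hs]
    have h0 : m₀ (s \ Icc (-L) L) = 0 := by
      have h1 : m₀.variation (s \ Icc (-L) L) = 0 :=
        measure_mono_null (fun x hx => hx.2) hsupp
      have h2 := VectorMeasure.norm_measure_le_variation (μ := m₀) (E := s \ Icc (-L) L)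
        (measure_ne_top _ _)
      rw [measureReal_def, h1] at h2
      simpa using h2
    have h3 := VectorMeasure.of_union (v := m₀) (A := s ∩ Icc (-L) L) (B := s \ Icc (-L) L)
      disjoint_sdiff_inter.symm (hs.inter measurableSet_Icc) (hs.diff measurableSet_Icc)
    rw [inter_union_sdiff, h0, add_zero] at h3
    exact h3.symm
  exact ⟨m₀.variation, w, inferInstance, hw, hw1, hsupp, hf, fun f => by rw [hres]; exact hf f⟩

/-! ### The mollifier and the mollified kernels -/

/-- The derivative of `G` away from the origin, with the symmetric value `0` at the origin. -/
def dG (x : ℝ) : ℝ := -(SignType.sign x : ℝ) * G x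

/-- The derivative `ρ_ε * G'` of `G^ε = ρ_ε * G`. -/
def dGEps (ρ : ℝ → ℝ) (ε : ℝ) : ℝ → ℝ := rhoEps ρ ε ⋆ dG

section Mollifier

variable {ρ : ℝ → ℝ} {ε : ℝ}

theorem IsMollifier.continuous_rhoEps (hρ : IsMollifier ρ) : Continuous (rhoEps ρ ε) := by
  have := hρ.contDiff.continuous
  unfold rhoEps
  fun_prop

theorem IsMollifier.rhoEps_nonneg (hρ : IsMollifier ρ) (hε : 0 < ε) (x : ℝ) :
    0 ≤ rhoEps ρ ε x :=
  mul_nonneg (by positivity) (hρ.nonneg _)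

theorem IsMollifier.rhoEps_neg (hρ : IsMollifier ρ) (x : ℝ) :
    rhoEps ρ ε (-x) = rhoEps ρ ε x := by
  simp only [rhoEps, neg_div, hρ.even]

theorem IsMollifier.support_rhoEps_subset (hρ : IsMollifier ρ) (hε : 0 < ε) :
    Function.support (rhoEps ρ ε) ⊆ Metric.ball 0 ε := by
  intro x hx
  have h1 : ρ (x / ε) ≠ 0 := fun h => hx (by simp [rhoEps, h])
  have h2 : |x / ε| < 1 := hρ.support (subset_tsupport _ h1)
  rw [abs_div, abs_of_pos hε, div_lt_one hε] at h2
  simpa using h2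

theorem IsMollifier.rhoEps_eq_zero (hρ : IsMollifier ρ) (hε : 0 < ε) {x : ℝ} (hx : ε ≤ |x|) :
    rhoEps ρ ε x = 0 := by
  by_contra h
  have := hρ.support_rhoEps_subset hε h
  simp only [Metric.mem_ball, dist_zero_right, Real.norm_eq_abs] at this
  linarith

theorem IsMollifier.hasCompactSupport_rhoEps (hρ : IsMollifier ρ) (hε : 0 < ε) :
    HasCompactSupport (rhoEps ρ ε) :=
  HasCompactSupport.intro (isCompact_closedBall (0 : ℝ) ε) fun x hx =>
    hρ.rhoEps_eq_zero hε (by simpa using (not_le.1 (by simpa using hx)).le)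

theorem IsMollifier.integrable_rhoEps (hρ : IsMollifier ρ) (hε : 0 < ε) :
    Integrable (rhoEps ρ ε) :=
  hρ.continuous_rhoEps.integrable_of_hasCompactSupport (hρ.hasCompactSupport_rhoEps hε)

theorem IsMollifier.integral_rhoEps (hρ : IsMollifier ρ) (hε : 0 < ε) :
    ∫ x, rhoEps ρ ε x = 1 := by
  simp only [rhoEps, integral_const_mul]
  rw [Measure.integral_comp_div, hρ.integral_eq_one, abs_of_pos hε, smul_eq_mul]
  field_simp

theorem IsMollifier.exists_rhoEps_le (hρ : IsMollifier ρ) (hε : 0 < ε) :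
    ∃ b, 0 ≤ b ∧ ∀ x, |rhoEps ρ ε x| ≤ b := by
  obtain ⟨b, hb⟩ := hρ.continuous_rhoEps.bounded_above_of_compact_support
    (hρ.hasCompactSupport_rhoEps hε)
  exact ⟨b, (norm_nonneg _).trans (hb 0), hb⟩

theorem convolution_real (k g : ℝ → ℝ) (x : ℝ) : (k ⋆ g) x = ∫ y, k y * g (x - y) := rfl

/-- Averaging against `ρ_ε` does not increase the supremum norm. -/
theorem IsMollifier.abs_convolution_le (hρ : IsMollifier ρ) (hε : 0 < ε) {g : ℝ → ℝ} {b : ℝ}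
    (hg : ∀ x, |g x| ≤ b) (x : ℝ) : |(rhoEps ρ ε ⋆ g) x| ≤ b := by
  rw [convolution_real]
  have h := norm_integral_le_of_norm_le (f := fun y => rhoEps ρ ε y * g (x - y))
    (g := fun y => rhoEps ρ ε y * b) (μ := volume) ((hρ.integrable_rhoEps hε).mul_const b)
    (Eventually.of_forall fun y => by
      rw [norm_mul, Real.norm_of_nonneg (hρ.rhoEps_nonneg hε y)]
      exact mul_le_mul_of_nonneg_left (hg _) (hρ.rhoEps_nonneg hε y))
  rwa [integral_mul_const, hρ.integral_rhoEps hε, one_mul] at h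

theorem IsMollifier.integrable_rhoEps_mul (hρ : IsMollifier ρ) (hε : 0 < ε) {g : ℝ → ℝ} {b : ℝ}
    (hgm : Measurable g) (hg : ∀ x, |g x| ≤ b) (x : ℝ) :
    Integrable (fun y => rhoEps ρ ε y * g (x - y)) :=
  (hρ.integrable_rhoEps hε).mul_bdd (c := b)
    (hgm.comp (measurable_const.sub measurable_id)).aestronglyMeasurable
    (Eventually.of_forall fun _ => hg _)

/-- A uniform estimate for a difference of two translates is preserved by averaging. -/
theorem IsMollifier.abs_convolution_sub_le (hρ : IsMollifier ρ) (hε : 0 < ε) {g h : ℝ → ℝ}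
    {b c : ℝ} (hgm : Measurable g) (hg : ∀ x, |g x| ≤ b) (hhm : Measurable h)
    (hh : ∀ x, |h x| ≤ b) {x y : ℝ} (hc : ∀ z, |g (x - z) - h (y - z)| ≤ c) :
    |(rhoEps ρ ε ⋆ g) x - (rhoEps ρ ε ⋆ h) y| ≤ c := by
  rw [convolution_real, convolution_real, ← integral_sub
    (hρ.integrable_rhoEps_mul hε hgm hg x) (hρ.integrable_rhoEps_mul hε hhm hh y)]
  have h := norm_integral_le_of_norm_le
    (f := fun z => rhoEps ρ ε z * g (x - z) - rhoEps ρ ε z * h (y - z))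
    (g := fun z => rhoEps ρ ε z * c) (μ := volume) ((hρ.integrable_rhoEps hε).mul_const c)
    (Eventually.of_forall fun z => by
      rw [← mul_sub, norm_mul, Real.norm_of_nonneg (hρ.rhoEps_nonneg hε z)]
      exact mul_le_mul_of_nonneg_left (hc z) (hρ.rhoEps_nonneg hε z))
  rwa [integral_mul_const, hρ.integral_rhoEps hε, one_mul] at h

/-- `ρ_ε` is an approximate identity: `(ρ_{ε_n} * g)(x_n) → g(x)` if `g` is continuous at `x`. -/
theorem IsMollifier.tendsto_convolution (hρ : IsMollifier ρ) {e : ℕ → ℝ} (he : ∀ n, 0 < e n)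
    (he0 : Tendsto e atTop (𝓝 0)) {g : ℝ → ℝ} (hg : Measurable g) {x : ℝ}
    (hgx : ContinuousAt g x) {y : ℕ → ℝ} (hy : Tendsto y atTop (𝓝 x)) :
    Tendsto (fun n => (rhoEps ρ (e n) ⋆ g) (y n)) atTop (𝓝 (g x)) := by
  refine convolution_tendsto_right (g := fun _ => g) (x₀ := x)
    (Eventually.of_forall fun n => hρ.rhoEps_nonneg (he n))
    (Eventually.of_forall fun n => hρ.integral_rhoEps (he n)) ?_
    (Eventually.of_forall fun n => hg.aestronglyMeasurable) ?_ hy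
  · rw [tendsto_smallSets_iff]
    intro t ht
    obtain ⟨δ, hδ, hδt⟩ := Metric.mem_nhds_iff.1 ht
    filter_upwards [he0.eventually (gt_mem_nhds hδ)] with n hn
    exact (hρ.support_rhoEps_subset (he n)).trans ((Metric.ball_subset_ball hn.le).trans hδt)
  · exact hgx.tendsto.comp tendsto_snd

end Mollifier

/-! ### The kernel `G` and its derivative -/

theorem continuous_G : Continuous G := by unfold G; fun_prop

theorem G_pos (x : ℝ) : 0 < G x := by unfold G; positivity

theorem G_le (x : ℝ) : G x ≤ 1 / 2 := by
  unfold G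
  have : exp (-|x|) ≤ 1 := exp_le_one_iff.2 (by simp)
  linarith

theorem abs_G_le (x : ℝ) : |G x| ≤ 1 / 2 := by rw [abs_of_pos (G_pos x)]; exact G_le x

theorem G_of_nonneg {x : ℝ} (hx : 0 ≤ x) : G x = 1 / 2 * exp (-x) := by
  rw [G, abs_of_nonneg hx]

theorem G_of_nonpos {x : ℝ} (hx : x ≤ 0) : G x = 1 / 2 * exp x := by
  rw [G, abs_of_nonpos hx, neg_neg]

theorem dG_of_pos {x : ℝ} (hx : 0 < x) : dG x = -(1 / 2 * exp (-x)) := by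
  simp [dG, sign_pos hx, G_of_nonneg hx.le]

theorem dG_of_neg {x : ℝ} (hx : x < 0) : dG x = 1 / 2 * exp x := by
  simp [dG, sign_neg hx, G_of_nonpos hx.le]

theorem abs_dG_le_G (x : ℝ) : |dG x| ≤ G x := by
  rw [dG, abs_mul, abs_of_pos (G_pos x), abs_neg]
  rcases lt_trichotomy x 0 with h | h | h <;> simp [h, (G_pos _).le]

theorem abs_dG_le (x : ℝ) : |dG x| ≤ 1 / 2 := (abs_dG_le_G x).trans (G_le x)

theorem continuousAt_dG {x : ℝ} (hx : x ≠ 0) : ContinuousAt dG x := by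
  rcases hx.lt_or_gt with h | h
  · have : (fun x => 1 / 2 * exp x) =ᶠ[𝓝 x] dG := by
      filter_upwards [gt_mem_nhds h] with y hy
      exact (dG_of_neg hy).symm
    exact ContinuousAt.congr (by fun_prop) this
  · have : (fun x => -(1 / 2 * exp (-x))) =ᶠ[𝓝 x] dG := by
      filter_upwards [lt_mem_nhds h] with y hy
      exact (dG_of_pos hy).symm
    exact ContinuousAt.congr (by fun_prop) this

theorem measurable_dG : Measurable dG := by
  refine measurable_of_countable_not_continuousAt ((countable_singleton (0 : ℝ)).mono ?_)
  intro x hx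
  by_contra h
  exact hx (continuousAt_dG h)

theorem integrable_G : Integrable G := by
  have h1 : IntegrableOn G (Ioi 0) := by
    refine IntegrableOn.congr_fun ((integrableOn_exp_neg_Ioi 0).const_mul (1 / 2)) ?_
      measurableSet_Ioi
    intro x hx
    exact (G_of_nonneg (le_of_lt hx)).symm
  have h2 : IntegrableOn G (Iic 0) := by
    refine IntegrableOn.congr_fun ((integrableOn_exp_Iic 0).const_mul (1 / 2)) ?_
      measurableSet_Iic
    intro x hx
    exact (G_of_nonpos hx).symm
  have := h2.union h1
  rwa [Iic_union_Ioi, integrableOn_univ] at this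

theorem integral_G : ∫ x, G x = 1 := by
  rw [← intervalIntegral.integral_Iic_add_Ioi (b := (0 : ℝ)) integrable_G.integrableOn
    integrable_G.integrableOn]
  have h1 : ∫ x in Ioi (0 : ℝ), G x = 1 / 2 := by
    rw [setIntegral_congr_fun (g := fun x => 1 / 2 * exp (-x)) measurableSet_Ioi
      fun x hx => G_of_nonneg (le_of_lt hx), integral_const_mul, integral_exp_neg_Ioi_zero, mul_one]
  have h2 : ∫ x in Iic (0 : ℝ), G x = 1 / 2 := by
    rw [setIntegral_congr_fun (g := fun x => 1 / 2 * exp x) measurableSet_Iic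
      fun x hx => G_of_nonpos hx, integral_const_mul, integral_exp_Iic_zero, mul_one]
  rw [h1, h2]; norm_num

theorem integrable_dG : Integrable dG :=
  integrable_G.mono measurable_dG.aestronglyMeasurable
    (Eventually.of_forall fun x => by
      rw [Real.norm_eq_abs, Real.norm_of_nonneg (G_pos x).le]; exact abs_dG_le_G x)

theorem abs_exp_neg_sub_le (a b : ℝ) : |exp (-a) - exp (-b)| ≤ |a - b| * (exp (-a) + exp (-b)) := by
  wlog h : a ≤ b generalizing a b
  · rw [abs_sub_comm, abs_sub_comm a, add_comm]; exact this b a (le_of_not_ge h)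
  have h1 : exp (-b) ≤ exp (-a) := exp_le_exp.2 (by linarith)
  have h2 : exp (-b) = exp (-a) * exp (a - b) := by rw [← exp_add]; congr 1; ring
  have h3 := add_one_le_exp (a - b)
  rw [abs_of_nonneg (by linarith), abs_of_nonpos (by linarith)]
  have h4 : exp (-a) - exp (-b) ≤ exp (-a) * (b - a) := by
    rw [h2]
    nlinarith [exp_pos (-a)]
  nlinarith [exp_pos (-a), exp_pos (-b)]

theorem abs_G_sub_le (x y : ℝ) : |G x - G y| ≤ |x - y| * (G x + G y) := by
  have h := abs_exp_neg_sub_le |x| |y|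
  have h2 := abs_abs_sub_abs_le_abs_sub x y
  have h3 : G x - G y = 1 / 2 * (exp (-|x|) - exp (-|y|)) := by unfold G; ring
  rw [h3, abs_mul, abs_of_pos (by norm_num : (0 : ℝ) < 1 / 2)]
  calc 1 / 2 * |exp (-|x|) - exp (-|y|)| ≤ 1 / 2 * (|(|x| - |y|)| * (exp (-|x|) + exp (-|y|))) := by
        gcongr
    _ ≤ 1 / 2 * (|x - y| * (exp (-|x|) + exp (-|y|))) := by gcongr
    _ = _ := by unfold G; ring

/-- `dG` differs from `∓G` by its jump at the origin only. -/
theorem abs_dG_sub_le (x y : ℝ) : |dG x - dG y| ≤ |x - y| * (G x + G y) +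
    (uIcc x y).indicator 1 0 := by
  by_cases h : (0 : ℝ) ∈ uIcc x y
  · rw [indicator_of_mem h, Pi.one_apply]
    have h1 := abs_dG_le x
    have h2 := abs_dG_le y
    have h3 : 0 ≤ |x - y| * (G x + G y) :=
      mul_nonneg (abs_nonneg _) (add_pos (G_pos x) (G_pos y)).le
    have := abs_sub (dG x) (dG y)
    linarith
  · rw [indicator_of_notMem h, add_zero]
    refine le_trans (le_of_eq ?_) (abs_G_sub_le x y)
    rw [mem_uIcc, not_or] at h
    rcases lt_or_ge 0 x with hx | hx
    · have hy : 0 < y := by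
        by_contra hy; exact h.2 ⟨not_lt.1 hy, hx.le⟩
      rw [dG_of_pos hx, dG_of_pos hy, G_of_nonneg hx.le, G_of_nonneg hy.le, ← abs_neg]
      congr 1; ring
    · have hy : y < 0 := by
        by_contra hy; exact h.1 ⟨hx, not_lt.1 hy⟩
      have hx : x < 0 := by
        rcases hx.lt_or_eq with h0 | h0
        · exact h0
        · exact absurd ⟨hy.le, h0.ge⟩ h.2
      rw [dG_of_neg hx, dG_of_neg hy, G_of_nonpos hx.le, G_of_nonpos hy.le]

/-- `g` has `L¹` modulus of continuity `A`, that is, `‖g(· - a) - g(· - b)‖_{L¹} ≤ A |a - b|`. This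
is a quantitative form of `g ∈ BV(ℝ)`. -/
def HasL1Modulus (g : ℝ → ℝ) (A : ℝ) : Prop :=
  ∀ a b, ∫⁻ x, ‖g (x - a) - g (x - b)‖ₑ ≤ ENNReal.ofReal (A * |a - b|)

theorem lintegral_G_modulus (a b : ℝ) :
    ∫⁻ x, ENNReal.ofReal (|a - b| * (G (x - a) + G (x - b))) = ENNReal.ofReal (2 * |a - b|) := by
  have hi : Integrable fun x => G (x - a) + G (x - b) :=
    (integrable_G.comp_sub_right a).add (integrable_G.comp_sub_right b)
  rw [← ofReal_integral_eq_lintegral_ofReal (hi.const_mul _), integral_const_mul]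
  · have : ∫ x, (G (x - a) + G (x - b)) = 2 := by
      rw [integral_add (integrable_G.comp_sub_right a) (integrable_G.comp_sub_right b),
        integral_sub_right_eq_self (μ := volume) G a, integral_sub_right_eq_self (μ := volume) G b,
        integral_G]
      norm_num
    rw [this, mul_comm]
  · exact Eventually.of_forall fun x =>
      mul_nonneg (abs_nonneg _) (add_pos (G_pos _) (G_pos _)).le

theorem hasL1Modulus_G : HasL1Modulus G 3 := by
  intro a b
  calc ∫⁻ x, ‖G (x - a) - G (x - b)‖ₑ
      ≤ ∫⁻ x, ENNReal.ofReal (|a - b| * (G (x - a) + G (x - b))) := by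
        refine lintegral_mono fun x => ?_
        rw [← ofReal_norm, Real.norm_eq_abs]
        refine ENNReal.ofReal_le_ofReal ((abs_G_sub_le _ _).trans (le_of_eq ?_))
        rw [abs_sub_comm a b]; congr 2; ring
    _ = ENNReal.ofReal (2 * |a - b|) := lintegral_G_modulus a b
    _ ≤ _ := ENNReal.ofReal_le_ofReal (by linarith [abs_nonneg (a - b)])

theorem hasL1Modulus_dG : HasL1Modulus dG 3 := by
  intro a b
  calc ∫⁻ x, ‖dG (x - a) - dG (x - b)‖ₑ
      ≤ ∫⁻ x, (ENNReal.ofReal (|a - b| * (G (x - a) + G (x - b)))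
          + (uIcc a b).indicator 1 x) := by
        refine lintegral_mono fun x => ?_
        rw [← ofReal_norm, Real.norm_eq_abs]
        refine (ENNReal.ofReal_le_ofReal (abs_dG_sub_le _ _)).trans ?_
        rw [ENNReal.ofReal_add (mul_nonneg (abs_nonneg _) (add_pos (G_pos _) (G_pos _)).le)
          (show (0 : ℝ) ≤ (uIcc (x - a) (x - b)).indicator 1 0 from
            indicator_nonneg (fun _ _ => zero_le_one) _)]
        refine add_le_add (le_of_eq ?_) (le_of_eq ?_)
        · rw [abs_sub_comm a b]; congr 3; ring
        · have : (0 : ℝ) ∈ uIcc (x - a) (x - b) ↔ x ∈ uIcc a b := by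
            simp only [mem_uIcc]
            constructor <;> rintro (h | h)
            · right; constructor <;> linarith
            · left; constructor <;> linarith
            · right; constructor <;> linarith
            · left; constructor <;> linarith
          by_cases hx : x ∈ uIcc a b
          · rw [indicator_of_mem (this.2 hx), indicator_of_mem hx]; simp
          · rw [indicator_of_notMem (this.not.2 hx), indicator_of_notMem hx]; simp
    _ = ENNReal.ofReal (2 * |a - b|) + ENNReal.ofReal |a - b| := by
        have hm : Measurable fun x => ENNReal.ofReal (|a - b| * (G (x - a) + G (x - b))) := by
          have := continuous_G.measurable
          fun_prop
        rw [lintegral_add_left hm, lintegral_G_modulus,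
          lintegral_indicator_one measurableSet_uIcc, uIcc, Real.volume_Icc, max_sub_min_eq_abs,
          abs_sub_comm b a]
    _ = _ := by
        rw [← ENNReal.ofReal_add (by positivity) (by positivity)]; congr 1; ring

/-! ### Derivatives of the mollified kernels, and the fundamental solution identities -/

theorem hasDerivAt_integral_Iic {f : ℝ → ℝ} (hf : Continuous f) (hfi : Integrable f) (x : ℝ) :
    HasDerivAt (fun x => ∫ y in Iic x, f y) (f x) x := by
  have h : (fun x => ∫ y in Iic x, f y) = fun x => (∫ y in (0 : ℝ)..x, f y) + ∫ y in Iic 0, f y := by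
    ext x
    rw [← intervalIntegral.integral_Iic_sub_Iic hfi.integrableOn hfi.integrableOn]
    ring
  rw [h]
  exact (intervalIntegral.integral_hasDerivAt_right (hf.intervalIntegrable _ _)
    hf.aestronglyMeasurable.stronglyMeasurableAtFilter hf.continuousAt).add_const _

theorem hasDerivAt_integral_Ioi {f : ℝ → ℝ} (hf : Continuous f) (hfi : Integrable f) (x : ℝ) :
    HasDerivAt (fun x => ∫ y in Ioi x, f y) (-f x) x := by
  have h : (fun x => ∫ y in Ioi x, f y) = fun x => (∫ y, f y) - ∫ y in Iic x, f y := by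
    ext x
    rw [← intervalIntegral.integral_Iic_add_Ioi (b := x) hfi.integrableOn hfi.integrableOn]
    ring
  rw [h]
  exact (hasDerivAt_integral_Iic hf hfi x).const_sub _

section

variable {k : ℝ → ℝ} (hk : Continuous k) (hkc : HasCompactSupport k)
include hk hkc

/-- Splitting `k * G` at the kink of `G` leaves smooth exponentials times integrals with variable
endpoint, which the fundamental theorem of calculus differentiates. -/
theorem convolution_G_eq (x : ℝ) : (k ⋆ G) x =
    1 / 2 * exp (-x) * (∫ y in Iic x, exp y * k y) + 1 / 2 * exp x * ∫ y in Ioi x, exp (-y) * k y := by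
  have hi : Integrable fun y => k y * G (x - y) :=
    (hk.mul (continuous_G.comp (by fun_prop))).integrable_of_hasCompactSupport hkc.mul_right
  rw [convolution_real, ← intervalIntegral.integral_Iic_add_Ioi (b := x) hi.integrableOn
    hi.integrableOn, ← integral_const_mul, ← integral_const_mul]
  congr 1
  · refine setIntegral_congr_fun measurableSet_Iic fun y hy => ?_
    rw [G_of_nonneg (sub_nonneg.2 hy), neg_sub, sub_eq_add_neg, exp_add]
    ring
  · refine setIntegral_congr_fun measurableSet_Ioi fun y hy => ?_
    rw [G_of_nonpos (sub_nonpos.2 (le_of_lt hy)), sub_eq_add_neg, exp_add]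
    ring

theorem convolution_dG_eq (x : ℝ) : (k ⋆ dG) x =
    -(1 / 2 * exp (-x) * (∫ y in Iic x, exp y * k y)) +
      1 / 2 * exp x * ∫ y in Ioi x, exp (-y) * k y := by
  have hi : Integrable fun y => k y * dG (x - y) :=
    (hk.integrable_of_hasCompactSupport hkc).mul_bdd (c := 1 / 2)
      (measurable_dG.comp (measurable_const.sub measurable_id)).aestronglyMeasurable
      (Eventually.of_forall fun _ => abs_dG_le _)
  rw [convolution_real, ← intervalIntegral.integral_Iic_add_Ioi (b := x) hi.integrableOn
    hi.integrableOn, ← integral_const_mul, ← integral_const_mul, ← integral_neg]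
  congr 1
  · rw [← setIntegral_congr_set Iio_ae_eq_Iic, ← setIntegral_congr_set Iio_ae_eq_Iic]
    refine setIntegral_congr_fun measurableSet_Iio fun y hy => ?_
    rw [dG_of_pos (sub_pos.2 hy), neg_sub, sub_eq_add_neg, exp_add]
    ring
  · refine setIntegral_congr_fun measurableSet_Ioi fun y hy => ?_
    rw [dG_of_neg (sub_neg.2 hy), sub_eq_add_neg, exp_add]
    ring

theorem hasDerivAt_convolution_G (x : ℝ) : HasDerivAt (k ⋆ G) ((k ⋆ dG) x) x := by
  have h1 := hasDerivAt_integral_Iic (f := fun y => exp y * k y) (by fun_prop)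
    ((by fun_prop : Continuous fun y => exp y * k y).integrable_of_hasCompactSupport
      hkc.mul_left) x
  have h2 := hasDerivAt_integral_Ioi (f := fun y => exp (-y) * k y) (by fun_prop)
    ((by fun_prop : Continuous fun y => exp (-y) * k y).integrable_of_hasCompactSupport
      hkc.mul_left) x
  have e1 : HasDerivAt (fun x : ℝ => 1 / 2 * exp (-x)) (-(1 / 2 * exp (-x))) x := by
    simpa using ((hasDerivAt_neg x).exp).const_mul (1 / 2 : ℝ)
  have e2 : HasDerivAt (fun x : ℝ => 1 / 2 * exp x) (1 / 2 * exp x) x :=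
    (hasDerivAt_exp x).const_mul _
  rw [funext (convolution_G_eq hk hkc), convolution_dG_eq hk hkc]
  refine ((e1.mul h1).add (e2.mul h2)).congr_deriv ?_
  ring

theorem hasDerivAt_convolution_dG (x : ℝ) : HasDerivAt (k ⋆ dG) ((k ⋆ G) x - k x) x := by
  have h1 := hasDerivAt_integral_Iic (f := fun y => exp y * k y) (by fun_prop)
    ((by fun_prop : Continuous fun y => exp y * k y).integrable_of_hasCompactSupport
      hkc.mul_left) x
  have h2 := hasDerivAt_integral_Ioi (f := fun y => exp (-y) * k y) (by fun_prop)
    ((by fun_prop : Continuous fun y => exp (-y) * k y).integrable_of_hasCompactSupport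
      hkc.mul_left) x
  have e1 : HasDerivAt (fun x : ℝ => 1 / 2 * exp (-x)) (-(1 / 2 * exp (-x))) x := by
    simpa using ((hasDerivAt_neg x).exp).const_mul (1 / 2 : ℝ)
  have e2 : HasDerivAt (fun x : ℝ => 1 / 2 * exp x) (1 / 2 * exp x) x :=
    (hasDerivAt_exp x).const_mul _
  rw [funext (convolution_dG_eq hk hkc), convolution_G_eq hk hkc]
  refine ((e1.mul h1).neg.add (e2.mul h2)).congr_deriv ?_
  have : exp (-x) * exp x = 1 := by rw [← exp_add]; simp
  linear_combination (-k x) * this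

end

section Mollified

variable {ρ : ℝ → ℝ} {ε : ℝ} (hρ : IsMollifier ρ) (hε : 0 < ε)
include hρ hε

theorem hasDerivAt_GEps (x : ℝ) : HasDerivAt (GEps ρ ε) (dGEps ρ ε x) x :=
  hasDerivAt_convolution_G hρ.continuous_rhoEps (hρ.hasCompactSupport_rhoEps hε) x

theorem hasDerivAt_dGEps (x : ℝ) :
    HasDerivAt (dGEps ρ ε) (GEps ρ ε x - rhoEps ρ ε x) x :=
  hasDerivAt_convolution_dG hρ.continuous_rhoEps (hρ.hasCompactSupport_rhoEps hε) x

theorem deriv_GEps : deriv (GEps ρ ε) = dGEps ρ ε :=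
  funext fun x => (hasDerivAt_GEps hρ hε x).deriv

theorem continuous_GEps : Continuous (GEps ρ ε) :=
  continuous_iff_continuousAt.2 fun x => (hasDerivAt_GEps hρ hε x).continuousAt

theorem continuous_dGEps : Continuous (dGEps ρ ε) :=
  continuous_iff_continuousAt.2 fun x => (hasDerivAt_dGEps hρ hε x).continuousAt

theorem abs_GEps_le (x : ℝ) : |GEps ρ ε x| ≤ 1 / 2 := hρ.abs_convolution_le hε abs_G_le x

theorem abs_dGEps_le (x : ℝ) : |dGEps ρ ε x| ≤ 1 / 2 := hρ.abs_convolution_le hε abs_dG_le x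

theorem abs_GEps_sub_le (x y : ℝ) : |GEps ρ ε x - GEps ρ ε y| ≤ 1 / 2 * |x - y| := by
  have := convex_univ.norm_image_sub_le_of_norm_hasDerivWithin_le (f := GEps ρ ε)
    (f' := dGEps ρ ε) (C := 1 / 2) (fun x _ => (hasDerivAt_GEps hρ hε x).hasDerivWithinAt)
    (fun x _ => abs_dGEps_le hρ hε x) (mem_univ y) (mem_univ x)
  exact this

theorem exists_abs_dGEps_sub_le : ∃ A, 0 ≤ A ∧ ∀ x y,
    |dGEps ρ ε x - dGEps ρ ε y| ≤ A * |x - y| := by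
  obtain ⟨b, hb0, hb⟩ := hρ.exists_rhoEps_le hε
  refine ⟨1 / 2 + b, by positivity, fun x y => ?_⟩
  have := convex_univ.norm_image_sub_le_of_norm_hasDerivWithin_le (f := dGEps ρ ε)
    (f' := fun x => GEps ρ ε x - rhoEps ρ ε x) (C := 1 / 2 + b)
    (fun x _ => (hasDerivAt_dGEps hρ hε x).hasDerivWithinAt)
    (fun x _ => (abs_sub _ _).trans (add_le_add (abs_GEps_le hρ hε x) (hb x)))
    (mem_univ y) (mem_univ x)
  exact this

end Mollified

/-! #### Distributional identities for `G` -/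

theorem integral_split_exp {a : ℝ} {f g : ℝ → ℝ} {c : ℝ} (hg : Integrable fun x => g x * f x)
    (h1 : ∀ x, x < a → g x = 1 / 2 * exp (x - a)) (h2 : ∀ x, a < x → g x = c * exp (-(x - a))) :
    ∫ x, g x * f x = 1 / 2 * (∫ x in Iic a, exp (x - a) * f x)
      + c * ∫ x in Ioi a, exp (-(x - a)) * f x := by
  rw [← intervalIntegral.integral_Iic_add_Ioi (b := a) hg.integrableOn hg.integrableOn,
    ← integral_const_mul, ← integral_const_mul]
  congr 1
  · rw [← setIntegral_congr_set Iio_ae_eq_Iic, ← setIntegral_congr_set Iio_ae_eq_Iic]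
    refine setIntegral_congr_fun measurableSet_Iio fun y hy => ?_
    rw [h1 y hy, mul_assoc]
  · refine setIntegral_congr_fun measurableSet_Ioi fun y hy => ?_
    rw [h2 y hy, mul_assoc]

section Fundamental

variable {ψ : ℝ → ℝ} (hψ : ContDiff ℝ 1 ψ) (hc : HasCompactSupport ψ) (a : ℝ)
include hψ hc

theorem integral_Ioi_exp_mul_deriv : ∫ x in Ioi a, exp (-(x - a)) * deriv ψ x
    = (∫ x in Ioi a, exp (-(x - a)) * ψ x) - ψ a := by
  have hψc := hψ.continuous
  have hdc : Continuous (deriv ψ) := hψ.continuous_deriv le_rfl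
  have hd : ∀ x, deriv (fun x => exp (-(x - a)) * ψ x) x
      = exp (-(x - a)) * deriv ψ x - exp (-(x - a)) * ψ x := by
    intro x
    have e1 : HasDerivAt (fun x : ℝ => exp (-(x - a))) (-exp (-(x - a))) x := by
      simpa using (((hasDerivAt_id x).sub_const a).neg).exp
    have := (e1.mul (hψ.differentiable one_ne_zero x).hasDerivAt).deriv
    simp only [Pi.mul_def] at this
    rw [this]; ring
  have h := HasCompactSupport.integral_Ioi_deriv_eq (f := fun x => exp (-(x - a)) * ψ x)
    (by fun_prop) hc.mul_left a
  simp only [hd] at h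
  rw [integral_sub] at h
  · simp only [sub_self, neg_zero, exp_zero, one_mul] at h
    linarith
  · exact ((by fun_prop : Continuous fun x => exp (-(x - a)) * deriv ψ x).integrable_of_hasCompactSupport
      hc.deriv.mul_left).integrableOn
  · exact ((by fun_prop : Continuous fun x => exp (-(x - a)) * ψ x).integrable_of_hasCompactSupport
      hc.mul_left).integrableOn

theorem integral_Iic_exp_mul_deriv : ∫ x in Iic a, exp (x - a) * deriv ψ x
    = ψ a - ∫ x in Iic a, exp (x - a) * ψ x := by
  have hψc := hψ.continuous
  have hdc : Continuous (deriv ψ) := hψ.continuous_deriv le_rfl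
  have hd : ∀ x, deriv (fun x => exp (x - a) * ψ x) x
      = exp (x - a) * deriv ψ x + exp (x - a) * ψ x := by
    intro x
    have e1 : HasDerivAt (fun x : ℝ => exp (x - a)) (exp (x - a)) x := by
      simpa using ((hasDerivAt_id x).sub_const a).exp
    have := (e1.mul (hψ.differentiable one_ne_zero x).hasDerivAt).deriv
    simp only [Pi.mul_def] at this
    rw [this]; ring
  have h := HasCompactSupport.integral_Iic_deriv_eq (f := fun x => exp (x - a) * ψ x)
    (by fun_prop) hc.mul_left a
  simp only [hd] at h
  rw [integral_add] at h
  · simp only [sub_self, exp_zero, one_mul] at h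
    linarith
  · exact ((by fun_prop : Continuous fun x => exp (x - a) * deriv ψ x).integrable_of_hasCompactSupport
      hc.deriv.mul_left).integrableOn
  · exact ((by fun_prop : Continuous fun x => exp (x - a) * ψ x).integrable_of_hasCompactSupport
      hc.mul_left).integrableOn

omit hψ hc in
theorem integral_G_mul {f : ℝ → ℝ} (hf : Continuous f) (hfc : HasCompactSupport f) :
    ∫ x, G (x - a) * f x = 1 / 2 * (∫ x in Iic a, exp (x - a) * f x)
      + 1 / 2 * ∫ x in Ioi a, exp (-(x - a)) * f x := by
  refine integral_split_exp ?_ (fun x hx => G_of_nonpos (by linarith))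
    (fun x hx => G_of_nonneg (by linarith))
  exact ((continuous_G.comp (by fun_prop)).mul hf).integrable_of_hasCompactSupport hfc.mul_left

omit hψ hc in
theorem integral_dG_mul {f : ℝ → ℝ} (hf : Continuous f) (hfc : HasCompactSupport f) :
    ∫ x, dG (x - a) * f x = 1 / 2 * (∫ x in Iic a, exp (x - a) * f x)
      + (-(1 / 2)) * ∫ x in Ioi a, exp (-(x - a)) * f x := by
  refine integral_split_exp ?_ (fun x hx => dG_of_neg (by linarith))
    (fun x hx => by rw [dG_of_pos (by linarith)]; ring)
  exact (hf.integrable_of_hasCompactSupport hfc).bdd_mul (c := 1 / 2)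
    (measurable_dG.comp (measurable_id.sub_const a)).aestronglyMeasurable
    (Eventually.of_forall fun _ => abs_dG_le _)

/-- `dG(· - a)` is the distributional derivative of `G(· - a)`. -/
theorem integral_G_mul_deriv :
    ∫ x, G (x - a) * deriv ψ x = -∫ x, dG (x - a) * ψ x := by
  rw [integral_G_mul a (hψ.continuous_deriv le_rfl) hc.deriv,
    integral_dG_mul a hψ.continuous hc, integral_Ioi_exp_mul_deriv hψ hc,
    integral_Iic_exp_mul_deriv hψ hc]
  ring

/-- The distributional derivative of `dG(· - a)` is `G(· - a) - δ_a`. -/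
theorem integral_dG_mul_deriv :
    ∫ x, dG (x - a) * deriv ψ x = ψ a - ∫ x, G (x - a) * ψ x := by
  rw [integral_dG_mul a (hψ.continuous_deriv le_rfl) hc.deriv,
    integral_G_mul a hψ.continuous hc, integral_Ioi_exp_mul_deriv hψ hc,
    integral_Iic_exp_mul_deriv hψ hc]
  ring

end Fundamental

/-- `G(· - a)` is the fundamental solution of `1 - ∂_xx` with pole `a`. -/
theorem integral_G_mul_helmholtz {φ : ℝ → ℝ} (hφ : ContDiff ℝ 2 φ) (hc : HasCompactSupport φ)
    (a : ℝ) : ∫ x, G (x - a) * (φ x - deriv (deriv φ) x) = φ a := by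
  have hφ1 : ContDiff ℝ 1 φ := hφ.of_le (by norm_num)
  have hd : ContDiff ℝ 1 (deriv φ) := by
    have : ContDiff ℝ (1 + 1) φ := by simpa [one_add_one_eq_two] using hφ
    exact (contDiff_succ_iff_deriv.1 this).2.2
  have h1 := integral_G_mul_deriv hd hc.deriv a
  rw [integral_dG_mul_deriv hφ1 hc a] at h1
  have e : ∀ x, G (x - a) * (φ x - deriv (deriv φ) x)
      = G (x - a) * φ x - G (x - a) * deriv (deriv φ) x := fun x => by ring
  simp only [e]
  rw [integral_sub, h1]
  · ring
  · exact ((continuous_G.comp (by fun_prop)).mul hφ.continuous).integrable_of_hasCompactSupport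
      hc.mul_left
  · exact ((continuous_G.comp (by fun_prop)).mul
      (hd.continuous_deriv le_rfl)).integrable_of_hasCompactSupport hc.deriv.deriv.mul_left

/-! ### Superpositions of translates of a kernel -/

/-- The superposition of the translates of `g` to the positions `Y θ`, weighted by `w μ`. For
`g = G` this is the velocity profile `u` of the configuration `Y`. -/
def layer (μ : Measure ℝ) (w g Y : ℝ → ℝ) (x : ℝ) : ℝ := ∫ θ, g (x - Y θ) * w θ ∂μ

section Layer

variable {μ : Measure ℝ} {w g g' Y Z : ℝ → ℝ} {b c : ℝ}

theorem layer_congr (h : ∀ᵐ θ ∂μ, Y θ = Z θ) : layer μ w g Y = layer μ w g Z := by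
  ext x
  refine integral_congr_ae ?_
  filter_upwards [h] with θ hθ
  rw [hθ]

variable [IsFiniteMeasure μ]

theorem abs_integral_mul_le (hw1 : ∀ x, |w x| = 1) {f : ℝ → ℝ} (hf : ∀ᵐ θ ∂μ, |f θ| ≤ b) :
    |∫ θ, f θ * w θ ∂μ| ≤ b * μ.real univ := by
  refine norm_integral_le_of_norm_le_const (f := fun θ => f θ * w θ) ?_
  filter_upwards [hf] with θ hθ
  rwa [Real.norm_eq_abs, abs_mul, hw1, mul_one]

theorem abs_layer_le (hw1 : ∀ x, |w x| = 1) (hg : ∀ x, |g x| ≤ b) (x : ℝ) :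
    |layer μ w g Y x| ≤ b * μ.real univ :=
  abs_integral_mul_le hw1 (Eventually.of_forall fun _ => hg _)

theorem integrable_mul_density (hw : Measurable w) (hw1 : ∀ x, |w x| = 1) {f : ℝ → ℝ}
    (hf : AEMeasurable f μ) (hb : ∀ x, |f x| ≤ b) : Integrable (fun θ => f θ * w θ) μ := by
  refine Integrable.of_bound (hf.mul hw.aemeasurable).aestronglyMeasurable b ?_
  filter_upwards with θ
  rw [Real.norm_eq_abs, abs_mul, hw1, mul_one]
  exact hb θ

theorem integrable_layer (hw : Measurable w) (hw1 : ∀ x, |w x| = 1) (hgm : Measurable g)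
    (hg : ∀ x, |g x| ≤ b) (hY : AEMeasurable Y μ) (x : ℝ) :
    Integrable (fun θ => g (x - Y θ) * w θ) μ :=
  integrable_mul_density hw hw1 (hgm.comp_aemeasurable (aemeasurable_const.sub hY))
    fun _ => hg _

theorem abs_layer_sub_le (hw : Measurable w) (hw1 : ∀ x, |w x| = 1) (hgm : Measurable g)
    (hg : ∀ x, |g x| ≤ b) (hY : AEMeasurable Y μ) (hZ : AEMeasurable Z μ) {x y : ℝ}
    (h : ∀ᵐ θ ∂μ, |g (x - Y θ) - g (y - Z θ)| ≤ c) :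
    |layer μ w g Y x - layer μ w g Z y| ≤ c * μ.real univ := by
  rw [layer, layer, ← integral_sub (integrable_layer hw hw1 hgm hg hY x)
    (integrable_layer hw hw1 hgm hg hZ y)]
  simp only [← sub_mul]
  exact abs_integral_mul_le hw1 h

theorem hasDerivAt_layer (hw : Measurable w) (hw1 : ∀ x, |w x| = 1)
    (hg : ∀ x, |g x| ≤ b) (hg' : ∀ x, |g' x| ≤ c) (hgg : ∀ x, HasDerivAt g (g' x) x)
    (hm : Measurable g') (hY : AEMeasurable Y μ) (x : ℝ) :
    HasDerivAt (layer μ w g Y) (layer μ w g' Y x) x := by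
  have hgc : Measurable g :=
    (continuous_iff_continuousAt.2 fun x => (hgg x).continuousAt).measurable
  refine (hasDerivAt_integral_of_dominated_loc_of_deriv_le (μ := μ) (s := univ)
    (F := fun x θ => g (x - Y θ) * w θ) (F' := fun x θ => g' (x - Y θ) * w θ)
    (bound := fun _ => c) univ_mem
    (Eventually.of_forall fun x => (integrable_layer hw hw1 hgc hg hY x).aestronglyMeasurable)
    (integrable_layer hw hw1 hgc hg hY x)
    (integrable_layer hw hw1 hm hg' hY x).aestronglyMeasurable
    (Eventually.of_forall fun θ x _ => ?_) (integrable_const _)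
    (Eventually.of_forall fun θ x _ => ?_)).2
  · rw [Real.norm_eq_abs, abs_mul, hw1, mul_one]
    exact hg' _
  · have := (hgg (x - Y θ)).comp x ((hasDerivAt_id x).sub_const (Y θ))
    simpa using this.mul_const (w θ)

theorem tendsto_layer (hw : Measurable w) (hw1 : ∀ x, |w x| = 1) {gn : ℕ → ℝ → ℝ}
    {Yn : ℕ → ℝ → ℝ} {y : ℕ → ℝ} {x : ℝ} (hgm : ∀ n, Measurable (gn n))
    (hg : ∀ n x, |gn n x| ≤ b) (hY : ∀ n, AEMeasurable (Yn n) μ)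
    (h : ∀ᵐ θ ∂μ, Tendsto (fun n => gn n (y n - Yn n θ)) atTop (𝓝 (g (x - Y θ)))) :
    Tendsto (fun n => layer μ w (gn n) (Yn n) (y n)) atTop (𝓝 (layer μ w g Y x)) := by
  refine tendsto_integral_of_dominated_convergence (fun _ => b)
    (fun n => (integrable_layer hw hw1 (hgm n) (hg n) (hY n) (y n)).aestronglyMeasurable)
    (integrable_const _) (fun n => Eventually.of_forall fun θ => ?_) ?_
  · rw [Real.norm_eq_abs, abs_mul, hw1, mul_one]
    exact hg n _
  · filter_upwards [h] with θ hθ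
    exact hθ.mul_const _

end Layer

/-! ### The regularized velocity -/

section Velocity

variable {m₀ : SignedMeasure ℝ} {L : ℝ} {μ : Measure ℝ} {w : ℝ → ℝ}
  {ρ : ℝ → ℝ} {ε : ℝ} {Y Z : ℝ → ℝ}

theorem IsPolar.preVelocity_eq (hp : IsPolar m₀ L μ w) (hρ : IsMollifier ρ) (hε : 0 < ε)
    (Y : ℝ → ℝ) (x : ℝ) : preVelocity ρ L m₀ ε Y x =
      layer μ w (GEps ρ ε) Y x ^ 2 - layer μ w (dGEps ρ ε) Y x ^ 2 := by
  rw [preVelocity, hp.setIntegral_eq, hp.setIntegral_eq, deriv_GEps hρ hε]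
  rfl

theorem IsPolar.uEps_eq (hp : IsPolar m₀ L μ w) (X : ℝ → ℝ → ℝ) (x t : ℝ) :
    uEps ρ L m₀ ε X x t = layer μ w (GEps ρ ε) (fun θ => X θ t) x := by
  rw [uEps, hp.setIntegral_eq]
  rfl

theorem IsPolar.velocity_congr (hp : IsPolar m₀ L μ w) (hρ : IsMollifier ρ) (hε : 0 < ε)
    (h : ∀ θ ∈ Icc (-L) L, Y θ = Z θ) : velocity ρ L m₀ ε Y = velocity ρ L m₀ ε Z := by
  have h' : ∀ᵐ θ ∂μ, Y θ = Z θ := by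
    filter_upwards [hp.mem_Icc] with θ hθ using h θ hθ
  have : preVelocity ρ L m₀ ε Y = preVelocity ρ L m₀ ε Z := by
    ext x
    rw [hp.preVelocity_eq hρ hε, hp.preVelocity_eq hρ hε, layer_congr h', layer_congr h']
  rw [velocity, velocity, this]

variable [IsFiniteMeasure μ]

theorem abs_sq_sub_sq_le {a b c : ℝ} (ha : |a| ≤ c) (hb : |b| ≤ c) : |a ^ 2 - b ^ 2| ≤ c ^ 2 := by
  have h1 := sq_le_sq' (abs_le.1 ha).1 (abs_le.1 ha).2
  have h2 := sq_le_sq' (abs_le.1 hb).1 (abs_le.1 hb).2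
  rw [abs_le]
  constructor <;> nlinarith [sq_nonneg a, sq_nonneg b]

theorem IsPolar.abs_preVelocity_le (hp : IsPolar m₀ L μ w) (hρ : IsMollifier ρ) (hε : 0 < ε)
    (Y : ℝ → ℝ) (x : ℝ) : |preVelocity ρ L m₀ ε Y x| ≤ (1 / 2 * μ.real univ) ^ 2 := by
  rw [hp.preVelocity_eq hρ hε]
  exact abs_sq_sub_sq_le (abs_layer_le hp.abs_eq_one (abs_GEps_le hρ hε) x)
    (abs_layer_le hp.abs_eq_one (abs_dGEps_le hρ hε) x)

/-- The regularized velocity is bounded uniformly in `ε`. -/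
theorem IsPolar.abs_velocity_le (hp : IsPolar m₀ L μ w) (hρ : IsMollifier ρ) (hε : 0 < ε)
    (Y : ℝ → ℝ) (x : ℝ) : |velocity ρ L m₀ ε Y x| ≤ (1 / 2 * μ.real univ) ^ 2 :=
  hρ.abs_convolution_le hε (hp.abs_preVelocity_le hρ hε Y) x

theorem abs_sq_sub_sq_le_mul {a a' c d : ℝ} (ha : |a| ≤ c) (ha' : |a'| ≤ c) (h : |a - a'| ≤ d) :
    |a ^ 2 - a' ^ 2| ≤ 2 * c * d := by
  have h1 : a ^ 2 - a' ^ 2 = (a + a') * (a - a') := by ring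
  rw [h1, abs_mul]
  have h2 := (abs_add_le a a').trans (add_le_add ha ha')
  rw [← two_mul] at h2
  exact mul_le_mul h2 h (abs_nonneg _) ((abs_nonneg _).trans h2)

/-- For fixed `ε` the velocity is Lipschitz in the point and in the configuration. -/
theorem IsPolar.exists_abs_preVelocity_sub_le (hp : IsPolar m₀ L μ w) (hρ : IsMollifier ρ)
    (hε : 0 < ε) : ∃ K, 0 ≤ K ∧ ∀ (Y Z : ℝ → ℝ) (c : ℝ), AEMeasurable Y μ → AEMeasurable Z μ →
      (∀ᵐ θ ∂μ, |Y θ - Z θ| ≤ c) → ∀ x y,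
      |preVelocity ρ L m₀ ε Y x - preVelocity ρ L m₀ ε Z y| ≤ K * (|x - y| + c) := by
  obtain ⟨A, hA0, hA⟩ := exists_abs_dGEps_sub_le hρ hε
  set M := μ.real univ with hM
  have hM0 : 0 ≤ M := measureReal_nonneg
  refine ⟨M * (1 / 2 * M) + M * (A * M), by positivity, fun Y Z c hY hZ hc x y => ?_⟩
  have key : ∀ᵐ θ ∂μ, |(x - Y θ) - (y - Z θ)| ≤ |x - y| + c := by
    filter_upwards [hc] with θ hθ
    have e : (x - Y θ) - (y - Z θ) = (x - y) - (Y θ - Z θ) := by ring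
    rw [e]
    exact (abs_sub _ _).trans (by linarith)
  have h1 : |layer μ w (GEps ρ ε) Y x - layer μ w (GEps ρ ε) Z y|
      ≤ (1 / 2 * (|x - y| + c)) * M := by
    refine abs_layer_sub_le hp.measurable hp.abs_eq_one (continuous_GEps hρ hε).measurable
      (abs_GEps_le hρ hε) hY hZ ?_
    filter_upwards [key] with θ hθ
    exact (abs_GEps_sub_le hρ hε _ _).trans (by gcongr)
  have h2 : |layer μ w (dGEps ρ ε) Y x - layer μ w (dGEps ρ ε) Z y|
      ≤ (A * (|x - y| + c)) * M := by
    refine abs_layer_sub_le hp.measurable hp.abs_eq_one (continuous_dGEps hρ hε).measurable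
      (abs_dGEps_le hρ hε) hY hZ ?_
    filter_upwards [key] with θ hθ
    exact (hA _ _).trans (by gcongr)
  have h3 := abs_sq_sub_sq_le_mul (abs_layer_le hp.abs_eq_one (abs_GEps_le hρ hε) x)
    (abs_layer_le hp.abs_eq_one (abs_GEps_le hρ hε) y) h1
  have h4 := abs_sq_sub_sq_le_mul (abs_layer_le hp.abs_eq_one (abs_dGEps_le hρ hε) x)
    (abs_layer_le hp.abs_eq_one (abs_dGEps_le hρ hε) y) h2
  rw [hp.preVelocity_eq hρ hε, hp.preVelocity_eq hρ hε]
  have e : ∀ a b c d : ℝ, a - b - (c - d) = (a - c) - (b - d) := fun a b c d => by ring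
  rw [e]
  refine (abs_sub _ _).trans ((add_le_add h3 h4).trans (le_of_eq ?_))
  rw [← hM]; ring

theorem IsPolar.continuous_preVelocity (hp : IsPolar m₀ L μ w) (hρ : IsMollifier ρ)
    (hε : 0 < ε) (hY : AEMeasurable Y μ) : Continuous (preVelocity ρ L m₀ ε Y) := by
  obtain ⟨K, hK0, hK⟩ := hp.exists_abs_preVelocity_sub_le hρ hε
  refine (LipschitzWith.of_dist_le_mul (K := ⟨K, hK0⟩) fun x y => ?_).continuous
  have := hK Y Y 0 hY hY (Eventually.of_forall fun θ => by simp) x y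
  rw [add_zero] at this
  rw [Real.dist_eq, Real.dist_eq]
  exact this

theorem IsPolar.exists_abs_velocity_sub_le (hp : IsPolar m₀ L μ w) (hρ : IsMollifier ρ)
    (hε : 0 < ε) : ∃ K : ℝ≥0, ∀ (Y Z : ℝ → ℝ) (c : ℝ), AEMeasurable Y μ → AEMeasurable Z μ →
      (∀ᵐ θ ∂μ, |Y θ - Z θ| ≤ c) → ∀ x y,
      |velocity ρ L m₀ ε Y x - velocity ρ L m₀ ε Z y| ≤ K * (|x - y| + c) := by
  obtain ⟨K, hK0, hK⟩ := hp.exists_abs_preVelocity_sub_le hρ hε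
  refine ⟨⟨K, hK0⟩, fun Y Z c hY hZ hc x y => ?_⟩
  refine hρ.abs_convolution_sub_le hε (hp.continuous_preVelocity hρ hε hY).measurable
    (hp.abs_preVelocity_le hρ hε Y) (hp.continuous_preVelocity hρ hε hZ).measurable
    (hp.abs_preVelocity_le hρ hε Z) fun z => ?_
  have := hK Y Z c hY hZ hc (x - z) (y - z)
  rwa [sub_sub_sub_cancel_right] at this

theorem IsPolar.hasDerivAt_layer_GEps (hp : IsPolar m₀ L μ w) (hρ : IsMollifier ρ) (hε : 0 < ε)
    (hY : AEMeasurable Y μ) (x : ℝ) :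
    HasDerivAt (layer μ w (GEps ρ ε) Y) (layer μ w (dGEps ρ ε) Y x) x :=
  hasDerivAt_layer hp.measurable hp.abs_eq_one (abs_GEps_le hρ hε) (abs_dGEps_le hρ hε)
    (hasDerivAt_GEps hρ hε) (continuous_dGEps hρ hε).measurable hY x

theorem IsPolar.hasDerivAt_layer_dGEps (hp : IsPolar m₀ L μ w) (hρ : IsMollifier ρ) (hε : 0 < ε)
    (hY : AEMeasurable Y μ) (x : ℝ) :
    HasDerivAt (layer μ w (dGEps ρ ε) Y)
      (layer μ w (GEps ρ ε) Y x - layer μ w (rhoEps ρ ε) Y x) x := by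
  obtain ⟨r, hr0, hr⟩ := hρ.exists_rhoEps_le hε
  refine (hasDerivAt_layer (c := 1 / 2 + r) hp.measurable hp.abs_eq_one (abs_dGEps_le hρ hε)
    (fun x => (abs_sub _ _).trans (add_le_add (abs_GEps_le hρ hε x) (hr x)))
    (hasDerivAt_dGEps hρ hε) ((continuous_GEps hρ hε).sub hρ.continuous_rhoEps).measurable
    hY x).congr_deriv ?_
  rw [layer, layer, layer, ← integral_sub
    (integrable_layer hp.measurable hp.abs_eq_one (continuous_GEps hρ hε).measurable
      (abs_GEps_le hρ hε) hY x)
    (integrable_layer hp.measurable hp.abs_eq_one hρ.continuous_rhoEps.measurable hr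
      hY x)]
  simp only [sub_mul]

end Velocity

/-! ### The regularized flow: existence, uniqueness, monotonicity -/

/-- A bounded Lipschitz vector field on a Banach space has global integral curves. -/
theorem exists_global_integralCurve {E : Type*} [NormedAddCommGroup E] [NormedSpace ℝ E]
    [CompleteSpace E] {F : E → E} {K B : ℝ≥0} (hF : LipschitzWith K F) (hB : ∀ x, ‖F x‖ ≤ B)
    (x₀ : E) : ∃ α : ℝ → E, α 0 = x₀ ∧ ∀ t, HasDerivAt α (F (α t)) t := by
  have loc : ∀ N : ℕ, ∃ α : ℝ → E, α 0 = x₀ ∧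
      ∀ t ∈ Ioo (-(N + 1 : ℝ)) (N + 1), HasDerivAt α (F (α t)) t := by
    intro N
    have hN : (0 : ℝ) ≤ N + 1 := by positivity
    have hpl : IsPicardLindelof (fun _ => F) (tmin := -(N + 1 : ℝ)) (tmax := N + 1)
        ⟨0, by constructor <;> linarith⟩ x₀ (B * (N + 1)) 0 B K :=
      IsPicardLindelof.of_time_independent (fun x _ => hB x) hF.lipschitzOnWith (by simp)
    obtain ⟨α, hα0, hα⟩ := hpl.exists_eq_forall_mem_Icc_hasDerivWithinAt₀
    exact ⟨α, hα0, fun t ht => (hα t (Ioo_subset_Icc_self ht)).hasDerivAt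
      (Icc_mem_nhds ht.1 ht.2)⟩
  choose α hα0 hα using loc
  have agree : ∀ N M : ℕ, N ≤ M → EqOn (α N) (α M) (Ioo (-(N + 1 : ℝ)) (N + 1)) := by
    intro N M hNM
    have hNM' : (N : ℝ) ≤ M := by exact_mod_cast hNM
    refine ODE_solution_unique_of_mem_Ioo (v := fun _ => F) (s := fun _ => univ) (t₀ := 0)
      (K := K) (fun t _ => hF.lipschitzOnWith)
      (by constructor <;> linarith [(Nat.cast_nonneg N : (0 : ℝ) ≤ N)])
      (fun t ht => ⟨hα N t ht, trivial⟩) (fun t ht => ⟨hα M t ?_, trivial⟩)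
      (by rw [hα0, hα0])
    constructor <;> linarith [ht.1, ht.2]
  have mem : ∀ t : ℝ, t ∈ Ioo (-((⌈|t|⌉₊ : ℝ) + 1)) ((⌈|t|⌉₊ : ℝ) + 1) := by
    intro t
    have h1 := Nat.le_ceil |t|
    have h2 := abs_le.1 h1
    constructor <;> linarith [h2.1, h2.2]
  refine ⟨fun t => α ⌈|t|⌉₊ t, hα0 _, fun t => ?_⟩
  refine (hα _ t (mem t)).congr_of_eventuallyEq ?_
  filter_upwards [Ioo_mem_nhds (mem t).1 (mem t).2] with s hs
  rcases le_total ⌈|s|⌉₊ ⌈|t|⌉₊ with h | h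
  · exact agree _ _ h (mem s)
  · exact (agree _ _ h hs).symm

section Flow

variable {m₀ : SignedMeasure ℝ} {L : ℝ} {μ : Measure ℝ} [IsFiniteMeasure μ] {w : ℝ → ℝ}
  {ρ : ℝ → ℝ} {ε : ℝ}

/-- The regularized dynamics as an autonomous differential equation in `C([-L, L])`, with a bounded
Lipschitz vector field. -/
theorem IsPolar.exists_vectorField (hp : IsPolar m₀ L μ w) (hρ : IsMollifier ρ) (hε : 0 < ε)
    (hL : -L ≤ L) : ∃ (F : C(Icc (-L) L, ℝ) → C(Icc (-L) L, ℝ)) (K B : ℝ≥0),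
      LipschitzWith K F ∧ (∀ Y, ‖F Y‖ ≤ B) ∧
      ∀ Y ξ, F Y ξ = velocity ρ L m₀ ε (IccExtend hL Y) (Y ξ) := by
  obtain ⟨K, hK⟩ := hp.exists_abs_velocity_sub_le hρ hε
  have hm : ∀ Y : C(Icc (-L) L, ℝ), AEMeasurable (IccExtend hL Y) μ := fun Y =>
    (Y.continuous.Icc_extend' (h := hL)).measurable.aemeasurable
  have hc : ∀ Y : C(Icc (-L) L, ℝ), Continuous (velocity ρ L m₀ ε (IccExtend hL Y)) := by
    intro Y
    refine (LipschitzWith.of_dist_le_mul (K := K) fun x y => ?_).continuous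
    have := hK _ _ 0 (hm Y) (hm Y) (Eventually.of_forall fun θ => by simp) x y
    rwa [add_zero] at this
  refine ⟨fun Y => ⟨fun ξ => velocity ρ L m₀ ε (IccExtend hL Y) (Y ξ),
    (hc Y).comp Y.continuous⟩, K * 2,
    Real.toNNReal ((1 / 2 * μ.real univ) ^ 2), ?_, ?_,
    fun _ _ => rfl⟩
  · refine LipschitzWith.of_dist_le_mul fun Y Z => ?_
    rw [ContinuousMap.dist_le (by positivity)]
    intro ξ
    have h1 : ∀ ξ, |Y ξ - Z ξ| ≤ dist Y Z := fun ξ =>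
      ContinuousMap.dist_apply_le_dist (f := Y) (g := Z) ξ
    have := hK _ _ (dist Y Z) (hm Y) (hm Z) (Eventually.of_forall fun θ => h1 _) (Y ξ) (Z ξ)
    refine this.trans ?_
    have h2 := h1 ξ
    push_cast
    rw [mul_assoc]
    gcongr
    linarith
  · intro Y
    rw [Real.coe_toNNReal _ (by positivity), ContinuousMap.norm_le _ (by positivity)]
    intro ξ
    exact hp.abs_velocity_le hρ hε _ _

theorem IsPolar.exists_isRegularizedFlow (hp : IsPolar m₀ L μ w) (hρ : IsMollifier ρ)
    (hε : 0 < ε) (hL : -L ≤ L) : ∃ X, IsRegularizedFlow ρ L m₀ ε X := by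
  obtain ⟨F, K, B, hF, hB, hFv⟩ := hp.exists_vectorField hρ hε hL
  obtain ⟨α, hα0, hα⟩ := exists_global_integralCurve hF hB
    (⟨fun ξ => (ξ : ℝ), continuous_subtype_val⟩ : C(Icc (-L) L, ℝ))
  have hαc : Continuous α := continuous_iff_continuousAt.2 fun t => (hα t).continuousAt
  refine ⟨fun ξ t => IccExtend hL (α t) ξ, ?_, ?_, ?_⟩
  · have : Continuous fun p : ℝ × ℝ => α p.2 (projIcc (-L) L hL p.1) :=
      (hαc.comp continuous_snd).eval (continuous_projIcc.comp continuous_fst)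
    exact this.continuousOn
  · intro ξ hξ
    simp only [IccExtend_of_mem hL _ hξ, hα0]
    rfl
  · intro ξ hξ t _
    simp only [IccExtend_of_mem hL _ hξ]
    have := ((ContinuousMap.evalCLM ℝ (⟨ξ, hξ⟩ : Icc (-L) L)).hasFDerivAt.comp_hasDerivAt t
      (hα t)).hasDerivWithinAt (s := Ici 0)
    refine this.congr_deriv ?_
    exact hFv _ _

omit [IsFiniteMeasure μ] in
/-- A regularized flow is an integral curve in `C([-L, L])`. -/
theorem IsRegularizedFlow.exists_curve (hp : IsPolar m₀ L μ w) (hρ : IsMollifier ρ)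
    (hε : 0 < ε) (hL : -L ≤ L) {F : C(Icc (-L) L, ℝ) → C(Icc (-L) L, ℝ)} (hFc : Continuous F)
    (hF : ∀ Y ξ, F Y ξ = velocity ρ L m₀ ε (IccExtend hL Y) (Y ξ)) {X : ℝ → ℝ → ℝ}
    (hX : IsRegularizedFlow ρ L m₀ ε X) :
    ∃ c : ℝ → C(Icc (-L) L, ℝ), Continuous c ∧ (∀ t, 0 ≤ t → ∀ ξ, c t ξ = X ξ t) ∧
      ∀ t, 0 ≤ t → HasDerivWithinAt c (F (c t)) (Ici t) t := by
  have hcont : Continuous fun p : ℝ × Icc (-L) L => X p.2 (max p.1 0) := by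
    have h : Continuous fun p : ℝ × Icc (-L) L => ((p.2 : ℝ), max p.1 0) := by fun_prop
    exact hX.continuousOn.comp_continuous h fun p => ⟨p.2.2, le_max_right p.1 0⟩
  set c : C(ℝ, C(Icc (-L) L, ℝ)) := ContinuousMap.curry ⟨_, hcont⟩ with hcdef
  have hc : ∀ t, 0 ≤ t → ∀ ξ, c t ξ = X ξ t := by
    intro t ht ξ
    have : c t ξ = X ξ (max t 0) := rfl
    rw [this, max_eq_left ht]
  have hFcc : Continuous fun s => F (c s) := hFc.comp c.continuous
  have hvel : ∀ s, 0 ≤ s → ∀ ξ : Icc (-L) L,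
      F (c s) ξ = velocity ρ L m₀ ε (fun θ => X θ s) (X ξ s) := by
    intro s hs ξ
    rw [hF, hc s hs, hp.velocity_congr hρ hε (Z := fun θ => X θ s)]
    intro θ hθ
    rw [IccExtend_of_mem hL _ hθ, hc s hs]
  have hint : ∀ t, 0 ≤ t → c t = c 0 + ∫ s in (0 : ℝ)..t, F (c s) := by
    intro t ht
    ext ξ
    rw [ContinuousMap.add_apply]
    have h1 : (∫ s in (0 : ℝ)..t, F (c s)) ξ = ∫ s in (0 : ℝ)..t, F (c s) ξ :=
      ((ContinuousMap.evalCLM ℝ ξ).intervalIntegral_comp_comm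
        (hFcc.intervalIntegrable 0 t)).symm
    have h2 : ∫ s in (0 : ℝ)..t, F (c s) ξ = c t ξ - c 0 ξ := by
      refine intervalIntegral.integral_eq_sub_of_hasDerivAt_of_le ht
        (f := fun s => c s ξ) ?_ ?_ ?_
      · exact (c.continuous.eval continuous_const).continuousOn
      · intro s hs
        rw [hvel s hs.1.le]
        have h3 := (hX.ode ξ ξ.2 s hs.1.le).hasDerivAt (Ici_mem_nhds hs.1)
        refine h3.congr_of_eventuallyEq ?_
        filter_upwards [lt_mem_nhds hs.1] with r hr
        exact hc r hr.le ξ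
      · exact (hFcc.eval continuous_const).intervalIntegrable 0 t
    rw [h1, h2]; ring
  refine ⟨c, c.continuous, hc, fun t ht => ?_⟩
  have h1 : HasDerivAt (fun t => c 0 + ∫ s in (0 : ℝ)..t, F (c s)) (F (c t)) t :=
    (intervalIntegral.integral_hasDerivAt_right (hFcc.intervalIntegrable _ _)
      hFcc.aestronglyMeasurable.stronglyMeasurableAtFilter hFcc.continuousAt).const_add _
  exact h1.hasDerivWithinAt.congr (fun s hs => hint s (ht.trans hs)) (hint t ht)

theorem IsRegularizedFlow.unique (hp : IsPolar m₀ L μ w) (hρ : IsMollifier ρ)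
    (hε : 0 < ε) (hL : -L ≤ L) {X Y : ℝ → ℝ → ℝ} (hX : IsRegularizedFlow ρ L m₀ ε X)
    (hY : IsRegularizedFlow ρ L m₀ ε Y) {ξ : ℝ} (hξ : ξ ∈ Icc (-L) L) {t : ℝ} (ht : 0 ≤ t) :
    Y ξ t = X ξ t := by
  obtain ⟨F, K, B, hF, hB, hFv⟩ := hp.exists_vectorField hρ hε hL
  obtain ⟨c, hc, hcX, hc'⟩ := hX.exists_curve hp hρ hε hL hF.continuous hFv
  obtain ⟨d, hd, hdY, hd'⟩ := hY.exists_curve hp hρ hε hL hF.continuous hFv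
  have h0 : c 0 = d 0 := by
    ext ξ
    rw [hcX 0 le_rfl, hdY 0 le_rfl, hX.initial ξ ξ.2, hY.initial ξ ξ.2]
  have := ODE_solution_unique (v := fun _ => F) (a := 0) (b := t) (fun _ => hF) hc.continuousOn
    (fun s hs => hc' s hs.1) hd.continuousOn (fun s hs => hd' s hs.1) h0 ⟨ht, le_rfl⟩
  have h2 := congrArg (fun f : C(Icc (-L) L, ℝ) => f ⟨ξ, hξ⟩) this
  simp only [hcX t ht, hdY t ht] at h2
  exact h2.symm

theorem IsRegularizedFlow.continuousOn_label {X : ℝ → ℝ → ℝ} (hX : IsRegularizedFlow ρ L m₀ ε X)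
    {t : ℝ} (ht : 0 ≤ t) : ContinuousOn (fun θ => X θ t) (Icc (-L) L) :=
  hX.continuousOn.comp (f := fun θ : ℝ => (θ, t)) (by fun_prop) fun _ hθ => ⟨hθ, ht⟩

theorem IsRegularizedFlow.continuousOn_time {X : ℝ → ℝ → ℝ} (hX : IsRegularizedFlow ρ L m₀ ε X)
    {ξ : ℝ} (hξ : ξ ∈ Icc (-L) L) : ContinuousOn (fun t => X ξ t) (Ici 0) :=
  hX.continuousOn.comp (f := fun t : ℝ => (ξ, t)) (by fun_prop) fun _ ht => ⟨hξ, ht⟩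

/-- Trajectories do not cross: after a meeting time they coincide, by uniqueness. -/
theorem IsRegularizedFlow.mono (hp : IsPolar m₀ L μ w) (hρ : IsMollifier ρ)
    (hε : 0 < ε) {X : ℝ → ℝ → ℝ} (hX : IsRegularizedFlow ρ L m₀ ε X)
    {ξ η : ℝ} (hξ : ξ ∈ Icc (-L) L) (hη : η ∈ Icc (-L) L) (h : ξ ≤ η) {t : ℝ} (ht : 0 ≤ t) :
    X ξ t ≤ X η t := by
  by_contra! hlt
  obtain ⟨K, hK⟩ := hp.exists_abs_velocity_sub_le hρ hε
  have hm : ∀ s, 0 ≤ s → AEMeasurable (fun θ => X θ s) μ := by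
    intro s hs
    have h1 : μ.restrict (Icc (-L) L) = μ := Measure.restrict_eq_self_of_ae_mem hp.mem_Icc
    rw [← h1]
    exact (hX.continuousOn_label hs).aemeasurable measurableSet_Icc
  have hcont : ContinuousOn (fun s => X η s - X ξ s) (Icc 0 t) :=
    ((hX.continuousOn_time hη).sub (hX.continuousOn_time hξ)).mono Icc_subset_Ici_self
  obtain ⟨s, hs, hs0⟩ := intermediate_value_Icc' ht hcont
    (show (0 : ℝ) ∈ Icc (X η t - X ξ t) (X η 0 - X ξ 0) by
      rw [hX.initial ξ hξ, hX.initial η hη]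
      constructor <;> linarith)
  have huniq := ODE_solution_unique_of_mem_Icc_right (K := K)
    (v := fun r => velocity ρ L m₀ ε (fun θ => X θ r)) (s := fun _ => univ)
    (f := fun r => X η r) (g := fun r => X ξ r) (a := s) (b := t)
    (fun r hr => ?_) ?_ ?_ (fun _ _ => trivial) ?_ ?_ (fun _ _ => trivial)
    (sub_eq_zero.1 hs0) ⟨hs.2, le_rfl⟩
  · exact hlt.ne huniq
  · refine (LipschitzWith.of_dist_le_mul fun x y => ?_).lipschitzOnWith
    have := hK _ _ 0 (hm r (hs.1.trans hr.1)) (hm r (hs.1.trans hr.1))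
      (Eventually.of_forall fun θ => by simp) x y
    rwa [add_zero] at this
  · exact (hX.continuousOn_time hη).mono fun r hr => hs.1.trans hr.1
  · intro r hr
    exact (hX.ode η hη r (hs.1.trans hr.1)).mono (Ici_subset_Ici.2 (hs.1.trans hr.1))
  · exact (hX.continuousOn_time hξ).mono fun r hr => hs.1.trans hr.1
  · intro r hr
    exact (hX.ode ξ hξ r (hs.1.trans hr.1)).mono (Ici_subset_Ici.2 (hs.1.trans hr.1))

theorem IsRegularizedFlow.abs_sub_le (hp : IsPolar m₀ L μ w) (hρ : IsMollifier ρ)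
    (hε : 0 < ε) {X : ℝ → ℝ → ℝ} (hX : IsRegularizedFlow ρ L m₀ ε X)
    {ξ : ℝ} (hξ : ξ ∈ Icc (-L) L) {s t : ℝ} (hs : 0 ≤ s) (ht : 0 ≤ t) :
    |X ξ t - X ξ s| ≤ (1 / 2 * μ.real univ) ^ 2 * |t - s| :=
  (convex_Ici (0 : ℝ)).norm_image_sub_le_of_norm_hasDerivWithin_le
    (f := fun t => X ξ t) (fun r hr => hX.ode ξ hξ r hr)
    (fun _ _ => hp.abs_velocity_le hρ hε _ _) hs ht

/-! #### Extension of the flow to all labels and times -/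

/-- The nearest point of `[-L, L]`. -/
def clamp (L θ : ℝ) : ℝ := max (-L) (min L θ)

theorem clamp_mem (hL : -L ≤ L) (θ : ℝ) : clamp L θ ∈ Icc (-L) L :=
  ⟨le_max_left _ _, max_le hL (min_le_left _ _)⟩

theorem clamp_of_mem {θ : ℝ} (h : θ ∈ Icc (-L) L) : clamp L θ = θ := by
  rw [clamp, min_eq_right h.2, max_eq_right h.1]

theorem monotone_clamp : Monotone (clamp L) := fun _ _ h =>
  max_le_max le_rfl (min_le_min le_rfl h)

theorem continuous_clamp : Continuous (clamp L) := by unfold clamp; fun_prop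

/-- The flow `X`, extended by constants in the label outside `[-L, L]` and in time before `0`. -/
def extendFlow (L : ℝ) (X : ℝ → ℝ → ℝ) (θ t : ℝ) : ℝ := X (clamp L θ) (max t 0)

/-- `Y θ t` is the position at time `t` of the particle `θ`. The properties listed hold for all
regularized flows, with `C` independent of `ε`, and pass to pointwise limits. Continuity in the
label is not among them: particles may concentrate or spread out in the limit. -/
structure IsMotion (L C : ℝ) (Y : ℝ → ℝ → ℝ) : Prop where
  measurable : Measurable (uncurry Y)
  abs_sub_le : ∀ θ s t, |Y θ t - Y θ s| ≤ C * |t - s|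
  initial : ∀ θ, Y θ 0 = clamp L θ

theorem IsRegularizedFlow.continuous_extendFlow (hL : -L ≤ L) {X : ℝ → ℝ → ℝ}
    (hX : IsRegularizedFlow ρ L m₀ ε X) : Continuous (uncurry (extendFlow L X)) := by
  have h : Continuous fun p : ℝ × ℝ => (clamp L p.1, max p.2 0) := by
    have := continuous_clamp (L := L)
    fun_prop
  exact hX.continuousOn.comp_continuous h fun p => ⟨clamp_mem hL _, le_max_right p.2 0⟩

theorem IsRegularizedFlow.isMotion (hp : IsPolar m₀ L μ w) (hρ : IsMollifier ρ)
    (hε : 0 < ε) (hL : -L ≤ L) {X : ℝ → ℝ → ℝ} (hX : IsRegularizedFlow ρ L m₀ ε X) :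
    IsMotion L ((1 / 2 * μ.real univ) ^ 2) (extendFlow L X) where
  measurable := (hX.continuous_extendFlow hL).measurable
  abs_sub_le θ s t := by
    refine (hX.abs_sub_le hp hρ hε (clamp_mem hL θ) (le_max_right s 0) (le_max_right t 0)).trans ?_
    have := abs_max_sub_max_le_abs t s 0
    gcongr
  initial θ := by
    rw [extendFlow, max_self, hX.initial _ (clamp_mem hL θ)]

theorem IsRegularizedFlow.monotone_extendFlow (hp : IsPolar m₀ L μ w) (hρ : IsMollifier ρ)
    (hε : 0 < ε) (hL : -L ≤ L) {X : ℝ → ℝ → ℝ} (hX : IsRegularizedFlow ρ L m₀ ε X) (t : ℝ) :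
    Monotone fun θ => extendFlow L X θ t := fun _ _ h =>
  hX.mono hp hρ hε (clamp_mem hL _) (clamp_mem hL _) (monotone_clamp h) (le_max_right _ _)

theorem extendFlow_of_mem {X : ℝ → ℝ → ℝ} {θ t : ℝ} (hθ : θ ∈ Icc (-L) L) (ht : 0 ≤ t) :
    extendFlow L X θ t = X θ t := by
  rw [extendFlow, clamp_of_mem hθ, max_eq_left ht]

omit [IsFiniteMeasure μ] in
theorem IsRegularizedFlow.hasDerivWithinAt_extendFlow (hp : IsPolar m₀ L μ w)
    (hρ : IsMollifier ρ) (hε : 0 < ε) (hL : -L ≤ L) {X : ℝ → ℝ → ℝ}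
    (hX : IsRegularizedFlow ρ L m₀ ε X) (θ : ℝ) {t : ℝ} (ht : 0 ≤ t) :
    HasDerivWithinAt (extendFlow L X θ)
      (velocity ρ L m₀ ε (fun θ => extendFlow L X θ t) (extendFlow L X θ t)) (Ici 0) t := by
  have h1 := hX.ode _ (clamp_mem hL θ) t ht
  have h2 : velocity ρ L m₀ ε (fun θ => extendFlow L X θ t) = velocity ρ L m₀ ε (fun θ => X θ t) :=
    hp.velocity_congr hρ hε fun θ hθ => extendFlow_of_mem hθ ht
  rw [h2]
  have h3 : ∀ s ∈ Ici (0 : ℝ), extendFlow L X θ s = X (clamp L θ) s := fun s hs => by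
    rw [extendFlow, max_eq_left hs]
  rw [h3 t ht]
  exact h1.congr h3 (h3 t ht)

omit [IsFiniteMeasure μ] in
theorem IsPolar.layer_extendFlow (hp : IsPolar m₀ L μ w) {X : ℝ → ℝ → ℝ} {t : ℝ} (ht : 0 ≤ t)
    (g : ℝ → ℝ) : layer μ w g (fun θ => extendFlow L X θ t) = layer μ w g fun θ => X θ t := by
  refine layer_congr ?_
  filter_upwards [hp.mem_Icc] with θ hθ using extendFlow_of_mem hθ ht

end Flow

/-! ### Helly's selection theorem for motions -/

theorem exists_subseq_tendsto_of_countable {ι : Type*} [Countable ι] (f : ℕ → ι → ℝ) (R : ι → ℝ)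
    (h : ∀ n i, |f n i| ≤ R i) : ∃ k : ℕ → ℕ, StrictMono k ∧
      ∀ i, ∃ l, Tendsto (fun n => f (k n) i) atTop (𝓝 l) := by
  have hK : IsCompact (Set.pi univ fun i => Icc (-R i) (R i)) :=
    isCompact_univ_pi fun i => isCompact_Icc
  obtain ⟨l, -, k, hk, hl⟩ := hK.tendsto_subseq (x := f) fun n i _ => abs_le.1 (h n i)
  exact ⟨k, hk, fun i => ⟨l i, (tendsto_pi_nhds.1 hl) i⟩⟩

/-- Pointwise convergence of monotone functions on a dense set propagates to the continuity points
of the (monotone) upper limit. -/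
theorem tendsto_limsup_of_continuousAt {f : ℕ → ℝ → ℝ} (hf : ∀ n, Monotone (f n)) {R : ℝ}
    (hR : ∀ n x, |f n x| ≤ R) (hq : ∀ q : ℚ, ∃ l, Tendsto (fun n => f n q) atTop (𝓝 l)) :
    Monotone (fun x => limsup (fun n => f n x) atTop) ∧
    ∀ x, ContinuousAt (fun x => limsup (fun n => f n x) atTop) x →
      Tendsto (fun n => f n x) atTop (𝓝 (limsup (fun n => f n x) atTop)) := by
  have hq' : ∀ q : ℚ, Tendsto (fun n => f n q) atTop (𝓝 (limsup (fun n => f n q) atTop)) := by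
    intro q
    obtain ⟨l, hl⟩ := hq q
    rwa [hl.limsup_eq]
  have hbdd : ∀ x, IsBoundedUnder (· ≤ ·) atTop fun n => f n x := fun x =>
    isBoundedUnder_of ⟨R, fun n => (abs_le.1 (hR n x)).2⟩
  have hcob : ∀ x, IsCoboundedUnder (· ≤ ·) atTop fun n => f n x := fun x =>
    (isBoundedUnder_of ⟨-R, fun n => (abs_le.1 (hR n x)).1⟩ :
      IsBoundedUnder (· ≥ ·) atTop fun n => f n x).isCoboundedUnder_le
  refine ⟨fun x y hxy => limsup_le_limsup (Eventually.of_forall fun n => hf n hxy) (hcob x)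
    (hbdd y), fun x hx => tendsto_order.2 ⟨fun a ha => ?_, fun a ha => ?_⟩⟩
  · obtain ⟨l, u, hlu, hsub⟩ := mem_nhds_iff_exists_Ioo_subset.1 (hx.eventually (lt_mem_nhds ha))
    obtain ⟨q, hlq, hqx⟩ := exists_rat_btwn hlu.1
    have h1 : a < limsup (fun n => f n q) atTop := hsub ⟨hlq, hqx.trans hlu.2⟩
    filter_upwards [(hq' q).eventually (lt_mem_nhds h1)] with n hn
    exact hn.trans_le (hf n hqx.le)
  · obtain ⟨l, u, hlu, hsub⟩ := mem_nhds_iff_exists_Ioo_subset.1 (hx.eventually (gt_mem_nhds ha))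
    obtain ⟨q, hxq, hqu⟩ := exists_rat_btwn hlu.2
    have h1 : limsup (fun n => f n q) atTop < a := hsub ⟨hlu.1.trans hxq, hqu⟩
    filter_upwards [(hq' q).eventually (gt_mem_nhds h1)] with n hn
    exact (hf n hxq.le).trans_lt hn

/-- **Helly's selection theorem** for functions that are monotone in the label `θ` and uniformly
Lipschitz in time: a subsequence converges at every point. -/
theorem exists_subseq_tendsto_of_monotone {f : ℕ → ℝ → ℝ → ℝ} {C : ℝ} {R : ℝ → ℝ}
    (mono : ∀ n t, Monotone fun θ => f n θ t) (hb : ∀ n θ t, |f n θ t| ≤ R t)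
    (lip : ∀ n θ s t, |f n θ t - f n θ s| ≤ C * |t - s|) :
    ∃ k : ℕ → ℕ, StrictMono k ∧ ∃ g : ℝ → ℝ → ℝ,
      ∀ θ t, Tendsto (fun n => f (k n) θ t) atTop (𝓝 (g θ t)) := by
  obtain ⟨k₁, hk₁, h₁⟩ := exists_subseq_tendsto_of_countable
    (fun n (p : ℚ × ℚ) => f n p.1 p.2) (fun p => R p.2) fun n p => hb n _ _
  set H : ℚ → ℝ → ℝ := fun s x => limsup (fun n => f (k₁ n) x s) atTop with hH
  have hHs := fun s : ℚ => tendsto_limsup_of_continuousAt (f := fun n θ => f (k₁ n) θ s)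
    (fun n => mono (k₁ n) s) (fun n x => hb (k₁ n) x s) (fun q => h₁ (q, s))
  -- the exceptional labels form a countable set, on which a further subsequence converges
  set D : Set ℝ := ⋃ s : ℚ, {x | ¬ContinuousAt (H s) x} with hD
  have hDc : D.Countable := countable_iUnion fun s => (hHs s).1.countable_not_continuousAt
  have : Countable D := hDc.to_subtype
  obtain ⟨k₂, hk₂, h₂⟩ := exists_subseq_tendsto_of_countable
    (fun n (p : D × ℚ) => f (k₁ n) p.1 p.2) (fun p => R p.2) fun n p => hb _ _ _
  have hrat : ∀ θ (s : ℚ), ∃ l, Tendsto (fun n => f (k₁ (k₂ n)) θ s) atTop (𝓝 l) := by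
    intro θ s
    by_cases hθ : θ ∈ D
    · exact h₂ (⟨θ, hθ⟩, s)
    · have hc : ContinuousAt (H s) θ := by
        by_contra h
        exact hθ (mem_iUnion.2 ⟨s, h⟩)
      exact ⟨_, ((hHs s).2 θ hc).comp hk₂.tendsto_atTop⟩
  have hreal : ∀ θ t, ∃ l, Tendsto (fun n => f (k₁ (k₂ n)) θ t) atTop (𝓝 l) := by
    intro θ t
    refine cauchySeq_tendsto_of_complete (Metric.cauchySeq_iff.2 fun ε hε => ?_)
    have hC : 0 < |C| + 1 := by positivity
    obtain ⟨s, hts, hs⟩ := exists_rat_btwn (show t < t + ε / (3 * (|C| + 1)) by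
      have : 0 < ε / (3 * (|C| + 1)) := by positivity
      linarith)
    have hsmall : C * |t - s| < ε / 3 := by
      rw [abs_sub_comm, abs_of_pos (by linarith)]
      calc C * (s - t) ≤ (|C| + 1) * (s - t) := by
            refine mul_le_mul_of_nonneg_right ?_ (by linarith)
            linarith [le_abs_self C]
        _ < (|C| + 1) * (ε / (3 * (|C| + 1))) := mul_lt_mul_of_pos_left (by linarith) hC
        _ = ε / 3 := by field_simp
    obtain ⟨l, hl⟩ := hrat θ s
    obtain ⟨N, hN⟩ := Metric.cauchySeq_iff.1 hl.cauchySeq (ε / 3) (by positivity)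
    refine ⟨N, fun m hm n hn => ?_⟩
    have h1 := hN m hm n hn
    have h2 := lip (k₁ (k₂ m)) θ s t
    have h3 := lip (k₁ (k₂ n)) θ s t
    rw [Real.dist_eq] at h1 ⊢
    rw [abs_le] at h2 h3
    rw [abs_lt] at h1 ⊢
    constructor <;> linarith [h1.1, h1.2, h2.1, h2.2, h3.1, h3.2]
  choose g hg using hreal
  exact ⟨fun n => k₁ (k₂ n), hk₁.comp hk₂, g, hg⟩

/-- Regularized flows have a subsequence which converges at every label and every time. -/
theorem exists_subseq_tendsto_flow {L C : ℝ} {Y : ℕ → ℝ → ℝ → ℝ} (hL : -L ≤ L)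
    (hY : ∀ n, IsMotion L C (Y n)) (hmono : ∀ n t, Monotone fun θ => Y n θ t) :
    ∃ k : ℕ → ℕ, StrictMono k ∧ ∃ X : ℝ → ℝ → ℝ, IsMotion L C X ∧
      ∀ θ t, Tendsto (fun n => Y (k n) θ t) atTop (𝓝 (X θ t)) := by
  have hb : ∀ n θ t, |Y n θ t| ≤ L + C * |t| := by
    intro n θ t
    have h1 := (hY n).abs_sub_le θ 0 t
    rw [(hY n).initial, sub_zero] at h1
    have h2 := clamp_mem hL θ
    rw [abs_le] at h1 ⊢
    constructor <;> linarith [h1.1, h1.2, h2.1, h2.2]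
  obtain ⟨k, hk, X, hX⟩ := exists_subseq_tendsto_of_monotone hmono hb
    fun n => (hY n).abs_sub_le
  refine ⟨k, hk, X, ⟨?_, fun θ s t => ?_, fun θ => ?_⟩, hX⟩
  · exact measurable_of_tendsto_metrizable (fun n => (hY (k n)).measurable)
      (tendsto_pi_nhds.2 fun p => hX p.1 p.2)
  · exact le_of_tendsto ((hX θ t).sub (hX θ s)).abs
      (Eventually.of_forall fun n => (hY (k n)).abs_sub_le θ s t)
  · refine tendsto_nhds_unique (hX θ 0) ?_
    simp only [(hY _).initial]
    exact tendsto_const_nhds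

/-! ### Integral estimates for superpositions -/

section Estimates

variable {μ : Measure ℝ} [IsFiniteMeasure μ] {w g Y Z : ℝ → ℝ} {A b c : ℝ}

theorem measurable_layer {X : ℝ → ℝ → ℝ} (hw : Measurable w) (hg : Measurable g)
    (hX : Measurable (uncurry X)) :
    Measurable (uncurry fun x t => layer μ w g (fun θ => X θ t) x) := by
  have h : Measurable fun q : (ℝ × ℝ) × ℝ => g (q.1.1 - X q.2 q.1.2) * w q.2 := by
    have h1 : Measurable fun q : (ℝ × ℝ) × ℝ => X q.2 q.1.2 :=
      hX.comp (by fun_prop : Measurable fun q : (ℝ × ℝ) × ℝ => (q.2, q.1.2))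
    have h2 : Measurable fun q : (ℝ × ℝ) × ℝ => q.1.1 - X q.2 q.1.2 :=
      (by fun_prop : Measurable fun q : (ℝ × ℝ) × ℝ => q.1.1).sub h1
    exact (hg.comp h2).mul (hw.comp measurable_snd)
  exact (h.stronglyMeasurable.integral_prod_right' (ν := μ)).measurable

theorem measurable_layer_space (hw : Measurable w) (hg : Measurable g) (hY : Measurable Y) :
    Measurable (layer μ w g Y) := by
  have := measurable_layer (μ := μ) (X := fun θ _ => Y θ) hw hg (hY.comp measurable_fst)
  exact this.comp (by fun_prop : Measurable fun x : ℝ => (x, (0 : ℝ)))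

/-- Superpositions of a kernel with `L¹` modulus of continuity depend in a Lipschitz way on the
positions, in the `L¹` norm. -/
theorem lintegral_layer_sub_le (hw : Measurable w) (hw1 : ∀ x, |w x| = 1) (hg : Measurable g)
    (hb : ∀ x, |g x| ≤ b) (hA : 0 ≤ A) (hgA : HasL1Modulus g A) (hY : Measurable Y)
    (hZ : Measurable Z) (hc : ∀ θ, |Y θ - Z θ| ≤ c) :
    ∫⁻ x, ‖layer μ w g Y x - layer μ w g Z x‖ₑ ≤ ENNReal.ofReal (A * c) * μ univ := by
  have hm : Measurable (uncurry fun x θ => ‖g (x - Y θ) - g (x - Z θ)‖ₑ) := by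
    have h1 : Measurable fun p : ℝ × ℝ => g (p.1 - Y p.2) := by fun_prop
    have h2 : Measurable fun p : ℝ × ℝ => g (p.1 - Z p.2) := by fun_prop
    exact (h1.sub h2).enorm
  calc ∫⁻ x, ‖layer μ w g Y x - layer μ w g Z x‖ₑ
      ≤ ∫⁻ x, ∫⁻ θ, ‖g (x - Y θ) - g (x - Z θ)‖ₑ ∂μ := by
        refine lintegral_mono fun x => ?_
        rw [layer, layer, ← integral_sub (integrable_layer hw hw1 hg hb hY.aemeasurable x)
          (integrable_layer hw hw1 hg hb hZ.aemeasurable x)]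
        refine (enorm_integral_le_lintegral_enorm _).trans (le_of_eq ?_)
        refine lintegral_congr fun θ => ?_
        rw [← sub_mul, enorm_mul, Real.enorm_eq_ofReal_abs (w θ), hw1, ENNReal.ofReal_one, mul_one]
    _ = ∫⁻ θ, (∫⁻ x, ‖g (x - Y θ) - g (x - Z θ)‖ₑ) ∂μ := lintegral_lintegral_swap hm.aemeasurable
    _ ≤ ∫⁻ _, ENNReal.ofReal (A * c) ∂μ := by
        refine lintegral_mono fun θ => (hgA _ _).trans ?_
        exact ENNReal.ofReal_le_ofReal (mul_le_mul_of_nonneg_left (hc θ) hA)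
    _ = _ := by rw [lintegral_const]

theorem lintegral_layer_le (hw1 : ∀ x, |w x| = 1) (hg : Measurable g) (hY : Measurable Y) :
    ∫⁻ x, ‖layer μ w g Y x‖ₑ ≤ (∫⁻ x, ‖g x‖ₑ) * μ univ := by
  have hm : Measurable (uncurry fun x θ => ‖g (x - Y θ)‖ₑ) := by
    have h1 : Measurable fun p : ℝ × ℝ => g (p.1 - Y p.2) := by fun_prop
    exact h1.enorm
  calc ∫⁻ x, ‖layer μ w g Y x‖ₑ
      ≤ ∫⁻ x, ∫⁻ θ, ‖g (x - Y θ)‖ₑ ∂μ := by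
        refine lintegral_mono fun x => (enorm_integral_le_lintegral_enorm _).trans (le_of_eq ?_)
        refine lintegral_congr fun θ => ?_
        rw [enorm_mul, Real.enorm_eq_ofReal_abs (w θ), hw1, ENNReal.ofReal_one, mul_one]
    _ = ∫⁻ θ, (∫⁻ x, ‖g (x - Y θ)‖ₑ) ∂μ := lintegral_lintegral_swap hm.aemeasurable
    _ = ∫⁻ _, (∫⁻ x, ‖g x‖ₑ) ∂μ := by
        refine lintegral_congr fun θ => ?_
        exact lintegral_sub_right_eq_self (fun x => ‖g x‖ₑ) (Y θ)
    _ = _ := by rw [lintegral_const]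

theorem integrable_layer_space (hw : Measurable w) (hw1 : ∀ x, |w x| = 1) (hg : Measurable g)
    (hgi : Integrable g) (hY : Measurable Y) : Integrable (layer μ w g Y) := by
  refine ⟨(measurable_layer_space hw hg hY).aestronglyMeasurable, ?_⟩
  refine (lintegral_layer_le hw1 hg hY).trans_lt ?_
  exact ENNReal.mul_lt_top hgi.2 (measure_lt_top _ _)

theorem integral_layer_mul_of_integrable {ψ : ℝ → ℝ}
    (h : Integrable (fun p : ℝ × ℝ => g (p.1 - Y p.2) * (ψ p.1 * w p.2)) (volume.prod μ)) :
    ∫ x, layer μ w g Y x * ψ x = ∫ θ, (∫ x, g (x - Y θ) * ψ x) * w θ ∂μ := by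
  calc ∫ x, layer μ w g Y x * ψ x = ∫ x, ∫ θ, g (x - Y θ) * (ψ x * w θ) ∂μ := by
        refine integral_congr_ae (Eventually.of_forall fun x => ?_)
        simp only [layer]
        rw [← integral_mul_const]
        refine integral_congr_ae (Eventually.of_forall fun θ => ?_)
        simp only; ring
    _ = _ := integral_integral_swap (f := fun x θ => g (x - Y θ) * (ψ x * w θ)) h
    _ = _ := by
        refine integral_congr_ae (Eventually.of_forall fun θ => ?_)
        simp only
        rw [← integral_mul_const]
        refine integral_congr_ae (Eventually.of_forall fun x => ?_)
        simp only; ring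

/-- Fubini's theorem for the pairing of the superposition of a bounded kernel with an integrable
function. -/
theorem integral_layer_mul (hw : Measurable w) (hw1 : ∀ x, |w x| = 1) (hg : Measurable g)
    (hb : ∀ x, |g x| ≤ b) (hY : Measurable Y) {ψ : ℝ → ℝ} (hψ : Integrable ψ) :
    ∫ x, layer μ w g Y x * ψ x = ∫ θ, (∫ x, g (x - Y θ) * ψ x) * w θ ∂μ := by
  refine integral_layer_mul_of_integrable
    (Integrable.bdd_mul (c := b) ?_ ?_ (Eventually.of_forall fun p => hb _))
  · refine hψ.mul_prod (f := ψ) (g := w) ?_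
    exact Integrable.of_bound hw.aestronglyMeasurable 1
      (Eventually.of_forall fun x => by rw [Real.norm_eq_abs, hw1])
  · have : Measurable fun p : ℝ × ℝ => g (p.1 - Y p.2) := by fun_prop
    exact this.aestronglyMeasurable

/-- Fubini's theorem for the pairing of the superposition of an integrable kernel with a bounded
function. -/
theorem integral_layer_mul_of_bounded (hw : Measurable w) (hw1 : ∀ x, |w x| = 1)
    (hg : Measurable g) (hgi : Integrable g) (hY : Measurable Y) {ψ : ℝ → ℝ} (hψ : Measurable ψ)
    (hb : ∀ x, |ψ x| ≤ b) :
    ∫ x, layer μ w g Y x * ψ x = ∫ θ, (∫ x, g (x - Y θ) * ψ x) * w θ ∂μ := by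
  have hm : Measurable fun p : ℝ × ℝ => g (p.1 - Y p.2) := by fun_prop
  refine integral_layer_mul_of_integrable (Integrable.mul_bdd (c := b) ?_ ?_
    (Eventually.of_forall fun p => ?_))
  · refine (integrable_prod_iff' hm.aestronglyMeasurable).2
      ⟨Eventually.of_forall fun θ => hgi.comp_sub_right (Y θ), ?_⟩
    have e : ∀ θ, ∫ x, ‖g (x - Y θ)‖ = ∫ x, ‖g x‖ := fun θ =>
      integral_sub_right_eq_self (fun x => ‖g x‖) (Y θ)
    simp only [e]
    exact integrable_const _
  · exact ((hψ.comp measurable_fst).mul (hw.comp measurable_snd)).aestronglyMeasurable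
  · rw [norm_mul, Real.norm_eq_abs (w _), hw1, mul_one]
    exact hb _

theorem eLpNorm_two_sq_le {f : ℝ → ℝ} (hb : ∀ x, |f x| ≤ b) :
    eLpNorm f 2 volume ^ 2 ≤ ENNReal.ofReal b * ∫⁻ x, ‖f x‖ₑ := by
  have h1 : eLpNorm f 2 volume ^ 2 = ∫⁻ x, ‖f x‖ₑ ^ 2 := by
    have := eLpNorm_nnreal_pow_eq_lintegral (f := f) (μ := volume) (p := 2) two_ne_zero
    simpa using this
  rw [h1, ← lintegral_const_mul' _ _ ENNReal.ofReal_ne_top]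
  refine lintegral_mono fun x => ?_
  rw [sq]
  gcongr
  rw [Real.enorm_eq_ofReal_abs]
  exact ENNReal.ofReal_le_ofReal (hb x)

theorem memLp_two_layer (hw : Measurable w) (hw1 : ∀ x, |w x| = 1) (hg : Measurable g)
    (hb : ∀ x, |g x| ≤ b) (hgi : Integrable g) (hY : Measurable Y) :
    MemLp (layer μ w g Y) 2 volume := by
  refine ⟨(measurable_layer_space hw hg hY).aestronglyMeasurable, ?_⟩
  have h := eLpNorm_two_sq_le (f := layer μ w g Y) (abs_layer_le hw1 hb)
  have h2 : eLpNorm (layer μ w g Y) 2 volume ^ 2 < ⊤ :=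
    h.trans_lt (ENNReal.mul_lt_top ENNReal.ofReal_lt_top
      (integrable_layer_space hw hw1 hg hgi hY).2)
  by_contra h3
  rw [not_lt, top_le_iff] at h3
  simp [h3] at h2

theorem hasWeakDeriv_layer (hw : Measurable w) (hw1 : ∀ x, |w x| = 1) (hY : Measurable Y) :
    HasWeakDeriv (layer μ w G Y) (layer μ w dG Y) := by
  refine ⟨(integrable_layer_space hw hw1 continuous_G.measurable integrable_G hY).locallyIntegrable,
    (integrable_layer_space hw hw1 measurable_dG integrable_dG hY).locallyIntegrable,
    fun ψ hψ hψc => ?_⟩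
  have hψ1 : ContDiff ℝ 1 ψ := hψ.of_le (by exact_mod_cast le_top)
  rw [integral_layer_mul hw hw1 continuous_G.measurable abs_G_le hY
      ((hψ1.continuous_deriv le_rfl).integrable_of_hasCompactSupport hψc.deriv),
    integral_layer_mul hw hw1 measurable_dG abs_dG_le hY
      (hψ1.continuous.integrable_of_hasCompactSupport hψc), ← integral_neg]
  refine integral_congr_ae (Eventually.of_forall fun θ => ?_)
  simp only
  rw [integral_G_mul_deriv hψ1 hψc]
  ring

end Estimates

/-! ### Regularity of the limit in space and time -/

section Regularity

variable {μ : Measure ℝ} [IsFiniteMeasure μ] {w g : ℝ → ℝ} {L C : ℝ} {X : ℝ → ℝ → ℝ}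

theorem IsMotion.measurable_label (hX : IsMotion L C X) (t : ℝ) : Measurable fun θ => X θ t :=
  hX.measurable.comp (by fun_prop : Measurable fun θ : ℝ => (θ, t))

/-- A superposition of translates as a function of space and time. -/
def flowLayer (μ : Measure ℝ) (w g : ℝ → ℝ) (X : ℝ → ℝ → ℝ) (x t : ℝ) : ℝ :=
  layer μ w g (fun θ => X θ t) x

theorem IsMotion.lintegral_flowLayer_time_sub_le (hX : IsMotion L C X) (hw : Measurable w)
    (hw1 : ∀ x, |w x| = 1) (hg : Measurable g) {b A : ℝ} (hb : ∀ x, |g x| ≤ b) (hA : 0 ≤ A)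
    (hgA : HasL1Modulus g A) (s t : ℝ) :
    ∫⁻ x, ‖flowLayer μ w g X x t - flowLayer μ w g X x s‖ₑ
      ≤ ENNReal.ofReal (A * (C * |t - s|)) * μ univ :=
  lintegral_layer_sub_le hw hw1 hg hb hA hgA (hX.measurable_label t) (hX.measurable_label s)
    fun θ => hX.abs_sub_le θ s t

theorem IsMotion.lintegral_flowLayer_space_sub_le (hX : IsMotion L C X) (hw : Measurable w)
    (hw1 : ∀ x, |w x| = 1) (hg : Measurable g) {b A : ℝ} (hb : ∀ x, |g x| ≤ b) (hA : 0 ≤ A)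
    (hgA : HasL1Modulus g A) (h t : ℝ) :
    ∫⁻ x, ‖flowLayer μ w g X (x - h) t - flowLayer μ w g X x t‖ₑ
      ≤ ENNReal.ofReal (A * |h|) * μ univ := by
  have e : ∀ x, flowLayer μ w g X (x - h) t = layer μ w g (fun θ => X θ t + h) x := by
    intro x
    simp only [flowLayer, layer, sub_sub, add_comm h]
  simp only [e]
  refine lintegral_layer_sub_le hw hw1 hg hb hA hgA ((hX.measurable_label t).add_const h)
    (hX.measurable_label t) fun θ => ?_
  rw [add_sub_cancel_left]

theorem IsMotion.tendsto_eLpNorm_two (hX : IsMotion L C X) (hw : Measurable w)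
    (hw1 : ∀ x, |w x| = 1) (hg : Measurable g) {b A : ℝ} (hb : ∀ x, |g x| ≤ b) (hA : 0 ≤ A)
    (hgA : HasL1Modulus g A) (s : ℝ) :
    Tendsto (fun t => eLpNorm (fun x => flowLayer μ w g X x t - flowLayer μ w g X x s) 2 volume ^ 2)
      (𝓝 s) (𝓝 0) := by
  have h1 : ∀ t, eLpNorm (fun x => flowLayer μ w g X x t - flowLayer μ w g X x s) 2 volume ^ 2
      ≤ ENNReal.ofReal (b * μ.real univ + b * μ.real univ) *
        (ENNReal.ofReal (A * (C * |t - s|)) * μ univ) := by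
    intro t
    refine (eLpNorm_two_sq_le fun x => (abs_sub _ _).trans
      (add_le_add (abs_layer_le hw1 hb x) (abs_layer_le hw1 hb x))).trans ?_
    gcongr
    exact hX.lintegral_flowLayer_time_sub_le hw hw1 hg hb hA hgA s t
  refine tendsto_of_tendsto_of_tendsto_of_le_of_le tendsto_const_nhds ?_ (fun _ => zero_le) h1
  have h2 : Tendsto (fun t => ENNReal.ofReal (A * (C * |t - s|))) (𝓝 s) (𝓝 0) := by
    have h3 : Tendsto (fun t => A * (C * |t - s|)) (𝓝 s) (𝓝 (A * (C * |s - s|))) :=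
      Continuous.tendsto (by fun_prop) s
    rw [sub_self, abs_zero, mul_zero, mul_zero] at h3
    simpa using ENNReal.tendsto_ofReal h3
  have h4 := ENNReal.Tendsto.const_mul (a := ENNReal.ofReal (b * μ.real univ + b * μ.real univ))
    (ENNReal.Tendsto.mul_const (b := μ univ) h2 (Or.inr (measure_ne_top _ _)))
    (Or.inr ENNReal.ofReal_ne_top)
  simpa using h4

theorem IsMotion.isContinuousH1 (hX : IsMotion L C X) (hw : Measurable w)
    (hw1 : ∀ x, |w x| = 1) : IsContinuousH1 (flowLayer μ w G X) (flowLayer μ w dG X) := by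
  refine ⟨fun t _ => ⟨?_, ?_, ?_⟩, fun s _ => ?_⟩
  · exact memLp_two_layer hw hw1 continuous_G.measurable abs_G_le integrable_G
      (hX.measurable_label t)
  · exact memLp_two_layer hw hw1 measurable_dG abs_dG_le integrable_dG (hX.measurable_label t)
  · exact hasWeakDeriv_layer hw hw1 (hX.measurable_label t)
  · refine Tendsto.mono_left ?_ nhdsWithin_le_nhds
    have h1 := (hX.tendsto_eLpNorm_two (μ := μ) hw hw1 continuous_G.measurable abs_G_le
      (by norm_num) hasL1Modulus_G s).add (hX.tendsto_eLpNorm_two (μ := μ) hw hw1 measurable_dG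
      abs_dG_le (by norm_num) hasL1Modulus_dG s)
    rw [add_zero] at h1
    have h2 := h1.ennrpow_const (1 / 2 : ℝ)
    rwa [ENNReal.zero_rpow_of_pos (by norm_num)] at h2

theorem IsMotion.isBoundedW1Inf (hX : IsMotion L C X) (hw : Measurable w)
    (hw1 : ∀ x, |w x| = 1) : IsBoundedW1Inf (flowLayer μ w G X) (flowLayer μ w dG X) := by
  refine ⟨(measurable_layer hw continuous_G.measurable hX.measurable).aestronglyMeasurable,
    (measurable_layer hw measurable_dG hX.measurable).aestronglyMeasurable,
    Real.toNNReal (1 / 2 * μ.real univ), Eventually.of_forall fun t => ⟨?_, ?_, ?_⟩⟩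
  · exact hasWeakDeriv_layer hw hw1 (hX.measurable_label t)
  · exact eLpNormEssSup_le_of_ae_bound (Eventually.of_forall fun x => abs_layer_le hw1 abs_G_le x)
  · exact eLpNormEssSup_le_of_ae_bound (Eventually.of_forall fun x => abs_layer_le hw1 abs_dG_le x)

/-- At each time, only countably many positions carry mass. -/
theorem IsMotion.ae_measure_slice_eq_zero (hX : IsMotion L C X) (t : ℝ) :
    ∀ᵐ x : ℝ, μ {θ | X θ t = x} = 0 := by
  have hc := Measure.countable_meas_level_set_pos (μ := μ) (hX.measurable_label t)
  filter_upwards [hc.ae_notMem volume] with x hx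
  simpa using hx

/-- For almost every point of space-time, almost no particle is there: at each time, only countably
many positions carry mass. -/
theorem IsMotion.ae_measure_eq_zero (hX : IsMotion L C X) :
    ∀ᵐ p : ℝ × ℝ, μ {θ | X θ p.2 = p.1} = 0 := by
  have hm : MeasurableSet {q : (ℝ × ℝ) × ℝ | X q.2 q.1.2 = q.1.1} := by
    have h1 : Measurable fun q : (ℝ × ℝ) × ℝ => X q.2 q.1.2 :=
      hX.measurable.comp (by fun_prop : Measurable fun q : (ℝ × ℝ) × ℝ => (q.2, q.1.2))
    exact measurableSet_eq_fun h1 (by fun_prop)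
  have hm2 : MeasurableSet {p : ℝ × ℝ | μ {θ | X θ p.2 = p.1} = 0} :=
    (measurable_measure_prodMk_left (ν := μ) hm) (measurableSet_singleton 0)
  have hswap : ∀ᵐ q : ℝ × ℝ, μ {θ | X θ q.1 = q.2} = 0 := by
    refine (Measure.ae_prod_iff_ae_ae (μ := (volume : Measure ℝ)) (ν := (volume : Measure ℝ))
      (p := fun q : ℝ × ℝ => μ {θ | X θ q.1 = q.2} = 0)
      (measurable_swap hm2)).2 (Eventually.of_forall fun t => hX.ae_measure_slice_eq_zero t)
  exact (Measure.measurePreserving_swap (μ := (volume : Measure ℝ))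
    (ν := (volume : Measure ℝ))).quasiMeasurePreserving.ae hswap

end Regularity

/-! ### Convergence of the regularized velocity profiles -/

section Convergence

variable {μ : Measure ℝ} [IsFiniteMeasure μ] {w : ℝ → ℝ} {L C : ℝ} {X : ℝ → ℝ → ℝ}
  {Y : ℕ → ℝ → ℝ → ℝ} {ρ : ℝ → ℝ} {e : ℕ → ℝ}

theorem tendsto_flowLayer_GEps (hw : Measurable w) (hw1 : ∀ x, |w x| = 1)
    (hρ : IsMollifier ρ) (he : ∀ n, 0 < e n) (he0 : Tendsto e atTop (𝓝 0))
    (hY : ∀ n, IsMotion L C (Y n)) (hlim : ∀ θ t, Tendsto (fun n => Y n θ t) atTop (𝓝 (X θ t)))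
    (x t : ℝ) :
    Tendsto (fun n => flowLayer μ w (GEps ρ (e n)) (Y n) x t) atTop
      (𝓝 (flowLayer μ w G X x t)) := by
  refine tendsto_layer hw hw1 (b := 1 / 2) (fun n => (continuous_GEps hρ (he n)).measurable)
    (fun n => abs_GEps_le hρ (he n)) (fun n => ((hY n).measurable_label t).aemeasurable)
    (Eventually.of_forall fun θ => ?_)
  exact hρ.tendsto_convolution he he0 continuous_G.measurable continuous_G.continuousAt
    (tendsto_const_nhds.sub (hlim θ t))

theorem tendsto_flowLayer_dGEps (hw : Measurable w) (hw1 : ∀ x, |w x| = 1)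
    (hρ : IsMollifier ρ) (he : ∀ n, 0 < e n) (he0 : Tendsto e atTop (𝓝 0))
    (hY : ∀ n, IsMotion L C (Y n)) (hlim : ∀ θ t, Tendsto (fun n => Y n θ t) atTop (𝓝 (X θ t)))
    {x t : ℝ} (hx : μ {θ | X θ t = x} = 0) :
    Tendsto (fun n => flowLayer μ w (dGEps ρ (e n)) (Y n) x t) atTop
      (𝓝 (flowLayer μ w dG X x t)) := by
  refine tendsto_layer hw hw1 (b := 1 / 2) (fun n => (continuous_dGEps hρ (he n)).measurable)
    (fun n => abs_dGEps_le hρ (he n)) (fun n => ((hY n).measurable_label t).aemeasurable) ?_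
  have : ∀ᵐ θ ∂μ, ¬X θ t = x := measure_eq_zero_iff_ae_notMem.1 hx
  filter_upwards [this] with θ hθ
  exact hρ.tendsto_convolution he he0 measurable_dG
    (continuousAt_dG (sub_ne_zero.2 (Ne.symm hθ))) (tendsto_const_nhds.sub (hlim θ t))

theorem tendstoL1Loc_of_ae {f F : ℕ → ℝ → ℝ → ℝ} {g : ℝ → ℝ → ℝ} {b : ℝ}
    (hF : ∀ n, Measurable (uncurry (F n))) (hg : Measurable (uncurry g))
    (hfF : ∀ n x t, 0 ≤ t → f n x t = F n x t) (hFb : ∀ n x t, |F n x t| ≤ b)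
    (hlim : ∀ᵐ p : ℝ × ℝ, Tendsto (fun n => F n p.1 p.2) atTop (𝓝 (g p.1 p.2))) :
    TendstoL1Loc f g := by
  intro K hK hK0
  have h1 : ∀ n, eLpNorm (uncurry (f n) - uncurry g) 1 (volume.restrict K)
      = ∫⁻ p in K, ‖uncurry (F n) p - uncurry g p‖ₑ := by
    intro n
    rw [eLpNorm_one_eq_lintegral_enorm]
    refine setLIntegral_congr_fun hK.measurableSet fun p hp => ?_
    simp only [Pi.sub_apply, uncurry, hfF n p.1 p.2 (hK0 hp).2]
  simp only [h1]
  have h2 : ∀ᵐ p ∂(volume.restrict K), ‖uncurry g p‖ ≤ b := by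
    filter_upwards [ae_restrict_of_ae hlim] with p hp
    exact le_of_tendsto hp.norm (Eventually.of_forall fun n => hFb n _ _)
  have h3 := tendsto_lintegral_of_dominated_convergence (μ := volume.restrict K)
    (F := fun n p => ‖uncurry (F n) p - uncurry g p‖ₑ) (f := fun _ => 0)
    (fun _ => ENNReal.ofReal (b + b)) (fun n => ((hF n).sub hg).enorm) (fun n => ?_) ?_ ?_
  · simpa using h3
  · filter_upwards [h2] with p hp
    rw [Real.enorm_eq_ofReal_abs]
    exact ENNReal.ofReal_le_ofReal ((abs_sub _ _).trans (add_le_add (hFb n _ _) hp))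
  · rw [lintegral_const, Measure.restrict_apply_univ]
    exact ENNReal.mul_ne_top ENNReal.ofReal_ne_top hK.measure_lt_top.ne
  · filter_upwards [ae_restrict_of_ae hlim] with p hp
    have : Tendsto (fun n => uncurry (F n) p - uncurry g p) atTop (𝓝 0) := by
      simpa [uncurry] using hp.sub_const (g p.1 p.2)
    simpa using this.enorm

end Convergence

/-! ### Partial derivatives of test functions -/

theorem hasDerivAt_space {f : ℝ → ℝ → ℝ} (hf : Differentiable ℝ (uncurry f)) (x t : ℝ) :
    HasDerivAt (fun y => f y t) (fderiv ℝ (uncurry f) (x, t) (1, 0)) x := by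
  have h1 : HasDerivAt (fun y : ℝ => (y, t)) ((1 : ℝ), (0 : ℝ)) x :=
    (hasDerivAt_id x).prodMk (hasDerivAt_const x t)
  exact (hf (x, t)).hasFDerivAt.comp_hasDerivAt x h1

theorem hasDerivAt_time {f : ℝ → ℝ → ℝ} (hf : Differentiable ℝ (uncurry f)) (x t : ℝ) :
    HasDerivAt (fun s => f x s) (fderiv ℝ (uncurry f) (x, t) (0, 1)) t := by
  have h1 : HasDerivAt (fun s : ℝ => (x, s)) ((0 : ℝ), (1 : ℝ)) t :=
    (hasDerivAt_const t x).prodMk (hasDerivAt_id t)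
  exact (hf (x, t)).hasFDerivAt.comp_hasDerivAt t h1

theorem dx_eq_fderiv {f : ℝ → ℝ → ℝ} (hf : Differentiable ℝ (uncurry f)) (x t : ℝ) :
    dx f x t = fderiv ℝ (uncurry f) (x, t) (1, 0) := (hasDerivAt_space hf x t).deriv

theorem dt_eq_fderiv {f : ℝ → ℝ → ℝ} (hf : Differentiable ℝ (uncurry f)) (x t : ℝ) :
    dt f x t = fderiv ℝ (uncurry f) (x, t) (0, 1) := (hasDerivAt_time hf x t).deriv

theorem hasCompactSupport_fderiv_apply {φ : ℝ × ℝ → ℝ} (hc : HasCompactSupport φ) (v : ℝ × ℝ) :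
    HasCompactSupport fun p => fderiv ℝ φ p v :=
  (hc.fderiv (𝕜 := ℝ)).comp_left (g := fun T : ℝ × ℝ →L[ℝ] ℝ => T v) rfl

theorem tsupport_fderiv_apply_subset' (φ : ℝ × ℝ → ℝ) (v : ℝ × ℝ) :
    tsupport (fun p => fderiv ℝ φ p v) ⊆ tsupport φ :=
  tsupport_fderiv_apply_subset ℝ v

section TestFunction

variable {Ω : Set (ℝ × ℝ)} {φ : ℝ → ℝ → ℝ}

theorem IsTestFunction.differentiable (h : IsTestFunction Ω φ) :
    Differentiable ℝ (uncurry φ) := h.1.differentiable (by simp)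

theorem IsTestFunction.of_fderiv (h : IsTestFunction Ω φ) (v : ℝ × ℝ) {ψ : ℝ → ℝ → ℝ}
    (hψ : uncurry ψ = fun p => fderiv ℝ (uncurry φ) p v) : IsTestFunction Ω ψ := by
  refine ⟨?_, ?_, ?_⟩ <;> rw [hψ]
  · exact (h.1.fderiv_right (m := ∞) (by simp)).clm_apply contDiff_const
  · exact hasCompactSupport_fderiv_apply h.2.1 v
  · exact (tsupport_fderiv_apply_subset' _ v).trans h.2.2

theorem IsTestFunction.dx (h : IsTestFunction Ω φ) : IsTestFunction Ω (dx φ) :=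
  h.of_fderiv (1, 0) (funext fun p => dx_eq_fderiv h.differentiable p.1 p.2)

theorem IsTestFunction.dt (h : IsTestFunction Ω φ) : IsTestFunction Ω (dt φ) :=
  h.of_fderiv (0, 1) (funext fun p => dt_eq_fderiv h.differentiable p.1 p.2)

theorem IsTestFunction.hasDerivAt_dx (h : IsTestFunction Ω φ) (x t : ℝ) :
    HasDerivAt (fun y => φ y t) (MCH.dx φ x t) x :=
  dx_eq_fderiv h.differentiable x t ▸ hasDerivAt_space h.differentiable x t

theorem IsTestFunction.continuous (h : IsTestFunction Ω φ) : Continuous (uncurry φ) :=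
  h.1.continuous

theorem IsTestFunction.exists_abs_le (h : IsTestFunction Ω φ) :
    ∃ b, 0 ≤ b ∧ ∀ x t, |φ x t| ≤ b := by
  obtain ⟨b, hb⟩ := h.continuous.bounded_above_of_compact_support h.2.1
  exact ⟨b, (norm_nonneg _).trans (hb (0, 0)), fun x t => hb (x, t)⟩

/-- The support of a test function lies in a bounded square. -/
theorem IsTestFunction.exists_eq_zero (h : IsTestFunction Ω φ) :
    ∃ R, 0 < R ∧ ∀ x t, (R ≤ |x| ∨ R ≤ |t|) → φ x t = 0 := by
  obtain ⟨R, hR0, hR⟩ := h.2.1.isBounded.exists_pos_norm_lt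
  refine ⟨R, hR0, fun x t hxt => ?_⟩
  by_contra hne
  have h1 : ‖(x, t)‖ < R := hR (x, t) (subset_tsupport _ hne)
  rw [Prod.norm_def, max_lt_iff] at h1
  simp only [Real.norm_eq_abs] at h1
  rcases hxt with h2 | h2 <;> linarith [h1.1, h1.2]

theorem IsTestFunction.contDiff_slice (h : IsTestFunction Ω φ) (t : ℝ) :
    ContDiff ℝ ∞ fun x => φ x t :=
  h.1.comp (contDiff_id.prodMk contDiff_const)

theorem IsTestFunction.hasCompactSupport_slice (h : IsTestFunction Ω φ) (t : ℝ) :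
    HasCompactSupport fun x => φ x t := by
  obtain ⟨R, hR0, hR⟩ := h.exists_eq_zero
  refine HasCompactSupport.intro (isCompact_closedBall (0 : ℝ) R) fun x hx => hR x t (Or.inl ?_)
  simpa using (not_le.1 (by simpa using hx)).le

end TestFunction

/-! ### Functions of bounded variation -/

/-- If the difference quotients of `f` in the direction `v` are bounded by `B` in `L¹(Ω)`, then so is
the distributional derivative of `f`. -/
theorem abs_integral_mul_fderiv_le {f φ : ℝ × ℝ → ℝ} {b B : ℝ} {Ω : Set (ℝ × ℝ)}
    (hf : Measurable f) (hb : ∀ p, |f p| ≤ b) (hφ : ContDiff ℝ 1 φ) (hc : HasCompactSupport φ)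
    (hΩ : tsupport φ ⊆ Ω) (hφ1 : ∀ p, |φ p| ≤ 1) (v : ℝ × ℝ) (hB : 0 ≤ B)
    (hdq : ∀ h, 0 < h → ∫⁻ p in Ω, ‖f (p - h • v) - f p‖ₑ ≤ ENNReal.ofReal (B * h)) :
    |∫ p, f p * fderiv ℝ φ p v| ≤ B := by
  have hb0 : 0 ≤ b := (abs_nonneg _).trans (hb 0)
  obtain ⟨K, hK⟩ := hφ.lipschitzWith_of_hasCompactSupport hc one_ne_zero
  have hφi : Integrable φ := hφ.continuous.integrable_of_hasCompactSupport hc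
  set h : ℕ → ℝ := fun n => 1 / ((n : ℝ) + 1) with hh
  have hpos : ∀ n, 0 < h n := fun n => by rw [hh]; positivity
  have hle : ∀ n, h n ≤ 1 := fun n => by
    rw [hh]
    simp only
    rw [div_le_one (by positivity)]
    linarith [(Nat.cast_nonneg n : (0 : ℝ) ≤ n)]
  have hh0 : Tendsto h atTop (𝓝 0) := tendsto_one_div_add_atTop_nhds_zero_nat
  have hfv : ∀ n, Integrable fun p => f p * φ (p + h n • v) := fun n =>
    (hφi.comp_add_right (h n • v)).bdd_mul (c := b) hf.aestronglyMeasurable (Eventually.of_forall hb)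
  have hfi : Integrable fun p => f p * φ p :=
    hφi.bdd_mul (c := b) hf.aestronglyMeasurable (Eventually.of_forall hb)
  have hfv' : ∀ n, Integrable fun p => f (p - h n • v) * φ p := fun n =>
    hφi.bdd_mul (c := b) (hf.comp (measurable_id.sub_const _)).aestronglyMeasurable
      (Eventually.of_forall fun _ => hb _)
  -- the difference quotients of `φ` converge, with a common compact support
  have hlim : Tendsto (fun n => ∫ p, f p * ((h n)⁻¹ * (φ (p + h n • v) - φ p))) atTop
      (𝓝 (∫ p, f p * fderiv ℝ φ p v)) := by
    set S := Metric.cthickening ‖v‖ (tsupport φ) with hS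
    have hSc : IsCompact S := hc.isCompact.cthickening
    refine tendsto_integral_of_dominated_convergence (S.indicator fun _ => b * (K * ‖v‖))
      (fun n => ?_) ?_ (fun n => Eventually.of_forall fun p => ?_)
      (Eventually.of_forall fun p => ?_)
    · have : Measurable fun p => φ (p + h n • v) - φ p := by
        have := hφ.continuous.measurable
        fun_prop
      exact (hf.mul (this.const_mul _)).aestronglyMeasurable
    · rw [integrable_indicator_iff hSc.measurableSet]
      exact integrableOn_const hSc.measure_lt_top.ne
    · by_cases hp : p ∈ S
      · rw [indicator_of_mem hp, norm_mul]
        refine mul_le_mul (hb p) ?_ (norm_nonneg _) hb0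
        have h1 := hK.dist_le_mul (p + h n • v) p
        rw [dist_eq_norm, dist_eq_norm, add_sub_cancel_left, norm_smul,
          Real.norm_of_nonneg (hpos n).le] at h1
        rw [norm_mul, norm_inv, Real.norm_of_nonneg (hpos n).le, inv_mul_le_iff₀ (hpos n)]
        calc _ ≤ _ := h1
          _ = _ := by ring
      · have h1 : φ p = 0 := by
          by_contra hne
          exact hp (Metric.self_subset_cthickening _ (subset_tsupport _ hne))
        have h2 : φ (p + h n • v) = 0 := by
          by_contra hne
          refine hp (Metric.mem_cthickening_of_dist_le p (p + h n • v) _ _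
            (subset_tsupport _ hne) ?_)
          rw [dist_eq_norm, sub_add_cancel_left, norm_neg, norm_smul,
            Real.norm_of_nonneg (hpos n).le]
          exact mul_le_of_le_one_left (norm_nonneg _) (hle n)
        rw [indicator_of_notMem hp, h1, h2]
        simp
    · have h1 := (((hφ.differentiable one_ne_zero) p).hasFDerivAt).hasLineDerivAt v
      have h2 := (hasDerivAt_iff_tendsto_slope_zero.1 h1).comp
        (tendsto_nhdsWithin_iff.2 ⟨hh0, Eventually.of_forall fun n => (hpos n).ne'⟩)
      refine (h2.const_mul (f p)).congr fun n => ?_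
      simp
  refine le_of_tendsto hlim.abs (Eventually.of_forall fun n => ?_)
  have h1 : ∫ p, f p * ((h n)⁻¹ * (φ (p + h n • v) - φ p))
      = (h n)⁻¹ * ∫ p, (f (p - h n • v) - f p) * φ p := by
    have e1 : ∀ p, f p * ((h n)⁻¹ * (φ (p + h n • v) - φ p))
        = (h n)⁻¹ * (f p * φ (p + h n • v) - f p * φ p) := fun p => by ring
    simp only [e1, integral_const_mul, sub_mul]
    rw [integral_sub (hfv n) hfi, integral_sub (hfv' n) hfi]
    congr 2
    rw [← integral_sub_right_eq_self (fun p => f p * φ (p + h n • v)) (h n • v)]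
    simp
  have h2 : ∫ p, (f (p - h n • v) - f p) * φ p = ∫ p in Ω, (f (p - h n • v) - f p) * φ p := by
    refine (setIntegral_eq_integral_of_forall_compl_eq_zero fun p hp => ?_).symm
    have : φ p = 0 := by
      by_contra hne
      exact hp (hΩ (subset_tsupport _ hne))
    rw [this, mul_zero]
  have h3 : ‖∫ p in Ω, (f (p - h n • v) - f p) * φ p‖ₑ ≤ ENNReal.ofReal (B * h n) := by
    refine (enorm_integral_le_lintegral_enorm _).trans ((lintegral_mono fun p => ?_).trans
      (hdq (h n) (hpos n)))
    rw [enorm_mul]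
    refine mul_le_of_le_one_right zero_le ?_
    rw [Real.enorm_eq_ofReal_abs]
    exact ENNReal.ofReal_le_one.2 (hφ1 p)
  rw [Real.enorm_eq_ofReal_abs, ENNReal.ofReal_le_ofReal_iff (mul_nonneg hB (hpos n).le)] at h3
  rw [h1, h2, abs_mul, abs_inv, abs_of_pos (hpos n), inv_mul_le_iff₀ (hpos n), mul_comm (h n)]
  exact h3

theorem IsTestField.abs_le {Ω : Set (ℝ × ℝ)} {φ₁ φ₂ : ℝ → ℝ → ℝ} (h : IsTestField Ω φ₁ φ₂) :
    (∀ x t, |φ₁ x t| ≤ 1) ∧ ∀ x t, |φ₂ x t| ≤ 1 :=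
  ⟨fun x t => (Real.abs_le_sqrt (by nlinarith [sq_nonneg (φ₂ x t)])).trans (h.2.2 x t),
    fun x t => (Real.abs_le_sqrt (by nlinarith [sq_nonneg (φ₁ x t)])).trans (h.2.2 x t)⟩

theorem totVar_lt_top {f : ℝ → ℝ → ℝ} {b B₁ B₂ : ℝ} {Ω : Set (ℝ × ℝ)}
    (hf : Measurable (uncurry f)) (hb : ∀ x t, |f x t| ≤ b) (hB₁ : 0 ≤ B₁) (hB₂ : 0 ≤ B₂)
    (h₁ : ∀ h, 0 < h → ∫⁻ p in Ω, ‖f (p.1 - h) p.2 - f p.1 p.2‖ₑ ≤ ENNReal.ofReal (B₁ * h))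
    (h₂ : ∀ h, 0 < h → ∫⁻ p in Ω, ‖f p.1 (p.2 - h) - f p.1 p.2‖ₑ ≤ ENNReal.ofReal (B₂ * h)) :
    totVar f Ω < ⊤ := by
  refine lt_of_le_of_lt ?_ (ENNReal.ofReal_lt_top (r := B₁ + B₂))
  refine iSup_le fun φ₁ => iSup_le fun φ₂ => iSup_le fun hφ => ENNReal.ofReal_le_ofReal ?_
  obtain ⟨⟨hd₁, hc₁, hs₁⟩, ⟨hd₂, hc₂, hs₂⟩, -⟩ := id hφ
  have hi : ∀ {φ : ℝ × ℝ → ℝ}, ContDiff ℝ 1 φ → HasCompactSupport φ → ∀ v,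
      Integrable fun p => uncurry f p * fderiv ℝ φ p v := by
    intro φ hd hc v
    refine Integrable.bdd_mul (c := b) ?_ hf.aestronglyMeasurable
      (Eventually.of_forall fun p => hb p.1 p.2)
    exact ((hd.continuous_fderiv one_ne_zero).clm_apply
      continuous_const).integrable_of_hasCompactSupport (hasCompactSupport_fderiv_apply hc v)
  have e1 : ∫ p in Ω, f p.1 p.2 * (dx φ₁ p.1 p.2 + dt φ₂ p.1 p.2)
      = (∫ p, uncurry f p * fderiv ℝ (uncurry φ₁) p (1, 0))
        + ∫ p, uncurry f p * fderiv ℝ (uncurry φ₂) p (0, 1) := by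
    rw [← integral_add (hi hd₁ hc₁ _) (hi hd₂ hc₂ _)]
    rw [setIntegral_eq_integral_of_forall_compl_eq_zero]
    · refine integral_congr_ae (Eventually.of_forall fun p => ?_)
      simp only
      rw [dx_eq_fderiv (hd₁.differentiable one_ne_zero),
        dt_eq_fderiv (hd₂.differentiable one_ne_zero)]
      simp only [uncurry]
      ring
    · intro p hp
      have z : ∀ {φ : ℝ × ℝ → ℝ}, tsupport φ ⊆ Ω → ∀ v, fderiv ℝ φ p v = 0 := by
        intro φ hs v
        by_contra hne
        exact hp (hs (tsupport_fderiv_apply_subset' φ v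
          (subset_tsupport (fun p => fderiv ℝ φ p v) hne)))
      rw [dx_eq_fderiv (hd₁.differentiable one_ne_zero),
        dt_eq_fderiv (hd₂.differentiable one_ne_zero), z hs₁, z hs₂]
      ring
  have a1 := abs_integral_mul_fderiv_le (f := uncurry f) (B := B₁) hf (fun p => hb p.1 p.2) hd₁
    hc₁ hs₁ (fun p => hφ.abs_le.1 p.1 p.2) (1, 0) hB₁ fun h hh => by
      simpa [uncurry] using h₁ h hh
  have a2 := abs_integral_mul_fderiv_le (f := uncurry f) (B := B₂) hf (fun p => hb p.1 p.2) hd₂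
    hc₂ hs₂ (fun p => hφ.abs_le.2 p.1 p.2) (0, 1) hB₂ fun h hh => by
      simpa [uncurry] using h₂ h hh
  rw [e1]
  exact add_le_add ((le_abs_self _).trans a1) ((le_abs_self _).trans a2)

theorem setLIntegral_strip_le {f : ℝ × ℝ → ℝ≥0∞} (hf : Measurable f) {I : Set ℝ}
    {c : ℝ≥0∞} (h : ∀ t, ∫⁻ x, f (x, t) ≤ c) :
    ∫⁻ p in univ ×ˢ I, f p ≤ c * volume I := by
  rw [Measure.volume_eq_prod, ← Measure.prod_restrict, Measure.restrict_univ,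
    lintegral_prod_symm _ hf.aemeasurable]
  refine (lintegral_mono h).trans ?_
  rw [lintegral_const, Measure.restrict_apply_univ]

section

variable {μ : Measure ℝ} [IsFiniteMeasure μ] {w g : ℝ → ℝ} {L C : ℝ} {X : ℝ → ℝ → ℝ}

theorem IsMotion.measurable_flowLayer (hX : IsMotion L C X) (hw : Measurable w)
    (hg : Measurable g) : Measurable (uncurry (flowLayer μ w g X)) :=
  measurable_layer hw hg hX.measurable

theorem IsMotion.integrableOn_flowLayer (hX : IsMotion L C X) (hw : Measurable w)
    (hw1 : ∀ x, |w x| = 1) (hg : Measurable g) (hgi : Integrable g) {I : Set ℝ}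
    (hIf : volume I ≠ ⊤) :
    IntegrableOn (uncurry (flowLayer μ w g X)) (univ ×ˢ I) := by
  refine ⟨(hX.measurable_flowLayer hw hg).aestronglyMeasurable, ?_⟩
  refine (setLIntegral_strip_le (hX.measurable_flowLayer hw hg).enorm fun t =>
    lintegral_layer_le hw1 hg (hX.measurable_label t)).trans_lt ?_
  exact ENNReal.mul_lt_top (ENNReal.mul_lt_top hgi.2 (measure_lt_top _ _)) hIf.lt_top

theorem IsMotion.isBV_flowLayer (hX : IsMotion L C X) (hC : 0 ≤ C) (hw : Measurable w)
    (hw1 : ∀ x, |w x| = 1) (hg : Measurable g) (hgi : Integrable g) {b A : ℝ}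
    (hb : ∀ x, |g x| ≤ b) (hA : 0 ≤ A) (hgA : HasL1Modulus g A) (T : ℝ) :
    IsBV (flowLayer μ w g X) (univ ×ˢ Ioo 0 T) := by
  refine ⟨hX.integrableOn_flowLayer hw hw1 hg hgi (by simp), ?_⟩
  set M := μ.real univ with hM
  set τ := (volume (Ioo 0 T)).toReal with hτ
  have hM0 : 0 ≤ M := measureReal_nonneg
  have hτ0 : 0 ≤ τ := ENNReal.toReal_nonneg
  have hMe : μ univ = ENNReal.ofReal M := by simp [hM, measureReal_def]
  have hτe : volume (Ioo 0 T) = ENNReal.ofReal τ := by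
    rw [hτ, ENNReal.ofReal_toReal (by simp)]
  have hm := hX.measurable_flowLayer (μ := μ) hw hg
  refine totVar_lt_top (b := b * M) (B₁ := A * M * τ) (B₂ := A * C * M * τ) hm
    (fun x t => abs_layer_le hw1 hb x) (by positivity) (by positivity) (fun h hh => ?_)
    fun h hh => ?_
  · refine (setLIntegral_strip_le (f := fun p => ‖flowLayer μ w g X (p.1 - h) p.2 -
      flowLayer μ w g X p.1 p.2‖ₑ) ?_
      fun t => hX.lintegral_flowLayer_space_sub_le hw hw1 hg hb hA hgA h t).trans (le_of_eq ?_)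
    · exact ((hm.comp (by fun_prop : Measurable fun p : ℝ × ℝ => (p.1 - h, p.2))).sub hm).enorm
    · rw [hMe, hτe, abs_of_pos hh, ← ENNReal.ofReal_mul (by positivity),
        ← ENNReal.ofReal_mul (by positivity)]
      congr 1; ring
  · refine (setLIntegral_strip_le (f := fun p => ‖flowLayer μ w g X p.1 (p.2 - h) -
      flowLayer μ w g X p.1 p.2‖ₑ) (c := ENNReal.ofReal (A * (C * h)) * μ univ) ?_
      fun t => (hX.lintegral_flowLayer_time_sub_le hw hw1 hg hb hA hgA t (t - h)).trans_eq ?_).trans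
        (le_of_eq ?_)
    · exact ((hm.comp (by fun_prop : Measurable fun p : ℝ × ℝ => (p.1, p.2 - h))).sub hm).enorm
    · rw [sub_sub_cancel_left, abs_neg, abs_of_pos hh]
    · rw [hMe, hτe,
        ← ENNReal.ofReal_mul (by positivity), ← ENNReal.ofReal_mul (by positivity)]
      congr 1; ring

end

/-! ### The weak formulation -/

section Slices

variable {Ω : Set (ℝ × ℝ)} {F ψ : ℝ → ℝ → ℝ} {b : ℝ}

theorem IsTestFunction.integrable_slice (hψ : IsTestFunction Ω ψ) (t : ℝ) :
    Integrable fun x => ψ x t :=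
  (hψ.contDiff_slice t).continuous.integrable_of_hasCompactSupport (hψ.hasCompactSupport_slice t)

theorem integrable_mul_slice (hF : Measurable (uncurry F)) (hb : ∀ x t, |F x t| ≤ b)
    (hψ : IsTestFunction Ω ψ) (t : ℝ) : Integrable fun x => F x t * ψ x t :=
  (hψ.integrable_slice t).bdd_mul (c := b)
    (hF.comp (by fun_prop : Measurable fun x : ℝ => (x, t))).aestronglyMeasurable
    (Eventually.of_forall fun x => hb x t)

theorem integrable_integral_mul (hF : Measurable (uncurry F)) (hb : ∀ x t, |F x t| ≤ b)
    (hψ : IsTestFunction Ω ψ) : Integrable fun t => ∫ x, F x t * ψ x t := by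
  have h1 : Integrable (fun p : ℝ × ℝ => uncurry F p * uncurry ψ p)
      ((volume : Measure ℝ).prod volume) :=
    (hψ.continuous.integrable_of_hasCompactSupport hψ.2.1).bdd_mul (c := b)
      hF.aestronglyMeasurable (Eventually.of_forall fun p => hb p.1 p.2)
  exact h1.integral_prod_right

end Slices

/-- The conservative form of `(u² - u_x²) m φ_x`, after integration by parts, for `m = u - u_xx`. -/
theorem integral_flux_eq {u v m a a' a'' : ℝ → ℝ} (hu : ∀ x, HasDerivAt u (v x) x)
    (hv : ∀ x, HasDerivAt v (u x - m x) x) (hm : Continuous m) (ha : ∀ x, HasDerivAt a (a' x) x)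
    (ha' : ∀ x, HasDerivAt a' (a'' x) x) (hac : HasCompactSupport a) (ha'c : HasCompactSupport a')
    (hac'' : Continuous a'') (ha''c : HasCompactSupport a'') :
    ∫ x, (u x ^ 2 - v x ^ 2) * m x * a x = ∫ x, ((u x ^ 3 + u x * v x ^ 2) * a x
      - 1 / 3 * (v x ^ 3 * a' x) - 1 / 3 * (u x ^ 3 * a'' x)) := by
  have huc : Continuous u := continuous_iff_continuousAt.2 fun x => (hu x).continuousAt
  have hvc : Continuous v := continuous_iff_continuousAt.2 fun x => (hv x).continuousAt
  have hacc : Continuous a := continuous_iff_continuousAt.2 fun x => (ha x).continuousAt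
  have ha'cc : Continuous a' := continuous_iff_continuousAt.2 fun x => (ha' x).continuousAt
  have i0 : ∀ {f g : ℝ → ℝ}, Continuous f → Continuous g → HasCompactSupport g →
      Integrable fun x => f x * g x := fun hf hg hc =>
    (hf.mul hg).integrable_of_hasCompactSupport hc.mul_left
  have i1 := i0 (f := fun x => (u x ^ 2 - v x ^ 2) * m x) (by fun_prop) hacc hac
  have i2 : Integrable fun x => (u x ^ 3 + u x * v x ^ 2) * a x
      - 1 / 3 * (v x ^ 3 * a' x) - 1 / 3 * (u x ^ 3 * a'' x) :=
    ((i0 (f := fun x => u x ^ 3 + u x * v x ^ 2) (by fun_prop) hacc hac).sub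
      ((i0 (f := fun x => v x ^ 3) (by fun_prop) ha'cc ha'c).const_mul _)).sub
      ((i0 (f := fun x => u x ^ 3) (by fun_prop) hac'' ha''c).const_mul _)
  have iF : Integrable fun x => (1 / 3 * v x ^ 3 - u x ^ 2 * v x) * a x
      + (1 / 3 * u x ^ 3) * a' x :=
    (i0 (f := fun x => 1 / 3 * v x ^ 3 - u x ^ 2 * v x) (by fun_prop) hacc hac).add
      (i0 (f := fun x => 1 / 3 * u x ^ 3) (by fun_prop) ha'cc ha'c)
  have hd : ∀ x, HasDerivAt (fun x => (1 / 3 * v x ^ 3 - u x ^ 2 * v x) * a x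
      + (1 / 3 * u x ^ 3) * a' x)
      ((u x ^ 2 - v x ^ 2) * m x * a x - ((u x ^ 3 + u x * v x ^ 2) * a x
        - 1 / 3 * (v x ^ 3 * a' x) - 1 / 3 * (u x ^ 3 * a'' x))) x := by
    intro x
    have h := ((((hv x).pow 3).const_mul (1 / 3 : ℝ)).sub (((hu x).pow 2).mul (hv x))).mul (ha x)
    have h' := (((hu x).pow 3).const_mul (1 / 3 : ℝ)).mul (ha' x)
    refine (h.add h').congr_deriv ?_
    simp only [Pi.sub_apply, Pi.mul_apply, Pi.pow_apply]
    push_cast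
    ring
  have h0 := integral_eq_zero_of_hasDerivAt_of_integrable hd (i1.sub i2) iF
  rw [integral_sub i1 i2] at h0
  linarith

section WeakForm

variable {m₀ : SignedMeasure ℝ} {L : ℝ} {μ : Measure ℝ} [IsFiniteMeasure μ] {w : ℝ → ℝ}
  {ρ : ℝ → ℝ} {ε C : ℝ} {Y : ℝ → ℝ → ℝ}

theorem IsMollifier.convolution_eq_integral_mul (hρ : IsMollifier ρ) (ψ : ℝ → ℝ) (y : ℝ) :
    (rhoEps ρ ε ⋆ ψ) y = ∫ x, rhoEps ρ ε (x - y) * ψ x := by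
  rw [convolution_real, ← integral_sub_left_eq_self _ volume y]
  refine integral_congr_ae (Eventually.of_forall fun x => ?_)
  simp only
  rw [sub_sub_cancel, ← hρ.rhoEps_neg (x - y), neg_sub]

/-- The commutator of mollification and multiplication by a Lipschitz function is `O(ε)`. -/
theorem IsMollifier.abs_convolution_mul_sub_le (hρ : IsMollifier ρ) (hε : 0 < ε)
    {U a : ℝ → ℝ} {B b K : ℝ} (hUm : Measurable U) (hU : ∀ x, |U x| ≤ B) (ham : Measurable a)
    (hab : ∀ x, |a x| ≤ b) (hK : ∀ x y, |a x - a y| ≤ K * |x - y|) (hK0 : 0 ≤ K) (y : ℝ) :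
    |(rhoEps ρ ε ⋆ U) y * a y - (rhoEps ρ ε ⋆ fun x => U x * a x) y| ≤ B * (K * ε) := by
  have hB : 0 ≤ B := (abs_nonneg _).trans (hU 0)
  have hUa : ∀ x, |U x * a x| ≤ B * b := fun x => by
    rw [abs_mul]; exact mul_le_mul (hU x) (hab x) (abs_nonneg _) hB
  rw [convolution_real, convolution_real, ← integral_mul_const, ← integral_sub
    ((hρ.integrable_rhoEps_mul hε hUm hU y).mul_const _)
    (hρ.integrable_rhoEps_mul hε (g := fun x => U x * a x) (hUm.mul ham) hUa y)]
  have h := norm_integral_le_of_norm_le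
    (f := fun z => rhoEps ρ ε z * U (y - z) * a y - rhoEps ρ ε z * (U (y - z) * a (y - z)))
    (g := fun z => rhoEps ρ ε z * (B * (K * ε))) (μ := volume)
    ((hρ.integrable_rhoEps hε).mul_const _)
    (Eventually.of_forall fun z => by
      have e : rhoEps ρ ε z * U (y - z) * a y - rhoEps ρ ε z * (U (y - z) * a (y - z))
          = rhoEps ρ ε z * (U (y - z) * (a y - a (y - z))) := by ring
      rw [e, norm_mul, Real.norm_of_nonneg (hρ.rhoEps_nonneg hε z)]
      rcases le_or_gt ε |z| with hz | hz
      · rw [hρ.rhoEps_eq_zero hε hz, zero_mul, zero_mul]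
      · refine mul_le_mul_of_nonneg_left ?_ (hρ.rhoEps_nonneg hε z)
        rw [norm_mul]
        refine mul_le_mul (hU _) ((hK _ _).trans ?_) (norm_nonneg _) hB
        rw [sub_sub_cancel]
        gcongr)
  rwa [integral_mul_const, hρ.integral_rhoEps hε, one_mul] at h

theorem IsPolar.measurable_preVelocity (hp : IsPolar m₀ L μ w) (hρ : IsMollifier ρ)
    (hε : 0 < ε) (hY : IsMotion L C Y) :
    Measurable (uncurry fun x t => preVelocity ρ L m₀ ε (fun θ => Y θ t) x) := by
  have e : (uncurry fun x t => preVelocity ρ L m₀ ε (fun θ => Y θ t) x)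
      = fun p => uncurry (flowLayer μ w (GEps ρ ε) Y) p ^ 2
        - uncurry (flowLayer μ w (dGEps ρ ε) Y) p ^ 2 :=
    funext fun p => hp.preVelocity_eq hρ hε _ _
  rw [e]
  exact ((hY.measurable_flowLayer hp.measurable (continuous_GEps hρ hε).measurable).pow_const 2).sub
    ((hY.measurable_flowLayer hp.measurable (continuous_dGEps hρ hε).measurable).pow_const 2)

theorem measurable_uncurry_comp {α : Type*} [MeasurableSpace α] {V : ℝ → ℝ → ℝ}
    (hV : Measurable (uncurry V)) {f g : α → ℝ} (hf : Measurable f) (hg : Measurable g) :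
    Measurable fun a => V (f a) (g a) := hV.comp (hf.prodMk hg)

theorem measurable_convolution_slice {k : ℝ → ℝ} {U : ℝ → ℝ → ℝ} (hk : Measurable k)
    (hU : Measurable (uncurry U)) : Measurable (uncurry fun x t => (k ⋆ fun y => U y t) x) := by
  have h2 : Measurable fun q : (ℝ × ℝ) × ℝ => k q.2 * U (q.1.1 - q.2) q.1.2 :=
    (hk.comp measurable_snd).mul (measurable_uncurry_comp hU (by fun_prop) (by fun_prop))
  exact (h2.stronglyMeasurable.integral_prod_right' (ν := volume)).measurable

theorem IsPolar.measurable_velocity (hp : IsPolar m₀ L μ w) (hρ : IsMollifier ρ)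
    (hε : 0 < ε) (hY : IsMotion L C Y) :
    Measurable (uncurry fun x t => velocity ρ L m₀ ε (fun θ => Y θ t) x) :=
  measurable_convolution_slice hρ.continuous_rhoEps.measurable (hp.measurable_preVelocity hρ hε hY)

/-- The time derivative of `φ` along the particle `θ` of the regularized flow. -/
def transport (ρ : ℝ → ℝ) (L : ℝ) (m₀ : SignedMeasure ℝ) (ε : ℝ) (Y φ : ℝ → ℝ → ℝ) (t θ : ℝ) : ℝ :=
  dt φ (Y θ t) t + velocity ρ L m₀ ε (fun η => Y η t) (Y θ t) * dx φ (Y θ t) t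

variable {Ω : Set (ℝ × ℝ)} {φ : ℝ → ℝ → ℝ}

theorem IsPolar.measurable_transport (hp : IsPolar m₀ L μ w) (hρ : IsMollifier ρ)
    (hε : 0 < ε) (hY : IsMotion L C Y) (hφ : IsTestFunction Ω φ) :
    Measurable (uncurry (transport ρ L m₀ ε Y φ)) := by
  have h1 : Measurable fun p : ℝ × ℝ => (Y p.2 p.1, p.1) :=
    (hY.measurable.comp measurable_swap).prodMk measurable_fst
  exact (hφ.dt.continuous.measurable.comp h1).add
    (((hp.measurable_velocity hρ hε hY).comp h1).mul (hφ.dx.continuous.measurable.comp h1))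

theorem IsPolar.exists_abs_transport_le (hp : IsPolar m₀ L μ w) (hρ : IsMollifier ρ)
    (hφ : IsTestFunction Ω φ) : ∃ b, 0 ≤ b ∧ ∀ ε, 0 < ε → ∀ Y t θ,
      |transport ρ L m₀ ε Y φ t θ| ≤ b := by
  obtain ⟨b₁, h₁, hb₁⟩ := hφ.dt.exists_abs_le
  obtain ⟨b₂, h₂, hb₂⟩ := hφ.dx.exists_abs_le
  refine ⟨b₁ + (1 / 2 * μ.real univ) ^ 2 * b₂, by positivity, fun ε hε Y t θ => ?_⟩
  refine (abs_add_le _ _).trans (add_le_add (hb₁ _ _) ?_)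
  rw [abs_mul]
  exact mul_le_mul (hp.abs_velocity_le hρ hε _ _) (hb₂ _ _) (abs_nonneg _) (by positivity)

/-- The transport equation for the measures carried by the regularized flow, in weak form. -/
theorem IsRegularizedFlow.integral_transport (hp : IsPolar m₀ L μ w) (hρ : IsMollifier ρ)
    (hε : 0 < ε) (hL : -L ≤ L) {X : ℝ → ℝ → ℝ} (hX : IsRegularizedFlow ρ L m₀ ε X)
    (hφ : IsTestFunction Ω φ) {R : ℝ} (hR : 0 < R) (hR0 : ∀ x t, (R ≤ |x| ∨ R ≤ |t|) → φ x t = 0) :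
    ∫ t in Ioc 0 R, ∫ θ, transport ρ L m₀ ε (extendFlow L X) φ t θ * w θ ∂μ
      = -∫ θ, φ θ 0 * w θ ∂μ := by
  have hY := hX.isMotion hp hρ hε hL
  set Y := extendFlow L X with hYdef
  obtain ⟨b, hb0, hb⟩ := hp.exists_abs_transport_le hρ hφ
  have hm := hp.measurable_transport hρ hε hY hφ
  have hi : Integrable (uncurry fun t θ => transport ρ L m₀ ε Y φ t θ * w θ)
      ((volume.restrict (Ioc 0 R)).prod μ) := by
    refine Integrable.of_bound (hm.mul (hp.measurable.comp
      measurable_snd)).aestronglyMeasurable b (Eventually.of_forall fun q => ?_)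
    rw [uncurry, Real.norm_eq_abs, abs_mul, hp.abs_eq_one, mul_one]
    exact hb ε hε Y q.1 q.2
  rw [integral_integral_swap hi, ← integral_neg]
  refine integral_congr_ae ?_
  filter_upwards [hp.mem_Icc] with θ hθ
  rw [integral_mul_const, ← intervalIntegral.integral_of_le hR.le]
  have hint : IntervalIntegrable (fun t => transport ρ L m₀ ε Y φ t θ) volume 0 R := by
    rw [intervalIntegrable_iff_integrableOn_Ioc_of_le hR.le]
    refine Integrable.of_bound (hm.comp
      (by fun_prop : Measurable fun t : ℝ => (t, θ))).aestronglyMeasurable b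
      (Eventually.of_forall fun t => hb ε hε Y t θ)
  have hYc : Continuous fun t => Y θ t :=
    (hX.continuous_extendFlow hL).comp (by fun_prop : Continuous fun t : ℝ => (θ, t))
  have hcont : Continuous fun t => φ (Y θ t) t := hφ.continuous.comp (hYc.prodMk continuous_id)
  have hftc := intervalIntegral.integral_eq_sub_of_hasDerivAt_of_le hR.le hcont.continuousOn
    (f' := fun t => transport ρ L m₀ ε Y φ t θ) (fun t ht => ?_) hint
  · rw [hftc, hR0 _ R (Or.inr (le_abs_self R)), hY.initial, clamp_of_mem hθ]
    ring
  · have h1 := (hX.hasDerivWithinAt_extendFlow hp hρ hε hL θ ht.1.le).hasDerivAt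
      (Ici_mem_nhds ht.1)
    have h2 := HasFDerivAt.comp_hasDerivAt (f := fun s => (Y θ s, s)) t
      (hφ.differentiable (Y θ t, t)).hasFDerivAt (h1.prodMk (hasDerivAt_id' t))
    refine h2.congr_deriv ?_
    rw [transport, dt_eq_fderiv hφ.differentiable, dx_eq_fderiv hφ.differentiable]
    set V := velocity ρ L m₀ ε (fun θ => Y θ t) (Y θ t)
    have e : ((V, 1) : ℝ × ℝ) = (0, 1) + V • (1, 0) := by simp
    rw [e, map_add, map_smul, smul_eq_mul]

/-- The local flux density of the weak formulation. -/
def fluxDensity (u v φ : ℝ → ℝ → ℝ) (x t : ℝ) : ℝ :=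
  (u x t ^ 3 + u x t * v x t ^ 2) * dx φ x t - 1 / 3 * (v x t ^ 3 * dx (dx φ) x t)
    - 1 / 3 * (u x t ^ 3 * dx (dx (dx φ)) x t)

theorem IsTestFunction.exists_lipschitz_space (hφ : IsTestFunction Ω φ) :
    ∃ K, 0 ≤ K ∧ ∀ t x y, |φ x t - φ y t| ≤ K * |x - y| := by
  obtain ⟨K, hK0, hK⟩ := hφ.dx.exists_abs_le
  exact ⟨K, hK0, fun t x y => convex_univ.norm_image_sub_le_of_norm_hasDerivWithin_le
    (f := fun x => φ x t) (fun x _ => (hφ.hasDerivAt_dx x t).hasDerivWithinAt)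
    (fun x _ => hK x t) (mem_univ y) (mem_univ x)⟩

/-- Up to an error of order `ε`, the transport term is the flux of the weak formulation. -/
theorem IsPolar.exists_abs_flux_sub_le (hp : IsPolar m₀ L μ w) (hρ : IsMollifier ρ)
    (hφ : IsTestFunction Ω φ) : ∃ K, ∀ ε, 0 < ε → ∀ Y, IsMotion L C Y → ∀ t,
      |(∫ θ, velocity ρ L m₀ ε (fun η => Y η t) (Y θ t) * dx φ (Y θ t) t * w θ ∂μ)
        - ∫ x, fluxDensity (flowLayer μ w (GEps ρ ε) Y) (flowLayer μ w (dGEps ρ ε) Y) φ x t|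
        ≤ K * ε := by
  obtain ⟨K, hK0, hK⟩ := hφ.dx.exists_lipschitz_space
  obtain ⟨b, hb0, hb⟩ := hφ.dx.exists_abs_le
  set B := (1 / 2 * μ.real univ) ^ 2 with hB
  have hB0 : 0 ≤ B := by positivity
  refine ⟨B * K * μ.real univ, fun ε hε Y hY t => ?_⟩
  have hYt := hY.measurable_label t
  obtain ⟨r, hr0, hr⟩ := hρ.exists_rhoEps_le hε
  set U := preVelocity ρ L m₀ ε (fun η => Y η t) with hU
  have hUc : Continuous U := hp.continuous_preVelocity hρ hε hYt.aemeasurable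
  have hUb : ∀ x, |U x| ≤ B := hp.abs_preVelocity_le hρ hε _
  have hac : Continuous fun x => dx φ x t := (hφ.dx.contDiff_slice t).continuous
  have hUa : ∀ x, |U x * dx φ x t| ≤ B * b := fun x => by
    rw [abs_mul]; exact mul_le_mul (hUb x) (hb x t) (abs_nonneg _) hB0
  -- the outer mollifier of the velocity acts on the configuration and turns it into `m^ε`
  have key : ∫ x, fluxDensity (flowLayer μ w (GEps ρ ε) Y) (flowLayer μ w (dGEps ρ ε) Y) φ x t
      = ∫ θ, (rhoEps ρ ε ⋆ fun x => U x * dx φ x t) (Y θ t) * w θ ∂μ := by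
    have hu : ∀ x, HasDerivAt (fun x => flowLayer μ w (GEps ρ ε) Y x t)
        (flowLayer μ w (dGEps ρ ε) Y x t) x := fun x =>
      hp.hasDerivAt_layer_GEps hρ hε hYt.aemeasurable x
    have hv : ∀ x, HasDerivAt (fun x => flowLayer μ w (dGEps ρ ε) Y x t)
        (flowLayer μ w (GEps ρ ε) Y x t - flowLayer μ w (rhoEps ρ ε) Y x t) x := fun x =>
      hp.hasDerivAt_layer_dGEps hρ hε hYt.aemeasurable x
    have hm : Continuous fun x => flowLayer μ w (rhoEps ρ ε) Y x t := by
      refine continuous_of_dominated (bound := fun _ => r)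
        (fun x => (integrable_layer hp.measurable hp.abs_eq_one hρ.continuous_rhoEps.measurable hr
          hYt.aemeasurable x).aestronglyMeasurable)
        (fun x => Eventually.of_forall fun θ => ?_) (integrable_const _)
        (Eventually.of_forall fun θ => ?_)
      · rw [Real.norm_eq_abs, abs_mul, hp.abs_eq_one, mul_one]
        exact hr _
      · exact (hρ.continuous_rhoEps.comp (by fun_prop)).mul continuous_const
    have h1 := integral_flux_eq hu hv hm (fun x => hφ.dx.hasDerivAt_dx x t)
      (fun x => hφ.dx.dx.hasDerivAt_dx x t) (hφ.dx.hasCompactSupport_slice t)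
      (hφ.dx.dx.hasCompactSupport_slice t) (hφ.dx.dx.dx.contDiff_slice t).continuous
      (hφ.dx.dx.dx.hasCompactSupport_slice t)
    have h2 : ∀ x, (flowLayer μ w (GEps ρ ε) Y x t ^ 2 - flowLayer μ w (dGEps ρ ε) Y x t ^ 2) *
        flowLayer μ w (rhoEps ρ ε) Y x t * dx φ x t
        = layer μ w (rhoEps ρ ε) (fun θ => Y θ t) x * (U x * dx φ x t) := by
      intro x
      rw [hU, hp.preVelocity_eq hρ hε]
      simp only [flowLayer]
      ring
    simp only [h2] at h1
    rw [integral_layer_mul hp.measurable hp.abs_eq_one hρ.continuous_rhoEps.measurable hr hYt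
      (ψ := fun x => U x * dx φ x t) ((hUc.mul hac).integrable_of_hasCompactSupport
        (hφ.dx.hasCompactSupport_slice t).mul_left)] at h1
    simp only [fluxDensity]
    rw [← h1]
    simp only [hρ.convolution_eq_integral_mul]
  rw [key, ← integral_sub]
  · simp only [← sub_mul]
    have h3 := abs_integral_mul_le (μ := μ) hp.abs_eq_one (Eventually.of_forall fun θ =>
      hρ.abs_convolution_mul_sub_le hε hUc.measurable hUb hac.measurable (fun x => hb x t)
        (hK t) hK0 (Y θ t))
    refine h3.trans (le_of_eq ?_)
    ring
  · have hVm : Measurable fun θ => velocity ρ L m₀ ε (fun η => Y η t) (Y θ t) :=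
      measurable_uncurry_comp (hp.measurable_velocity hρ hε hY) hYt measurable_const
    refine integrable_mul_density (b := B * b) hp.measurable hp.abs_eq_one
      (hVm.mul (hac.measurable.comp hYt)).aemeasurable fun θ => ?_
    rw [abs_mul]
    exact mul_le_mul (hp.abs_velocity_le hρ hε _ _) (hb _ _) (abs_nonneg _) hB0
  · have hcm : Measurable (rhoEps ρ ε ⋆ fun x => U x * dx φ x t) := by
      have := (hρ.hasCompactSupport_rhoEps hε).continuous_convolution_left
        (ContinuousLinearMap.lsmul ℝ ℝ) (μ := volume) hρ.continuous_rhoEps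
        (g := fun x => U x * dx φ x t) (hUc.mul hac).locallyIntegrable
      exact this.measurable
    exact integrable_mul_density hp.measurable hp.abs_eq_one (hcm.comp hYt).aemeasurable
      fun θ => hρ.abs_convolution_le hε hUa _

end WeakForm

/-! ### Passage to the limit in the weak formulation -/

theorem integral_sub_sub {ν : Measure ℝ} {f g h : ℝ → ℝ} (hf : Integrable f ν)
    (hg : Integrable g ν) (hh : Integrable h ν) :
    ∫ x, (f x - g x - h x) ∂ν = (∫ x, f x ∂ν) - (∫ x, g x ∂ν) - ∫ x, h x ∂ν := by
  rw [← integral_sub hf hg]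
  exact integral_sub (hf.sub hg) hh

section Flux

variable {Ω : Set (ℝ × ℝ)} {u v φ : ℝ → ℝ → ℝ} {c : ℝ}

theorem abs_fluxDensity_le (hu : ∀ x t, |u x t| ≤ c) (hv : ∀ x t, |v x t| ≤ c) (x t : ℝ) :
    |fluxDensity u v φ x t| ≤ 2 * c ^ 3 * |dx φ x t| + c ^ 3 * |dx (dx φ) x t|
      + c ^ 3 * |dx (dx (dx φ)) x t| := by
  have hc : 0 ≤ c := (abs_nonneg _).trans (hu 0 0)
  have hu3 : |u x t ^ 3| ≤ c ^ 3 := by rw [abs_pow]; gcongr; exact hu x t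
  have hv3 : |v x t ^ 3| ≤ c ^ 3 := by rw [abs_pow]; gcongr; exact hv x t
  have huv : |u x t ^ 3 + u x t * v x t ^ 2| ≤ 2 * c ^ 3 := by
    have h : |u x t * v x t ^ 2| ≤ c * c ^ 2 := by
      rw [abs_mul, abs_pow]; gcongr
      · exact hu x t
      · exact hv x t
    refine (abs_add_le _ _).trans ((add_le_add hu3 h).trans (le_of_eq ?_))
    ring
  have h3 : ∀ {a d : ℝ}, |a| ≤ c ^ 3 → |1 / 3 * (a * d)| ≤ c ^ 3 * |d| := by
    intro a d ha
    rw [abs_mul, abs_mul, abs_of_pos (by norm_num : (0 : ℝ) < 1 / 3)]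
    have := mul_le_mul_of_nonneg_right ha (abs_nonneg d)
    have := mul_nonneg (abs_nonneg a) (abs_nonneg d)
    linarith
  refine (abs_sub _ _).trans (add_le_add ((abs_sub _ _).trans (add_le_add ?_ (h3 hv3))) (h3 hu3))
  rw [abs_mul]
  exact mul_le_mul_of_nonneg_right huv (abs_nonneg _)

theorem measurable_fluxDensity_slice (hu : Measurable (uncurry u)) (hv : Measurable (uncurry v))
    (hφ : IsTestFunction Ω φ) (t : ℝ) : Measurable fun x => fluxDensity u v φ x t := by
  have hm : ∀ {f : ℝ → ℝ → ℝ}, Measurable (uncurry f) → Measurable fun x => f x t := fun hf =>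
    hf.comp (by fun_prop : Measurable fun x : ℝ => (x, t))
  have h1 := hm hu
  have h2 := hm hv
  have h3 := hm hφ.dx.continuous.measurable
  have h4 := hm hφ.dx.dx.continuous.measurable
  have h5 := hm hφ.dx.dx.dx.continuous.measurable
  unfold fluxDensity
  fun_prop

theorem tendsto_integral_fluxDensity {U V : ℕ → ℝ → ℝ → ℝ} (hU : ∀ n, Measurable (uncurry (U n)))
    (hV : ∀ n, Measurable (uncurry (V n))) (hUc : ∀ n x t, |U n x t| ≤ c)
    (hVc : ∀ n x t, |V n x t| ≤ c) (hφ : IsTestFunction Ω φ) {t : ℝ}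
    (hu : ∀ᵐ x, Tendsto (fun n => U n x t) atTop (𝓝 (u x t)))
    (hv : ∀ᵐ x, Tendsto (fun n => V n x t) atTop (𝓝 (v x t))) :
    Tendsto (fun n => ∫ x, fluxDensity (U n) (V n) φ x t) atTop
      (𝓝 (∫ x, fluxDensity u v φ x t)) := by
  refine tendsto_integral_of_dominated_convergence
    (fun x => 2 * c ^ 3 * |dx φ x t| + c ^ 3 * |dx (dx φ) x t| + c ^ 3 * |dx (dx (dx φ)) x t|)
    (fun n => (measurable_fluxDensity_slice (hU n) (hV n) hφ t).aestronglyMeasurable)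
    (((((hφ.dx.integrable_slice t).abs).const_mul _).add
      ((hφ.dx.dx.integrable_slice t).abs.const_mul _)).add
      ((hφ.dx.dx.dx.integrable_slice t).abs.const_mul _))
    (fun n => Eventually.of_forall fun x => abs_fluxDensity_le (hUc n) (hVc n) x t) ?_
  filter_upwards [hu, hv] with x h1 h2
  unfold fluxDensity
  exact ((((h1.pow 3).add (h1.mul (h2.pow 2))).mul_const _).sub
    (((h2.pow 3).mul_const _).const_mul _)).sub (((h1.pow 3).mul_const _).const_mul _)

end Flux

/-- The time density of the weak formulation. -/
def weakDensity (u v φ : ℝ → ℝ → ℝ) (t : ℝ) : ℝ :=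
  (∫ x, u x t * (dt φ x t - dx (dx (dt φ)) x t)) + ∫ x, fluxDensity u v φ x t

section WeakDensity

variable {Ω : Set (ℝ × ℝ)} {u v φ : ℝ → ℝ → ℝ} {c : ℝ}

theorem dx_eq_zero {ψ : ℝ → ℝ → ℝ} {t : ℝ} (h : ∀ x, ψ x t = 0) (x : ℝ) : dx ψ x t = 0 := by
  simp only [dx, h, deriv_const]

theorem weakDensity_eq_zero {t : ℝ} (h : ∀ x, φ x t = 0) (h' : ∀ x, dt φ x t = 0) :
    weakDensity u v φ t = 0 := by
  have h1 := dx_eq_zero h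
  have h2 := dx_eq_zero h1
  have h3 := dx_eq_zero h2
  have h4 := dx_eq_zero (dx_eq_zero h')
  simp [weakDensity, fluxDensity, h1, h2, h3, h4, h']

/-- All slices in the weak formulation are integrable in time, so its integrals can be merged. -/
theorem weakFunctional_eq_integral (hu : Measurable (uncurry u)) (hv : Measurable (uncurry v))
    (huc : ∀ x t, |u x t| ≤ c) (hvc : ∀ x t, |v x t| ≤ c) (hφ : IsTestFunction Ω φ) :
    weakFunctional u v φ = ∫ t in Ioi (0 : ℝ), weakDensity u v φ t := by
  have hc : 0 ≤ c := (abs_nonneg _).trans (huc 0 0)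
  have hu3 : ∀ x t, |u x t ^ 3| ≤ c ^ 3 := fun x t => by rw [abs_pow]; gcongr; exact huc x t
  have hv3 : ∀ x t, |v x t ^ 3| ≤ c ^ 3 := fun x t => by rw [abs_pow]; gcongr; exact hvc x t
  have huv : ∀ x t, |u x t ^ 3 + u x t * v x t ^ 2| ≤ c ^ 3 + c * c ^ 2 := fun x t => by
    refine (abs_add_le _ _).trans (add_le_add (hu3 x t) ?_)
    rw [abs_mul, abs_pow]; gcongr
    · exact huc x t
    · exact hvc x t
  have mu3 : Measurable (uncurry fun x t => u x t ^ 3) := hu.pow_const 3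
  have mv3 : Measurable (uncurry fun x t => v x t ^ 3) := hv.pow_const 3
  have muv : Measurable (uncurry fun x t => u x t ^ 3 + u x t * v x t ^ 2) :=
    (hu.pow_const 3).add (hu.mul (hv.pow_const 2))
  have e1 : ∀ t, ∫ x, u x t * (dt φ x t - dx (dx (dt φ)) x t)
      = (∫ x, u x t * dt φ x t) - ∫ x, u x t * dx (dx (dt φ)) x t := fun t => by
    rw [← integral_sub (integrable_mul_slice hu huc hφ.dt t)
      (integrable_mul_slice hu huc hφ.dt.dx.dx t)]
    simp only [mul_sub]
  have e2 : ∀ t, ∫ x, fluxDensity u v φ x t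
      = (∫ x, (u x t ^ 3 + u x t * v x t ^ 2) * dx φ x t)
        - 1 / 3 * (∫ x, v x t ^ 3 * dx (dx φ) x t)
        - 1 / 3 * ∫ x, u x t ^ 3 * dx (dx (dx φ)) x t := fun t => by
    unfold fluxDensity
    have i1 := integrable_mul_slice muv huv hφ.dx t
    have i2 := integrable_mul_slice mv3 hv3 hφ.dx.dx t
    have i3 := integrable_mul_slice mu3 hu3 hφ.dx.dx.dx t
    rw [integral_sub_sub i1 (i2.const_mul _) (i3.const_mul _), integral_const_mul,
      integral_const_mul]
  have i0 : Integrable fun t => ∫ x, u x t * (dt φ x t - dx (dx (dt φ)) x t) := by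
    simp only [e1]
    exact (integrable_integral_mul hu huc hφ.dt).sub (integrable_integral_mul hu huc hφ.dt.dx.dx)
  have i1 := (integrable_integral_mul muv huv hφ.dx).restrict (s := Ioi 0)
  have i2 := ((integrable_integral_mul mv3 hv3 hφ.dx.dx).const_mul (1 / 3)).restrict (s := Ioi 0)
  have i3 := ((integrable_integral_mul mu3 hu3 hφ.dx.dx.dx).const_mul (1 / 3)).restrict
    (s := Ioi 0)
  simp only [weakDensity, e2]
  have i4 := (i1.sub i2).sub i3
  simp only [Pi.sub_def] at i4
  rw [integral_add i0.restrict i4, integral_sub_sub i1 i2 i3, integral_const_mul,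
    integral_const_mul, weakFunctional]
  ring

end WeakDensity

section Limit

variable {m₀ : SignedMeasure ℝ} {L : ℝ} {μ : Measure ℝ} [IsFiniteMeasure μ] {w : ℝ → ℝ}
  {ρ : ℝ → ℝ} {C : ℝ} {X : ℝ → ℝ → ℝ} {Y : ℕ → ℝ → ℝ → ℝ} {e : ℕ → ℝ} {Ω : Set (ℝ × ℝ)}
  {φ : ℝ → ℝ → ℝ}

/-- The transport term converges at every time: the part with `φ_t` because the flows
converge, the part with `φ_x` because it is the flux up to `O(ε)`. -/
theorem tendsto_integral_transport (hp : IsPolar m₀ L μ w) (hρ : IsMollifier ρ)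
    (he : ∀ n, 0 < e n) (he0 : Tendsto e atTop (𝓝 0)) (hY : ∀ n, IsMotion L C (Y n))
    (hX : IsMotion L C X) (hlim : ∀ θ t, Tendsto (fun n => Y n θ t) atTop (𝓝 (X θ t)))
    (hφ : IsTestFunction Ω φ) (t : ℝ) :
    Tendsto (fun n => ∫ θ, transport ρ L m₀ (e n) (Y n) φ t θ * w θ ∂μ) atTop
      (𝓝 (weakDensity (flowLayer μ w G X) (flowLayer μ w dG X) φ t)) := by
  obtain ⟨b₁, h₁, hb₁⟩ := hφ.dt.exists_abs_le
  obtain ⟨b₂, h₂, hb₂⟩ := hφ.dx.exists_abs_le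
  have hdc : Continuous fun x => dt φ x t := (hφ.dt.contDiff_slice t).continuous
  have hxc : Continuous fun x => dx φ x t := (hφ.dx.contDiff_slice t).continuous
  have hsplit : ∀ n, ∫ θ, transport ρ L m₀ (e n) (Y n) φ t θ * w θ ∂μ
      = (∫ θ, dt φ (Y n θ t) t * w θ ∂μ)
        + ∫ θ, velocity ρ L m₀ (e n) (fun η => Y n η t) (Y n θ t) * dx φ (Y n θ t) t * w θ ∂μ := by
    intro n
    have hYt := (hY n).measurable_label t
    have hVm := measurable_uncurry_comp (hp.measurable_velocity hρ (he n) (hY n)) hYt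
      (measurable_const (a := t))
    rw [← integral_add]
    · simp only [transport, add_mul]
    · exact integrable_mul_density hp.measurable hp.abs_eq_one
        (hdc.measurable.comp hYt).aemeasurable fun θ => hb₁ _ _
    · refine integrable_mul_density (b := (1 / 2 * μ.real univ) ^ 2 * b₂) hp.measurable
        hp.abs_eq_one (hVm.mul (hxc.measurable.comp hYt)).aemeasurable fun θ => ?_
      rw [abs_mul]
      exact mul_le_mul (hp.abs_velocity_le hρ (he n) _ _) (hb₂ _ _) (abs_nonneg _)
        (by positivity)
  simp only [hsplit]
  refine Tendsto.add ?_ ?_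
  · have h1 : ∫ x, flowLayer μ w G X x t * (dt φ x t - dx (dx (dt φ)) x t)
        = ∫ θ, dt φ (X θ t) t * w θ ∂μ := by
      have hψ : Integrable fun x => dt φ x t - dx (dx (dt φ)) x t :=
        (hφ.dt.integrable_slice t).sub (hφ.dt.dx.dx.integrable_slice t)
      refine (integral_layer_mul hp.measurable hp.abs_eq_one continuous_G.measurable abs_G_le
        (hX.measurable_label t) hψ).trans ?_
      refine integral_congr_ae (Eventually.of_forall fun θ => ?_)
      exact congrArg (· * w θ) (integral_G_mul_helmholtz
        (contDiff_infty.1 (hφ.dt.contDiff_slice t) 2)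
        (hφ.dt.hasCompactSupport_slice t) (X θ t))
    rw [h1]
    refine tendsto_integral_of_dominated_convergence (fun _ => b₁)
      (fun n => (((hdc.measurable.comp ((hY n).measurable_label t))).mul
        hp.measurable).aestronglyMeasurable) (integrable_const _)
      (fun n => Eventually.of_forall fun θ => ?_) (Eventually.of_forall fun θ => ?_)
    · rw [Real.norm_eq_abs, abs_mul, hp.abs_eq_one, mul_one]
      exact hb₁ _ _
    · exact ((hdc.tendsto _).comp (hlim θ t)).mul_const _
  · obtain ⟨K, hK⟩ := hp.exists_abs_flux_sub_le (C := C) hρ hφ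
    have h2 : Tendsto (fun n => ∫ x, fluxDensity (flowLayer μ w (GEps ρ (e n)) (Y n))
        (flowLayer μ w (dGEps ρ (e n)) (Y n)) φ x t) atTop
        (𝓝 (∫ x, fluxDensity (flowLayer μ w G X) (flowLayer μ w dG X) φ x t)) := by
      refine tendsto_integral_fluxDensity (c := 1 / 2 * μ.real univ)
        (fun n => (hY n).measurable_flowLayer hp.measurable (continuous_GEps hρ (he n)).measurable)
        (fun n => (hY n).measurable_flowLayer hp.measurable
          (continuous_dGEps hρ (he n)).measurable)
        (fun n x t => abs_layer_le hp.abs_eq_one (abs_GEps_le hρ (he n)) x)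
        (fun n x t => abs_layer_le hp.abs_eq_one (abs_dGEps_le hρ (he n)) x) hφ
        (Eventually.of_forall fun x =>
          tendsto_flowLayer_GEps hp.measurable hp.abs_eq_one hρ he he0 hY hlim x t) ?_
      filter_upwards [hX.ae_measure_slice_eq_zero (μ := μ) t] with x hx
      exact tendsto_flowLayer_dGEps hp.measurable hp.abs_eq_one hρ he he0 hY hlim hx
    have h3 := squeeze_zero_norm (a := fun n => K * e n)
      (f := fun n => (∫ θ, velocity ρ L m₀ (e n) (fun η => Y n η t) (Y n θ t)
        * dx φ (Y n θ t) t * w θ ∂μ) - ∫ x, fluxDensity (flowLayer μ w (GEps ρ (e n)) (Y n))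
        (flowLayer μ w (dGEps ρ (e n)) (Y n)) φ x t)
      (fun n => hK (e n) (he n) (Y n) (hY n) t) (by simpa using he0.const_mul K)
    simpa using h3.add h2

/-- The weak formulation for the limit, with the time densities collected under one integral. -/
theorem IsMotion.integral_weakDensity (hp : IsPolar m₀ L μ w) (hρ : IsMollifier ρ) (hL : -L ≤ L)
    (he : ∀ n, 0 < e n) (he0 : Tendsto e atTop (𝓝 0)) {F : ℕ → ℝ → ℝ → ℝ}
    (hF : ∀ n, IsRegularizedFlow ρ L m₀ (e n) (F n))
    (hX : IsMotion L ((1 / 2 * μ.real univ) ^ 2) X)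
    (hlim : ∀ θ t, Tendsto (fun n => extendFlow L (F n) θ t) atTop (𝓝 (X θ t)))
    (hφ : IsTestFunction Ω φ) :
    ∫ t in Ioi 0, weakDensity (flowLayer μ w G X) (flowLayer μ w dG X) φ t
      = -∫ θ, φ θ 0 * w θ ∂μ := by
  obtain ⟨R₁, hR₁, hφR₁⟩ := hφ.exists_eq_zero
  obtain ⟨R₂, hR₂, hφR₂⟩ := hφ.dt.exists_eq_zero
  obtain ⟨b, hb0, hb⟩ := hp.exists_abs_transport_le hρ hφ
  -- after time `R` both `φ` and `φ_t` vanish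
  set R := max R₁ R₂ with hR
  have hR0 : 0 < R := lt_max_of_lt_left hR₁
  have hmo : ∀ n, IsMotion L ((1 / 2 * μ.real univ) ^ 2) (extendFlow L (F n)) := fun n =>
    (hF n).isMotion hp hρ (he n) hL
  have h1 : ∫ t in Ioi 0, weakDensity (flowLayer μ w G X) (flowLayer μ w dG X) φ t
      = ∫ t in Ioc 0 R, weakDensity (flowLayer μ w G X) (flowLayer μ w dG X) φ t := by
    refine setIntegral_eq_of_subset_of_forall_sdiff_eq_zero measurableSet_Ioi Ioc_subset_Ioi_self
      fun t ht => ?_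
    have hRt : R ≤ |t| := by
      by_contra hlt
      exact ht.2 ⟨ht.1, ((le_abs_self t).trans_lt (not_le.1 hlt)).le⟩
    exact weakDensity_eq_zero (fun x => hφR₁ x t (Or.inr ((le_max_left _ _).trans hRt)))
      fun x => hφR₂ x t (Or.inr ((le_max_right _ _).trans hRt))
  rw [h1]
  have h2 : Tendsto (fun n => ∫ t in Ioc 0 R,
      ∫ θ, transport ρ L m₀ (e n) (extendFlow L (F n)) φ t θ * w θ ∂μ) atTop
      (𝓝 (∫ t in Ioc 0 R, weakDensity (flowLayer μ w G X) (flowLayer μ w dG X) φ t)) := by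
    refine tendsto_integral_of_dominated_convergence (fun _ => b * μ.real univ) (fun n => ?_)
      (integrable_const _) (fun n => Eventually.of_forall fun t => ?_)
      (Eventually.of_forall fun t =>
        tendsto_integral_transport hp hρ he he0 hmo hX hlim hφ t)
    · have hm := (hp.measurable_transport hρ (he n) (hmo n) hφ).mul
        (hp.measurable.comp measurable_snd)
      exact (hm.stronglyMeasurable.integral_prod_right' (ν := μ)).aestronglyMeasurable
    · exact abs_integral_mul_le hp.abs_eq_one (Eventually.of_forall fun θ => hb _ (he n) _ _ _)
  refine tendsto_nhds_unique h2 (Tendsto.congr (fun n => ?_) tendsto_const_nhds)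
  refine ((hF n).integral_transport hp hρ (he n) hL hφ hR0 fun x t hxt => hφR₁ x t ?_).symm
  exact hxt.imp (le_max_left _ _).trans (le_max_left _ _).trans

theorem IsMotion.isGlobalWeakSolution (hp : IsPolar m₀ L μ w) (hρ : IsMollifier ρ) (hL : -L ≤ L)
    (he : ∀ n, 0 < e n) (he0 : Tendsto e atTop (𝓝 0)) {F : ℕ → ℝ → ℝ → ℝ}
    (hF : ∀ n, IsRegularizedFlow ρ L m₀ (e n) (F n))
    (hX : IsMotion L ((1 / 2 * μ.real univ) ^ 2) X)
    (hlim : ∀ θ t, Tendsto (fun n => extendFlow L (F n) θ t) atTop (𝓝 (X θ t))) :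
    IsGlobalWeakSolution m₀ (flowLayer μ w G X) (flowLayer μ w dG X) where
  continuousH1 := hX.isContinuousH1 hp.measurable hp.abs_eq_one
  boundedW1Inf := hX.isBoundedW1Inf hp.measurable hp.abs_eq_one
  weak φ hφ := by
    rw [weakFunctional_eq_integral (c := 1 / 2 * μ.real univ)
      (hX.measurable_flowLayer hp.measurable continuous_G.measurable)
      (hX.measurable_flowLayer hp.measurable measurable_dG)
      (fun x t => abs_layer_le hp.abs_eq_one abs_G_le x)
      (fun x t => abs_layer_le hp.abs_eq_one abs_dG_le x) hφ,
      hX.integral_weakDensity hp hρ hL he he0 hF hlim hφ, hp.integral_eq]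

end Limit

/-! ### The momentum as a measure in space-time -/

/-- The image under a measurable map of the signed measure with density `w = ±1`, built as the
difference of the images of its positive and negative parts. -/
theorem exists_signedMeasure_map {α β : Type*} [MeasurableSpace α] [MeasurableSpace β]
    (ν : Measure β) [IsFiniteMeasure ν] {w : β → ℝ} (hw : Measurable w) (hw1 : ∀ y, |w y| = 1)
    {Φ : β → α} (hΦ : Measurable Φ) : ∃ m : SignedMeasure α, ∀ (f : α → ℝ) (b : ℝ),
      Measurable f → (∀ x, |f x| ≤ b) → ∫ᵛ x, f x ∂•m = ∫ y, f (Φ y) * w y ∂ν := by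
  set S : Set β := {y | 0 ≤ w y} with hS
  have hSm : MeasurableSet S := measurableSet_le measurable_const hw
  refine ⟨((ν.restrict S).map Φ).toSignedMeasure - ((ν.restrict Sᶜ).map Φ).toSignedMeasure,
    fun f b hf hb => ?_⟩
  have hi : ∀ (η : Measure α) [IsFiniteMeasure η], Integrable f η := fun η _ =>
    Integrable.of_bound hf.aestronglyMeasurable b (Eventually.of_forall hb)
  have hfw : Integrable (fun y => f (Φ y) * w y) ν := by
    refine Integrable.of_bound ((hf.comp hΦ).mul hw).aestronglyMeasurable b
      (Eventually.of_forall fun y => ?_)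
    rw [norm_mul, Real.norm_eq_abs (w y), hw1, mul_one]
    exact hb _
  rw [VectorMeasure.integral_sub_vectorMeasure, integral_lsmul_toSignedMeasure,
    integral_lsmul_toSignedMeasure, integral_map hΦ.aemeasurable hf.aestronglyMeasurable,
    integral_map hΦ.aemeasurable hf.aestronglyMeasurable, ← integral_add_compl hSm hfw,
    sub_eq_add_neg, ← integral_neg]
  · congr 1
    · refine setIntegral_congr_fun hSm fun y hy => ?_
      have h := hw1 y
      rw [abs_of_nonneg hy] at h
      simp only [h, mul_one]
    · refine setIntegral_congr_fun hSm.compl fun y hy => ?_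
      have h := hw1 y
      rw [abs_of_neg (not_le.1 (mem_compl_iff _ _ |>.1 hy))] at h
      simp only [neg_eq_iff_eq_neg.1 h, mul_neg, mul_one]
  · simpa [VectorMeasure.Integrable] using hi _
  · simpa [VectorMeasure.Integrable] using hi _

theorem setIntegral_strip {f : ℝ × ℝ → ℝ} {I : Set ℝ} (hf : IntegrableOn f (univ ×ˢ I)) :
    ∫ p in univ ×ˢ I, f p = ∫ t in I, ∫ x, f (x, t) := by
  rw [IntegrableOn, Measure.volume_eq_prod, ← Measure.prod_restrict, Measure.restrict_univ] at hf
  rw [Measure.volume_eq_prod, ← Measure.prod_restrict, Measure.restrict_univ,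
    integral_prod_symm _ hf]

section Momentum

variable {m₀ : SignedMeasure ℝ} {L : ℝ} {μ : Measure ℝ} [IsFiniteMeasure μ] {w : ℝ → ℝ}
  {C T : ℝ} {X : ℝ → ℝ → ℝ}

/-- The momentum `m = ∫ δ_{(X(θ, t), t)} dm₀(θ) dt` of a motion. -/
theorem IsMotion.exists_momentum (hX : IsMotion L C X) (hw : Measurable w)
    (hw1 : ∀ x, |w x| = 1) (T : ℝ) : ∃ m : SignedMeasure (strip T), ∀ (f : ℝ × ℝ → ℝ) (b : ℝ),
      Measurable f → (∀ p, |f p| ≤ b) →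
      ∫ᵛ p : strip T, f p ∂•m = ∫ t in Ico 0 T, ∫ θ, f (X θ t, t) * w θ ∂μ := by
  set ν : Measure (Ico (0 : ℝ) T) := Measure.comap Subtype.val volume with hν
  have : IsFiniteMeasure ν := by
    refine ⟨?_⟩
    rw [hν, (MeasurableEmbedding.subtype_coe measurableSet_Ico).comap_apply, image_univ,
      Subtype.range_coe, Real.volume_Ico]
    exact ENNReal.ofReal_lt_top
  set Φ : Ico (0 : ℝ) T × ℝ → strip T := fun q => ⟨(X q.2 q.1, q.1), mem_univ _, q.1.2⟩ with hΦ
  have hΦm : Measurable Φ := by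
    refine Measurable.subtype_mk (Measurable.prodMk ?_ ?_)
    · exact hX.measurable.comp
        (measurable_snd.prodMk (measurable_subtype_coe.comp measurable_fst))
    · exact measurable_subtype_coe.comp measurable_fst
  obtain ⟨m, hm⟩ := exists_signedMeasure_map (ν.prod μ) (w := fun q => w q.2)
    (hw.comp measurable_snd) (fun q => hw1 q.2) hΦm
  refine ⟨m, fun f b hf hb => ?_⟩
  rw [hm (fun p => f p) b (hf.comp measurable_subtype_coe) fun p => hb p, integral_prod]
  · exact integral_subtype_comap measurableSet_Ico fun t => ∫ θ, f (X θ t, t) * w θ ∂μ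
  · refine Integrable.of_bound (C := b) ?_ (Eventually.of_forall fun q => ?_)
    · exact ((hf.comp (measurable_subtype_coe.comp hΦm)).mul
        (hw.comp measurable_snd)).aestronglyMeasurable
    · rw [norm_mul, Real.norm_eq_abs (w _), hw1, mul_one]
      exact hb _

theorem IsMotion.isHelmholtzMeasure (hX : IsMotion L C X) (hw : Measurable w)
    (hw1 : ∀ x, |w x| = 1) {m : SignedMeasure (strip T)}
    (hm : ∀ (f : ℝ × ℝ → ℝ) (b : ℝ), Measurable f → (∀ p, |f p| ≤ b) →
      ∫ᵛ p : strip T, f p ∂•m = ∫ t in Ico 0 T, ∫ θ, f (X θ t, t) * w θ ∂μ) :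
    IsHelmholtzMeasure T (flowLayer μ w G X) m := by
  intro φ hφ
  obtain ⟨b, hb0, hb⟩ := hφ.exists_abs_le
  have h1 := hm (uncurry φ) b hφ.continuous.measurable fun p => hb p.1 p.2
  have hi : Integrable fun p : ℝ × ℝ => φ p.1 p.2 - dx (dx φ) p.1 p.2 :=
    (hφ.continuous.integrable_of_hasCompactSupport hφ.2.1).sub
      (hφ.dx.dx.continuous.integrable_of_hasCompactSupport hφ.dx.dx.2.1)
  have hi2 : Integrable fun p : ℝ × ℝ =>
      flowLayer μ w G X p.1 p.2 * (φ p.1 p.2 - dx (dx φ) p.1 p.2) :=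
    hi.bdd_mul (c := 1 / 2 * μ.real univ)
      (hX.measurable_flowLayer hw continuous_G.measurable).aestronglyMeasurable
      (Eventually.of_forall fun p => abs_layer_le hw1 abs_G_le p.1)
  refine h1.trans ?_
  rw [strip, setIntegral_strip hi2.integrableOn]
  refine integral_congr_ae (Eventually.of_forall fun t => ?_)
  refine Eq.trans ?_ (integral_layer_mul hw hw1 continuous_G.measurable abs_G_le
    (hX.measurable_label t) ((hφ.integrable_slice t).sub (hφ.dx.dx.integrable_slice t))).symm
  refine integral_congr_ae (Eventually.of_forall fun θ => ?_)
  exact (congrArg (· * w θ) (integral_G_mul_helmholtz (contDiff_infty.1 (hφ.contDiff_slice t) 2)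
    (hφ.hasCompactSupport_slice t) (X θ t))).symm

end Momentum

section Regularized

variable {m₀ : SignedMeasure ℝ} {L : ℝ} {μ : Measure ℝ} {w : ℝ → ℝ}
  {ρ : ℝ → ℝ} {ε C T : ℝ} {X : ℝ → ℝ → ℝ}

theorem IsPolar.uEps_eq_flowLayer (hp : IsPolar m₀ L μ w) {t : ℝ} (ht : 0 ≤ t) (x : ℝ) :
    uEps ρ L m₀ ε X x t = flowLayer μ w (GEps ρ ε) (extendFlow L X) x t := by
  rw [hp.uEps_eq, flowLayer, hp.layer_extendFlow ht]

variable [IsFiniteMeasure μ]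

theorem IsPolar.dx_uEps_eq_flowLayer (hp : IsPolar m₀ L μ w) (hρ : IsMollifier ρ) (hε : 0 < ε)
    (hY : IsMotion L C (extendFlow L X)) {t : ℝ} (ht : 0 ≤ t) (x : ℝ) :
    dx (uEps ρ L m₀ ε X) x t = flowLayer μ w (dGEps ρ ε) (extendFlow L X) x t := by
  simp only [dx, hp.uEps_eq_flowLayer ht]
  exact (hp.hasDerivAt_layer_GEps hρ hε (hY.measurable_label t).aemeasurable x).deriv

/-- The regularized momentum is the superposition of the translates of `ρ_ε`. -/
theorem IsPolar.mEps_eq_flowLayer (hp : IsPolar m₀ L μ w) (hρ : IsMollifier ρ) (hε : 0 < ε)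
    (hY : IsMotion L C (extendFlow L X)) {t : ℝ} (ht : 0 ≤ t) (x : ℝ) :
    mEps ρ L m₀ ε X x t = flowLayer μ w (rhoEps ρ ε) (extendFlow L X) x t := by
  have h : dx (dx (uEps ρ L m₀ ε X)) x t
      = deriv (fun y => flowLayer μ w (dGEps ρ ε) (extendFlow L X) y t) x := by
    rw [dx]
    simp only [hp.dx_uEps_eq_flowLayer hρ hε hY ht]
  have h2 := (hp.hasDerivAt_layer_dGEps hρ hε (hY.measurable_label t).aemeasurable x).deriv
  rw [mEps, h, hp.uEps_eq_flowLayer ht]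
  refine (congrArg (_ - ·) h2).trans ?_
  rw [flowLayer, sub_sub_cancel, flowLayer]

/-- Testing `m^ε` with `φ` is testing the image of `m₀ ⊗ dt` under the regularized flow with
`ρ_ε * φ`. -/
theorem tendstoWeakStar_mEps (hp : IsPolar m₀ L μ w) (hρ : IsMollifier ρ) {e : ℕ → ℝ}
    (he : ∀ n, 0 < e n) (he0 : Tendsto e atTop (𝓝 0)) {F : ℕ → ℝ → ℝ → ℝ}
    (hY : ∀ n, IsMotion L C (extendFlow L (F n)))
    (hlim : ∀ θ t, Tendsto (fun n => extendFlow L (F n) θ t) atTop (𝓝 (X θ t)))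
    {m : SignedMeasure (strip T)}
    (hm : ∀ (f : ℝ × ℝ → ℝ) (b : ℝ), Measurable f → (∀ p, |f p| ≤ b) →
      ∫ᵛ p : strip T, f p ∂•m = ∫ t in Ico 0 T, ∫ θ, f (X θ t, t) * w θ ∂μ) :
    TendstoWeakStar T (fun n => mEps ρ L m₀ (e n) (F n)) m := by
  have hstrip : MeasurableSet (strip T) := MeasurableSet.univ.prod measurableSet_Ico
  have hmE : ∀ n, ∀ p ∈ strip T, mEps ρ L m₀ (e n) (F n) p.1 p.2
      = flowLayer μ w (rhoEps ρ (e n)) (extendFlow L (F n)) p.1 p.2 := fun n p hp' =>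
    hp.mEps_eq_flowLayer hρ (he n) (hY n) hp'.2.1 p.1
  have hi : ∀ n, IntegrableOn
      (uncurry (flowLayer μ w (rhoEps ρ (e n)) (extendFlow L (F n)))) (strip T) := fun n =>
    (hY n).integrableOn_flowLayer hp.measurable hp.abs_eq_one hρ.continuous_rhoEps.measurable
      (hρ.integrable_rhoEps (he n)) (by simp)
  refine ⟨fun n => (hi n).congr_fun (fun p hp' => (hmE n p hp').symm) hstrip, fun φ => ?_⟩
  obtain ⟨b, hb0, hb⟩ : ∃ b, 0 ≤ b ∧ ∀ p, |φ p| ≤ b :=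
    ⟨‖φ.toBCF‖, norm_nonneg _, fun p => φ.toBCF.norm_coe_le_norm p⟩
  -- the extension of `φ` by zero
  set ψ : ℝ × ℝ → ℝ := extend Subtype.val φ 0 with hψ
  have hψm : Measurable ψ := (MeasurableEmbedding.subtype_coe hstrip).measurable_extend
    φ.continuous.measurable measurable_zero
  have hψφ : ∀ p : strip T, ψ p = φ p := fun p => Subtype.val_injective.extend_apply _ _ p
  have hψb : ∀ p, |ψ p| ≤ b := by
    intro p
    by_cases hp' : p ∈ strip T
    · exact (hψφ ⟨p, hp'⟩).symm ▸ hb _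
    · rw [hψ, extend_apply' _ _ _ (by rintro ⟨a, rfl⟩; exact hp' a.2)]
      simpa using hb0
  have hψt : ∀ t, Measurable fun x => ψ (x, t) := fun t => hψm.comp (by fun_prop)
  have hψc : ∀ t ∈ Ico 0 T, Continuous fun x => ψ (x, t) := by
    intro t ht
    have : (fun x => ψ (x, t)) = fun x => φ ⟨(x, t), mem_univ _, ht⟩ :=
      funext fun x => hψφ ⟨(x, t), mem_univ _, ht⟩
    rw [this]
    exact φ.continuous.comp (by fun_prop)
  have hlhs : ∀ n, ∫ p : strip T, φ p * mEps ρ L m₀ (e n) (F n) p.1.1 p.1.2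
      ∂volume.comap Subtype.val
      = ∫ t in Ico 0 T, ∫ θ, (rhoEps ρ (e n) ⋆ fun x => ψ (x, t)) (extendFlow L (F n) θ t)
          * w θ ∂μ := by
    intro n
    have e1 : ∀ p : strip T, φ p * mEps ρ L m₀ (e n) (F n) p.1.1 p.1.2
        = (fun p : ℝ × ℝ => flowLayer μ w (rhoEps ρ (e n)) (extendFlow L (F n)) p.1 p.2 * ψ p) p :=
      fun p => by rw [← hψφ, hmE n p p.2, mul_comm]
    simp only [e1]
    rw [integral_subtype_comap hstrip (fun p : ℝ × ℝ =>
      flowLayer μ w (rhoEps ρ (e n)) (extendFlow L (F n)) p.1 p.2 * ψ p)]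
    refine (setIntegral_strip ((hi n).mul_bdd (c := b) hψm.aestronglyMeasurable
      (Eventually.of_forall hψb))).trans ?_
    refine integral_congr_ae (Eventually.of_forall fun t => ?_)
    refine (integral_layer_mul_of_bounded hp.measurable hp.abs_eq_one
      hρ.continuous_rhoEps.measurable (hρ.integrable_rhoEps (he n)) ((hY n).measurable_label t)
      (hψt t) fun x => hψb (x, t)).trans ?_
    simp only [hρ.convolution_eq_integral_mul]
  have hrhs : ∫ᵛ p : strip T, φ p ∂•m = ∫ t in Ico 0 T, ∫ θ, ψ (X θ t, t) * w θ ∂μ := by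
    simp only [← hψφ]
    exact hm ψ b hψm hψb
  simp only [hlhs]
  rw [hrhs]
  have hconv : ∀ n, Measurable (uncurry fun y t => (rhoEps ρ (e n) ⋆ fun x => ψ (x, t)) y) :=
    fun n => measurable_convolution_slice (U := fun x t => ψ (x, t))
      hρ.continuous_rhoEps.measurable hψm
  have hcb : ∀ n t y, |(rhoEps ρ (e n) ⋆ fun x => ψ (x, t)) y| ≤ b := fun n t y =>
    hρ.abs_convolution_le (he n) (fun x => hψb (x, t)) y
  refine tendsto_integral_of_dominated_convergence (fun _ => b * μ.real univ) (fun n => ?_)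
    (integrable_const _) (fun n => Eventually.of_forall fun t =>
      abs_integral_mul_le hp.abs_eq_one (Eventually.of_forall fun θ => hcb n t _)) ?_
  · have h := (measurable_uncurry_comp (α := ℝ × ℝ) (hconv n)
      ((hY n).measurable.comp measurable_swap) measurable_fst).mul
      (hp.measurable.comp measurable_snd)
    exact (h.stronglyMeasurable.integral_prod_right' (ν := μ)).aestronglyMeasurable
  · filter_upwards [ae_restrict_mem measurableSet_Ico] with t ht
    refine tendsto_integral_of_dominated_convergence (fun _ => b) (fun n => ?_)
      (integrable_const _) (fun n => Eventually.of_forall fun θ => ?_)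
      (Eventually.of_forall fun θ => ?_)
    · exact ((measurable_uncurry_comp (hconv n) ((hY n).measurable_label t)
        measurable_const).mul hp.measurable).aestronglyMeasurable
    · rw [Real.norm_eq_abs, abs_mul, hp.abs_eq_one, mul_one]
      exact hcb n t _
    · exact (hρ.tendsto_convolution he he0 (hψt t) (hψc t ht).continuousAt (hlim θ t)).mul_const _

end Regularized

end

end MCH

theorem theorem1p4 (m₀ : SignedMeasure ℝ) (L : ℝ) (hL : 0 < L)
    (hm₀ : m₀.variation.support ⊆ Ioo (-L) L)
    (ρ : ℝ → ℝ) (hρ : MCH.IsMollifier ρ) :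
    -- The regularized Lagrangian dynamics has exactly one global solution for every `ε > 0`.
    (∀ ε : ℝ, 0 < ε → ∃ X : ℝ → ℝ → ℝ, MCH.IsRegularizedFlow ρ L m₀ ε X ∧
      ∀ Y : ℝ → ℝ → ℝ, MCH.IsRegularizedFlow ρ L m₀ ε Y →
        ∀ ξ ∈ Icc (-L) L, ∀ t, 0 ≤ t → Y ξ t = X ξ t) ∧
    -- Every sequence `ε n → 0` has a subsequence along which the approximations converge to a
    -- global weak solution `u`, with `v = u_x`.
    ∀ X : ℝ → ℝ → ℝ → ℝ, (∀ ε : ℝ, 0 < ε → MCH.IsRegularizedFlow ρ L m₀ ε (X ε)) →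
    ∀ ε : ℕ → ℝ, (∀ n, 0 < ε n) → Tendsto ε atTop (𝓝 0) →
    ∃ k : ℕ → ℕ, StrictMono k ∧ ∃ u v : ℝ → ℝ → ℝ,
      MCH.TendstoL1Loc (fun n => MCH.uEps ρ L m₀ (ε (k n)) (X (ε (k n)))) u ∧
      MCH.TendstoL1Loc (fun n => MCH.dx (MCH.uEps ρ L m₀ (ε (k n)) (X (ε (k n))))) v ∧
      MCH.IsGlobalWeakSolution m₀ u v ∧
      MCH.IsContinuousH1 u v ∧ MCH.IsBoundedW1Inf u v ∧
      ∀ T : ℝ, 0 < T →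
        MCH.IsBV u (univ ×ˢ Ioo 0 T) ∧ MCH.IsBV v (univ ×ˢ Ioo 0 T) ∧
        ∃ m : SignedMeasure (MCH.strip T), MCH.IsHelmholtzMeasure T u m ∧
          MCH.TendstoWeakStar T
            (fun n => MCH.mEps ρ L m₀ (ε (k n)) (X (ε (k n)))) m := by
  open MCH in
  obtain ⟨μ, w, hμ, hp⟩ := exists_isPolar m₀ L hm₀
  have hL' : -L ≤ L := by linarith
  have hw := hp.measurable
  have hw1 := hp.abs_eq_one
  refine ⟨fun ε hε => ?_, fun X hX ε hε hε0 => ?_⟩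
  · obtain ⟨X, hX⟩ := hp.exists_isRegularizedFlow hρ hε hL'
    exact ⟨X, hX, fun Y hY ξ hξ t ht => hX.unique hp hρ hε hL' hY hξ ht⟩
  obtain ⟨k, hk, Z, hZ, hlim⟩ := exists_subseq_tendsto_flow hL'
    (fun n => (hX (ε n) (hε n)).isMotion hp hρ (hε n) hL')
    (fun n => (hX (ε n) (hε n)).monotone_extendFlow hp hρ (hε n) hL')
  have hF : ∀ n, IsRegularizedFlow ρ L m₀ (ε (k n)) (X (ε (k n))) := fun n => hX _ (hε _)
  have he : ∀ n, 0 < ε (k n) := fun n => hε _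
  have he0 : Tendsto (fun n => ε (k n)) atTop (𝓝 0) := hε0.comp hk.tendsto_atTop
  have hY := fun n => (hF n).isMotion hp hρ (he n) hL'
  refine ⟨k, hk, flowLayer μ w G Z, flowLayer μ w dG Z, ?_, ?_,
    hZ.isGlobalWeakSolution hp hρ hL' he he0 hF hlim, hZ.isContinuousH1 hw hw1,
    hZ.isBoundedW1Inf hw hw1, fun T _ => ⟨?_, ?_, ?_⟩⟩
  · refine tendstoL1Loc_of_ae (b := 1 / 2 * μ.real univ)
      (fun n => (hY n).measurable_flowLayer hw (continuous_GEps hρ (he n)).measurable)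
      (hZ.measurable_flowLayer hw continuous_G.measurable)
      (fun n x t ht => hp.uEps_eq_flowLayer ht x)
      (fun n x t => abs_layer_le hw1 (abs_GEps_le hρ (he n)) x)
      (Eventually.of_forall fun p => ?_)
    exact tendsto_flowLayer_GEps hw hw1 hρ he he0 hY hlim p.1 p.2
  · refine tendstoL1Loc_of_ae (b := 1 / 2 * μ.real univ)
      (fun n => (hY n).measurable_flowLayer hw (continuous_dGEps hρ (he n)).measurable)
      (hZ.measurable_flowLayer hw measurable_dG)
      (fun n x t ht => hp.dx_uEps_eq_flowLayer hρ (he n) (hY n) ht x)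
      (fun n x t => abs_layer_le hw1 (abs_dGEps_le hρ (he n)) x) ?_
    filter_upwards [hZ.ae_measure_eq_zero (μ := μ)] with p hp'
    exact tendsto_flowLayer_dGEps hw hw1 hρ he he0 hY hlim hp'
  · exact hZ.isBV_flowLayer (by positivity) hw hw1 continuous_G.measurable integrable_G abs_G_le
      (by norm_num) hasL1Modulus_G T
  · exact hZ.isBV_flowLayer (by positivity) hw hw1 measurable_dG integrable_dG abs_dG_le
      (by norm_num) hasL1Modulus_dG T
  · obtain ⟨m, hm⟩ := hZ.exists_momentum (μ := μ) hw hw1 T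
    exact ⟨m, hZ.isHelmholtzMeasure hw hw1 hm, tendstoWeakStar_mEps hp hρ he he0 hY hlim hm⟩
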